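/- Let $n\ge 2$ and let $M$ be a smooth manifold of dimension $4n+3$ (so $\dim M>7$). Throughout, $(a,b,c)$ denotes a cyclic permutation of $(1,2,3)$, and $d\eta(X,Y)=X\eta(Y)-Y\eta(X)-\eta([X,Y])$. **Quaternionic contact structures.** Let $M$ carry a quaternionic contact structure with a chosen metric $\gamma$ in its conformal class: a corank three subbundle $Q\subset TM$, a metric $\gamma$ on $Q$ and a two-sphere bundle $\mathbb I$ of $\gamma$-orthogonal complex structures of $Q$ such that locally there are sections $I_1,I_2,I_3$ of $\mathbb I$ with $I_1I_2=-I_2I_1=I_3$, $\mathbb I=\{\sum v_aI_a : |v|=1\}$, and an $\mathbb R^3$-valued one-form $\eta=(\eta_1,\eta_2,\eta_3)$ with kernel $Q$ and $\gamma(I_aX,Y)=d\eta_a(X,Y)$ for $X,Y\in Q$. The *Reeb three-plane field* $Q^\perp$ is the rank three subbundle of $TM$ locally spanned by vector fields $R_1,R_2,R_3$ with $\eta_a(R_b)=\delta_{ab}$ and $d\eta_a(R_a,X)=0$ for $X\in Q$. **Quaternionic pseudohermitian structures.** An almost hyper CR structure on an open set $U\subset M$ consists of almost CR structures $(Q_1,I_1),(Q_2,I_2)$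 (corank one subbundles with complex structures), transversal to each other, with $I_1I_2=-I_2I_1$ on $I_1(Q_1\cap Q_2)\cap I_2(Q_1\cap Q_2)$; it determines a third one by $Q_3=I_1(Q_1\cap Q_2)+I_2(Q_1\cap Q_2)$, $I_3=-I_2I_1$ on $I_1(Q_1\cap Q_2)$ and $I_3=I_1I_2$ on $I_2(Q_1\cap Q_2)$. Put $Q=Q_1\cap Q_2\cap Q_3$. It is a hyper CR structure if, for all $X,Y\in\Gamma(Q)$ and all $a$, $N_a:=[X,Y]-[I_aX,I_aY]\in\Gamma(Q_a)$ and $I_aN_a-[X,I_aY]-[I_aX,Y]\in\Gamma(Q)$. A one-form $\theta=(\theta_1,\theta_2,\theta_3)$ is compatible with it if $\ker\theta_a=Q_a$ and $\theta_c\circ I_a=\theta_b$ on $Q_a$; its Levi form is the form on $Q$ given by $\mathrm{Levi}_\theta(X,Y)=\frac12\bigl(d\theta_a(X,I_aY)+d\theta_a(I_bX,I_cY)\bigr)$, which does not depend on $a$. An admissible triple is a triple $(T_1,T_2,T_3)$ of vector fields spanning a complement of $Q$ with $T_a\in\Gamma(Q_b\cap Q_c)$ and $I_aT_b=T_c$.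 For a unit vector $v\in\mathbb R^3$ put $Q_v=Q\oplus\{\sum x_aT_a : \sum x_av_a=0\}$ and $I_v=\bigl(\sum v_a\widetilde I_a\bigr)|_{Q_v}$, where $\widetilde I_a$ extends $I_a$ by $\widetilde I_aT_a=0$ (this does not depend on the admissible triple). A quaternionic pseudohermitian structure on $M$ is a covering of $M$ by local hyper CR structures with compatible one-forms $\theta$ of positive definite Levi form, such that on overlaps $\theta'_a=\sum_b s_{ab}\theta_b$, $Q'_v=Q_{S^{\mathsf T}v}$, $I'_v=I_{S^{\mathsf T}v}$ for a smooth $SO(3)$-valued function $S=(s_{ab})$. The bundle $Q$ and the Levi form $g$ on $Q$ are then globally defined. The structure is ultra-pseudoconvex if $h(X,Y)=(2n+4)g(X,Y)-\sum_a d\theta_a(X,I_aY)$ is definite on $Q$. A three-plane field is admissible if it is spanned by an admissible triple over the domain of each local hyper CR structure. **Canonical three-plane field and connection.** For an admissible three-plane field $P$, the associated connection $\nabla$ is the connection on $TM$ such that: $\nabla$ preserves $Q$ and $P$; $g$ on $Q$ and $g^\perp=\theta_1^2+\theta_2^2+\theta_3^2$ on $P$ are parallel; and, with components taken along $TM=Q\oplus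 P$, $\mathrm{Tor}(X,Y)_Q=0$ for $X,Y\in Q$, $\mathrm{Tor}(V,W)_P=0$ for $V,W\in P$, the map $X\mapsto\mathrm{Tor}(V,X)_Q$ on $Q$ is $g$-symmetric for $V\in P$, and the map $V\mapsto\mathrm{Tor}(V,X)_P$ on $P$ is $g^\perp$-symmetric for $X\in Q$. Let $\omega$ be its connection matrix on $Q$, restricted to $Q$, in local $g$-orthonormal frames consisting of quadruples $\varepsilon,I_1\varepsilon,I_2\varepsilon,I_3\varepsilon$; let $\omega^{\rm obs}\in Q^*\otimes(sp(n)+sp(1))^\perp$ be its component orthogonal to $sp(n)+sp(1)$ in $so(4n)$, and $\omega^{E\otimes H}$ the $E\otimes H$-isotypic component of $\omega^{\rm obs}$ under $Sp(n)\cdot Sp(1)$, where $E\otimes H=\mathbb H^n\otimes\mathbb C$ is the complexified standard representation. For an ultra-pseudoconvex structure, the *canonical three-plane field* is the unique admissible three-plane field whose associated connection satisfies $\omega^{E\otimes H}=0$, and that connection is the *canonical connection*. **Induced structure.** If $P$ is a three-plane field complementary to $Q$ in the quaternionic contact manifold $M$, the induced quaternionic pseudohermitian structure is given, for each local choice of $(I_a)$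 and $(\eta_a)$ as above, by $\theta_a=\eta_a$, by $Q_a=Q\oplus\mathbb RT_b\oplus\mathbb RT_c$, where $T_1,T_2,T_3$ are the sections of $P$ with $\eta_a(T_b)=\delta_{ab}$, and by the extension of $I_a$ to $Q_a$ with $I_aT_b=T_c$, $I_aT_c=-T_b$. **Proposition.** The Reeb three-plane field $Q^\perp$ of $M$ exists and is unique. The structure induced by $Q^\perp$ is an ultra-pseudoconvex quaternionic pseudohermitian structure with underlying bundle $Q$ and Levi form $\gamma$, and $Q^\perp$ is its canonical three-plane field. The connection associated with $Q^\perp$ exists, it is the canonical connection of this structure, and the canonical connection is unique. -/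

import Mathlib

open Bundle Set Filter Topology TopologicalSpace Module VectorField
open scoped Manifold ContDiff Matrix

noncomputable section

namespace QuaternionicCR

/-! ## Linear algebra: the model `ℍⁿ = ℝ⁴ⁿ` of `Sp(n)·Sp(1)` and the `E ⊗ H`-component

The standard basis of `ℍⁿ` is indexed by `Fin 4 × Fin n`: for fixed `k : Fin n`, the vectors
`(0, k), (1, k), (2, k), (3, k)` are `ε, I₁ε, I₂ε, I₃ε`. -/

/-- Matrices of left multiplication by `i`, `j`, `k` on `ℍ` in the basis `1, i, j, k`. -/
def quatUnit : Fin 3 → Matrix (Fin 4) (Fin 4) ℝ :=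
  ![!![0, -1, 0, 0; 1, 0, 0, 0; 0, 0, 0, -1; 0, 0, 1, 0],
    !![0, 0, -1, 0; 0, 0, 0, 1; 1, 0, 0, 0; 0, -1, 0, 0],
    !![0, 0, 0, -1; 0, 0, -1, 0; 0, 1, 0, 0; 1, 0, 0, 0]]

/-- The three standard complex structures of `ℝ⁴ⁿ = ℍⁿ`. -/
def modelJ (n : ℕ) (a : Fin 3) : Matrix (Fin 4 × Fin n) (Fin 4 × Fin n) ℝ :=
  Matrix.blockDiagonal fun _ => quatUnit a

/-- The group `Sp(n)·Sp(1)` in `SO(4n)`: products of an orthogonal matrix commuting with the three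
complex structures and of a unit quaternion `c₀ + c₁ I₁ + c₂ I₂ + c₃ I₃`. -/
def SpSp1 (n : ℕ) : Set (Matrix (Fin 4 × Fin n) (Fin 4 × Fin n) ℝ) :=
  {A | ∃ (B : Matrix (Fin 4 × Fin n) (Fin 4 × Fin n) ℝ) (c₀ : ℝ) (c : Fin 3 → ℝ),
    Bᵀ * B = 1 ∧ (∀ a, B * modelJ n a = modelJ n a * B) ∧ c₀ ^ 2 + ∑ a, c a ^ 2 = 1 ∧
    A = B * (c₀ • (1 : Matrix (Fin 4 × Fin n) (Fin 4 × Fin n) ℝ) + ∑ a, c a • modelJ n a)}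

/-- The Lie algebra `sp(n)`: skew-symmetric matrices commuting with the complex structures. -/
def spAlg (n : ℕ) : Submodule ℝ (Matrix (Fin 4 × Fin n) (Fin 4 × Fin n) ℝ) where
  carrier := {B | Bᵀ = -B ∧ ∀ a, B * modelJ n a = modelJ n a * B}
  add_mem' := by
    rintro A B ⟨hA, hA'⟩ ⟨hB, hB'⟩
    refine ⟨by rw [Matrix.transpose_add, hA, hB, neg_add], fun a => ?_⟩
    rw [add_mul, mul_add, hA' a, hB' a]
  zero_mem' := by simp
  smul_mem' := by
    rintro c B ⟨hB, hB'⟩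
    refine ⟨by rw [Matrix.transpose_smul, hB, smul_neg], fun a => ?_⟩
    rw [smul_mul_assoc, mul_smul_comm, hB' a]

/-- The Lie algebra `sp(n) + sp(1)` in `so(4n)`. -/
def spSp1Alg (n : ℕ) : Submodule ℝ (Matrix (Fin 4 × Fin n) (Fin 4 × Fin n) ℝ) :=
  spAlg n ⊔ Submodule.span ℝ (range (modelJ n))

/-- Three-index tensors `T (i, j, k)` on `ℝ⁴ⁿ`, with the Euclidean inner product. -/
abbrev Tensor3 (n : ℕ) : Type :=
  EuclideanSpace ℝ ((Fin 4 × Fin n) × (Fin 4 × Fin n) × (Fin 4 × Fin n))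

/-- The module `(ℍⁿ)* ⊗ (sp(n) + sp(1))^⊥`: for each `i` the matrix `T (i, ·, ·)` is in `so(4n)` and
orthogonal to `sp(n) + sp(1)` (on `so(4n)` the Killing form is a negative multiple of
`(A, C) ↦ ∑ A j k * C j k`). -/
def obsSpace (n : ℕ) : Submodule ℝ (Tensor3 n) where
  carrier := {T | ∀ i, (∀ j k, T (i, j, k) = -T (i, k, j)) ∧
    ∀ C ∈ spSp1Alg n, ∑ j, ∑ k, T (i, j, k) * C j k = 0}
  add_mem' := by
    intro S T hS hT i
    refine ⟨fun j k => ?_, fun C hC => ?_⟩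
    · simp only [PiLp.add_apply]
      rw [(hS i).1 j k, (hT i).1 j k]; ring
    · have h1 := (hS i).2 C hC
      have h2 := (hT i).2 C hC
      simp only [PiLp.add_apply, add_mul, Finset.sum_add_distrib, h1, h2, add_zero]
  zero_mem' := by intro i; simp
  smul_mem' := by
    intro c T hT i
    refine ⟨fun j k => ?_, fun C hC => ?_⟩
    · simp only [PiLp.smul_apply, smul_eq_mul]
      rw [(hT i).1 j k]; ring
    · have h := (hT i).2 C hC
      simp only [PiLp.smul_apply, smul_eq_mul, mul_assoc, ← Finset.mul_sum, h, mul_zero]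

/-- `f : ℍⁿ → (ℍⁿ)* ⊗ (sp(n) + sp(1))^⊥` is a linear map of `Sp(n)·Sp(1)`-modules. -/
def IsEquivariant (n : ℕ) (f : (Fin 4 × Fin n → ℝ) →ₗ[ℝ] Tensor3 n) : Prop :=
  (∀ w, f w ∈ obsSpace n) ∧
  ∀ A ∈ SpSp1 n, ∀ w i j k, f (A *ᵥ w) (i, j, k) =
    ∑ i', ∑ j', ∑ k', A i i' * A j j' * A k k' * f w (i', j', k')

/-- The component of type `E ⊗ H` of `(ℍⁿ)* ⊗ (sp(n) + sp(1))^⊥`: the sum of all its submodules that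
are images of `ℍⁿ`. (The irreducible module `ℍⁿ` has complexification `E ⊗ H`.) -/
def ehSpace (n : ℕ) : Submodule ℝ (Tensor3 n) :=
  ⨆ (f : (Fin 4 × Fin n → ℝ) →ₗ[ℝ] Tensor3 n) (_ : IsEquivariant n f), LinearMap.range f

/-- The `(sp(n) + sp(1))^⊥`-component `ω^obs` of a tensor `T = ω`. -/
def omegaObs (n : ℕ) (T : Tensor3 n) : Tensor3 n := (obsSpace n).starProjection T

/-- The component `ω^{E⊗H}` of `ω^obs`. -/
def omegaEH (n : ℕ) (T : Tensor3 n) : Tensor3 n := (ehSpace n).starProjection (omegaObs n T)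

/-! ## Calculus on a manifold of dimension `4n + 3` -/

/-- The model space `ℝ^{4n+3}`. -/
abbrev Mdl (n : ℕ) : Type := EuclideanSpace ℝ (Fin (4 * n + 3))

/-- The tangent space of `M` at `q`. -/
abbrev Tan (n : ℕ) {M : Type*} [TopologicalSpace M] [ChartedSpace (Mdl n) M] (q : M) : Type :=
  TangentSpace 𝓘(ℝ, Mdl n) q

section Manifold

variable {n : ℕ} {M : Type*} [TopologicalSpace M] [ChartedSpace (Mdl n) M]
  [IsManifold 𝓘(ℝ, Mdl n) ∞ M]

/-- The vector field `X` is smooth at `q`. -/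
def SmoothAt (X : ∀ p : M, Tan n p) (q : M) : Prop :=
  ContMDiffAt 𝓘(ℝ, Mdl n) (𝓘(ℝ, Mdl n).prod 𝓘(ℝ, Mdl n)) ∞
    (fun p => (TotalSpace.mk' (Mdl n) p (X p) : TangentBundle 𝓘(ℝ, Mdl n) M)) q

/-- The vector field `X` is differentiable at `q`. -/
def DiffAt (X : ∀ p : M, Tan n p) (q : M) : Prop :=
  MDifferentiableAt 𝓘(ℝ, Mdl n) (𝓘(ℝ, Mdl n).prod 𝓘(ℝ, Mdl n))
    (fun p => (TotalSpace.mk' (Mdl n) p (X p) : TangentBundle 𝓘(ℝ, Mdl n) M)) q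

/-- The one-form `η` is smooth on the set `U`. -/
def SmoothFormOn (η : ∀ p : M, Tan n p →L[ℝ] ℝ) (U : Set M) : Prop :=
  ContMDiffOn 𝓘(ℝ, Mdl n) (𝓘(ℝ, Mdl n).prod 𝓘(ℝ, Mdl n →L[ℝ] ℝ)) ∞
    (fun p => TotalSpace.mk' (Mdl n →L[ℝ] ℝ)
      (E := fun x : M => Tan n x →L[ℝ] Bundle.Trivial M ℝ x) p (η p)) U

/-- The derivative `v f` of a real function `f` in the direction of the tangent vector `v`. -/
def dirDeriv (f : M → ℝ) (q : M) (v : Tan n q) : ℝ := mvfderiv 𝓘(ℝ, Mdl n) f q v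

/-- The exterior derivative of a one-form,
`dη(X, Y) = X (η(Y)) - Y (η(X)) - η([X, Y])`, at two tangent vectors, which are extended to
vector fields near `q`. The value does not depend on the extensions, see `dForm_apply`. -/
def dForm (η : ∀ p : M, Tan n p →L[ℝ] ℝ) (q : M) (v w : Tan n q) : ℝ :=
  dirDeriv (fun p => η p (FiberBundle.extend (Mdl n) w p)) q v
    - dirDeriv (fun p => η p (FiberBundle.extend (Mdl n) v p)) q w
    - η q (mlieBracket 𝓘(ℝ, Mdl n) (FiberBundle.extend (Mdl n) v) (FiberBundle.extend (Mdl n) w) q)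

/-- The value of `dη` at `q` can be computed with any vector fields `X`, `Y`
differentiable at `q`. -/
theorem dForm_apply {η : ∀ p : M, Tan n p →L[ℝ] ℝ} {U : Set M} (hU : IsOpen U)
    (hη : SmoothFormOn η U) {q : M} (hq : q ∈ U)
    {X Y : ∀ p : M, Tan n p}
    (hX : DiffAt X q) (hY : DiffAt Y q) :
    dForm η q (X q) (Y q) = dirDeriv (fun p => η p (Y p)) q (X q)
      - dirDeriv (fun p => η p (X p)) q (Y q) - η q (mlieBracket 𝓘(ℝ, Mdl n) X Y q) := by
  have hη' := ((hη q hq).contMDiffAt (hU.mem_nhds hq)).mdifferentiableAt (by simp)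
  have key : ∀ Z : ∀ p : M, Tan n p, DiffAt Z q →
      MDifferentiableAt 𝓘(ℝ, Mdl n) 𝓘(ℝ, ℝ) (fun p => η p (Z p)) q := by
    intro Z hZ
    have := MDifferentiableAt.clm_bundle_apply (E₂ := Bundle.Trivial M ℝ) hη' hZ
    rw [mdifferentiableAt_totalSpace] at this
    simpa using this.2
  let Φ : (∀ p : M, Tan n p) → (∀ p : M, Tan n p) → ℝ :=
    fun X Y => dirDeriv (fun p => η p (Y p)) q (X q)
      - dirDeriv (fun p => η p (X p)) q (Y q) - η q (mlieBracket 𝓘(ℝ, Mdl n) X Y q)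
  have h1 : ∀ Y : ∀ p : M, Tan n p, DiffAt Y q →
      TensorialAt 𝓘(ℝ, Mdl n) (Mdl n) (fun X => Φ X Y) q := by
    intro Y hY
    constructor
    · intro f X hf hX
      have e : (fun p => η p ((f • X) p)) = fun p => f p * η p (X p) := by
        funext p; simp
      simp only [Φ, dirDeriv]
      rw [e, mvfderiv_fun_mul hf (key X hX), mlieBracket_smul_left hf hX]
      simp
      ring
    · intro X X' hX hX'
      have e : (fun p => η p ((X + X') p)) = fun p => η p (X p) + η p (X' p) := by
        funext p; simp
      simp only [Φ, dirDeriv]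
      rw [e, mvfderiv_fun_add (key X hX) (key X' hX'), mlieBracket_add_left hX hX']
      simp
      ring
  have hsw : ∀ X Y : ∀ p : M, Tan n p, Φ X Y = -Φ Y X := by
    intro X Y
    simp only [Φ]
    rw [mlieBracket_swap_apply, map_neg]
    ring
  have h2 : ∀ X : ∀ p : M, Tan n p, DiffAt X q →
      TensorialAt 𝓘(ℝ, Mdl n) (Mdl n) (fun Y => Φ X Y) q := by
    intro X hX
    constructor
    · intro f Y hf hY
      rw [hsw, (h1 X hX).smul hf hY, hsw Y X, smul_neg, neg_neg]
    · intro Y Y' hY hY'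
      rw [hsw, (h1 X hX).add hY hY', hsw Y X, hsw Y' X]
      ring
  have e1 := TensorialAt.mkHom₂_apply (Φ := Φ) (x := q) h1 h2 hX hY
  have e2 : Φ (FiberBundle.extend (Mdl n) (X q)) (FiberBundle.extend (Mdl n) (Y q)) = Φ X Y := e1
  simpa [Φ, dForm] using e2

/-- `D` restricts to a smooth subbundle of `TM` of rank `r` over the set `U`. -/
def IsSmoothSubbundleOn (D : ∀ q : M, Submodule ℝ (Tan n q)) (r : ℕ) (U : Set M) : Prop :=
  ∀ q ∈ U, ∃ V : Opens M, q ∈ V ∧ ∃ X : Fin r → ∀ p : M, Tan n p,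
    ∀ p ∈ V, (∀ i, SmoothAt (X i) p) ∧ LinearIndependent ℝ (fun i => X i p) ∧
      (p ∈ U → Submodule.span ℝ (range fun i => X i p) = D p)

/-- The endomorphisms `J` of the bundle `D` are smooth over `U`: they map smooth sections to smooth
sections. -/
def SmoothEndOn (D : ∀ q : M, Submodule ℝ (Tan n q)) (J : ∀ q : M, Module.End ℝ (D q))
    (U : Set M) : Prop :=
  ∀ q ∈ U, ∀ Y : ∀ p : M, D p, SmoothAt (fun p => (Y p : Tan n p)) q →
    SmoothAt (fun p => (J p (Y p) : Tan n p)) q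

/-! ## Hyper and quaternionic CR structures -/

variable (n M) in
/-- The data of a local hyper CR structure with a compatible one-form, over the open set `U`:
the hyperplane fields `Q₁, Q₂, Q₃`, the endomorphisms `I₁, I₂, I₃` (with `I_a` acting on `Q_a`), and
the components of `θ = (θ₁, θ₂, θ₃)`. Indices `1, 2, 3` become `0, 1, 2 : Fin 3`, so that
the cyclic permutations of `(1, 2, 3)` are the triples `(a, a + 1, a + 2)`. Only the
values at points of `U` matter. -/
structure LocalData where
  /-- the domain -/
  U : Opens M
  /-- the hyperplane fields -/
  D : Fin 3 → ∀ q : M, Submodule ℝ (Tan n q)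
  /-- the complex structures -/
  J : ∀ (a : Fin 3) (q : M), Module.End ℝ (D a q)
  /-- the one-forms -/
  θ : Fin 3 → ∀ q : M, Tan n q →L[ℝ] ℝ

namespace LocalData

variable (L : LocalData n M)

/-- The corank three field `Q = Q₁ ∩ Q₂ ∩ Q₃`. -/
def Q (q : M) : Submodule ℝ (Tan n q) := ⨅ a, L.D a q

open Classical in
/-- `I_a v` for `v ∈ Q_a` (and `0` for other tangent vectors). -/
def ap (a : Fin 3) (q : M) (v : Tan n q) : Tan n q :=
  if h : v ∈ L.D a q then (L.J a q ⟨v, h⟩ : Tan n q) else 0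

/-- `L` is an almost hyper CR structure on its domain: `(Q₁, I₁)` and `(Q₂, I₂)` are
almost CR structures, `Q₁` and `Q₂` are transversal, `I₁I₂ = -I₂I₁` where both sides make sense,
and `(Q₃, I₃)` is the third almost CR structure which they determine. -/
structure IsAlmostHyperCR : Prop where
  subbundle : ∀ a, IsSmoothSubbundleOn (L.D a) (4 * n + 2) L.U
  smooth_J : ∀ a, SmoothEndOn (L.D a) (L.J a) L.U
  sq : ∀ q ∈ L.U, ∀ a, ∀ v : L.D a q, L.J a q (L.J a q v) = -v
  transversal : ∀ q ∈ L.U, L.D 0 q ⊔ L.D 1 q = ⊤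
  anticomm : ∀ q ∈ L.U, ∀ v : Tan n q,
    (∃ x ∈ L.D 0 q ⊓ L.D 1 q, v = L.ap 0 q x) → (∃ y ∈ L.D 0 q ⊓ L.D 1 q, v = L.ap 1 q y) →
      L.ap 0 q (L.ap 1 q v) = -L.ap 1 q (L.ap 0 q v)
  third_bundle : ∀ q ∈ L.U, ∀ v : Tan n q, v ∈ L.D 2 q ↔
    ∃ x ∈ L.D 0 q ⊓ L.D 1 q, ∃ y ∈ L.D 0 q ⊓ L.D 1 q, v = L.ap 0 q x + L.ap 1 q y
  third_left : ∀ q ∈ L.U, ∀ x ∈ L.D 0 q ⊓ L.D 1 q,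
    L.ap 2 q (L.ap 0 q x) = -L.ap 1 q (L.ap 0 q (L.ap 0 q x))
  third_right : ∀ q ∈ L.U, ∀ y ∈ L.D 0 q ⊓ L.D 1 q,
    L.ap 2 q (L.ap 1 q y) = L.ap 0 q (L.ap 1 q (L.ap 1 q y))

/-- The integrability condition for an almost hyper CR structure. -/
def IsIntegrable : Prop :=
  ∀ q ∈ L.U, ∀ X Y : ∀ p : M, L.Q p,
    SmoothAt (fun p => (X p : Tan n p)) q → SmoothAt (fun p => (Y p : Tan n p)) q → ∀ a,
      let N : Tan n q := mlieBracket 𝓘(ℝ, Mdl n) (fun p => (X p : Tan n p)) (fun p => Y p) q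
        - mlieBracket 𝓘(ℝ, Mdl n) (fun p => L.ap a p (X p)) (fun p => L.ap a p (Y p)) q
      N ∈ L.D a q ∧
      L.ap a q N - mlieBracket 𝓘(ℝ, Mdl n) (fun p => (X p : Tan n p)) (fun p => L.ap a p (Y p)) q
        - mlieBracket 𝓘(ℝ, Mdl n) (fun p => L.ap a p (X p)) (fun p => Y p) q ∈ L.Q q

/-- The one-form `θ` is compatible with the almost hyper CR structure: `ker θ_a = Q_a`, and
`θ₃ ∘ I₁ = θ₂` on `Q₁`, `θ₁ ∘ I₂ = θ₃` on `Q₂`, `θ₂ ∘ I₃ = θ₁` on `Q₃`. -/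
structure IsCompatible : Prop where
  smooth : ∀ a, SmoothFormOn (L.θ a) L.U
  ker : ∀ q ∈ L.U, ∀ a, ∀ v : Tan n q, v ∈ L.D a q ↔ L.θ a q v = 0
  comp : ∀ q ∈ L.U, ∀ a, ∀ v ∈ L.D a q, L.θ (a + 2) q (L.ap a q v) = L.θ (a + 1) q v

/-- The bilinear form `½ (dθ_a(X, I_a Y) + dθ_a(I_b X, I_c Y))` on `Q`; for an integrable structure
it does not depend on `a`, and it is the Levi form of `θ`. -/
def levi (a : Fin 3) (q : M) (X Y : Tan n q) : ℝ :=
  (dForm (L.θ a) q X (L.ap a q Y)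
    + dForm (L.θ a) q (L.ap (a + 1) q X) (L.ap (a + 2) q Y)) / 2

/-- `(t₁, t₂, t₃)` is an admissible triple at the point `q`: it spans a complement of `Q`, and
`t_a ∈ Q_b ∩ Q_c`, `I_a t_b = t_c`. -/
structure IsAdmissibleAt (q : M) (t : Fin 3 → Tan n q) : Prop where
  transverse : IsCompl (L.Q q) (Submodule.span ℝ (range t))
  mem : ∀ a, t a ∈ L.D (a + 1) q ⊓ L.D (a + 2) q
  rel : ∀ a, L.ap a q (t (a + 1)) = t (a + 2)

/-- `A_a` is the extension of `I_a` to the whole tangent space with `A_a t_a = 0`. -/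
def IsExtension (q : M) (t : Fin 3 → Tan n q) (A : Fin 3 → Module.End ℝ (Tan n q)) : Prop :=
  ∀ a, (∀ v ∈ L.D a q, A a v = L.ap a q v) ∧ A a (t a) = 0

/-- The hyperplane `Q_v = Q ⊕ {∑ x_a t_a | ∑ x_a v_a = 0}`, for a unit vector `v`. -/
def Qv (q : M) (t : Fin 3 → Tan n q) (v : Fin 3 → ℝ) : Submodule ℝ (Tan n q) :=
  L.Q q ⊔ Submodule.span ℝ {w | ∃ x : Fin 3 → ℝ, x ⬝ᵥ v = 0 ∧ w = ∑ a, x a • t a}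

end LocalData

/-- The gluing condition at the point `q`, for a rotation `S`: one has `Q'_v = Q_{Sᵀv}` and
`I'_v = I_{Sᵀv}` for all unit vectors `v`, and `θ'_a = ∑ s_ab θ_b`. Here `I_v` is the restriction of
`∑ v_a A_a` to `Q_v`, with `A` the extension of `(I₁, I₂, I₃)` given by an
admissible triple. -/
def GluesAt (L L' : LocalData n M) (q : M) (S : Matrix (Fin 3) (Fin 3) ℝ) : Prop :=
  (∀ a, L'.θ a q = ∑ b, S a b • L.θ b q) ∧
  ∀ t t' : Fin 3 → Tan n q, L.IsAdmissibleAt q t → L'.IsAdmissibleAt q t' →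
  ∀ A A' : Fin 3 → Module.End ℝ (Tan n q), L.IsExtension q t A → L'.IsExtension q t' A' →
  ∀ v : Fin 3 → ℝ, v ⬝ᵥ v = 1 →
    L'.Qv q t' v = L.Qv q t (Sᵀ *ᵥ v) ∧
    ∀ w ∈ L'.Qv q t' v, ∑ a, v a • A' a w = ∑ a, (Sᵀ *ᵥ v) a • A a w

/-- `𝒜` is (an atlas of) a quaternionic pseudohermitian structure with underlying corank three
bundle `Q` and with Levi form `g`: a covering by local hyper CR structures with compatible
one-forms, glued by smooth `SO(3)`-valued functions, for which the Levi form is positive definite. -/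
structure IsQuaternionicPseudohermitian (𝒜 : Set (LocalData n M))
    (Q : ∀ q : M, Submodule ℝ (Tan n q)) (g : ∀ q : M, LinearMap.BilinForm ℝ (Q q)) : Prop where
  covers : ∀ q : M, ∃ L ∈ 𝒜, q ∈ L.U
  almost : ∀ L ∈ 𝒜, L.IsAlmostHyperCR
  integrable : ∀ L ∈ 𝒜, L.IsIntegrable
  compatible : ∀ L ∈ 𝒜, L.IsCompatible
  glue : ∀ L ∈ 𝒜, ∀ L' ∈ 𝒜, ∃ S : M → Matrix (Fin 3) (Fin 3) ℝ,
    (∀ a b, ContMDiffOn 𝓘(ℝ, Mdl n) 𝓘(ℝ, ℝ) ∞ (fun q => S q a b) (L.U ∩ L'.U : Set M)) ∧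
    ∀ q ∈ (L.U ∩ L'.U : Set M), S q ∈ Matrix.specialOrthogonalGroup (Fin 3) ℝ ∧
      GluesAt L L' q (S q)
  underlying : ∀ L ∈ 𝒜, ∀ q ∈ L.U, Q q = L.Q q
  levi : ∀ L ∈ 𝒜, ∀ q ∈ L.U, ∀ a, ∀ X Y : Q q, g q X Y = L.levi a q X Y
  pos : ∀ (q : M) (X : Q q), X ≠ 0 → 0 < g q X X

/-- Ultra-pseudoconvexity: the form `h = (2n + 4) Levi_θ - ∑ dθ_a(·, I_a ·)` on `Q` is definite. As
its quaternion-hermitian part is `(2n + 1) Levi_θ`, and the Levi form `g` is positive definite, this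
means that `h` is positive definite. -/
def IsUltraPseudoconvex (𝒜 : Set (LocalData n M))
    (Q : ∀ q : M, Submodule ℝ (Tan n q)) (g : ∀ q : M, LinearMap.BilinForm ℝ (Q q)) : Prop :=
  ∀ L ∈ 𝒜, ∀ q ∈ L.U, ∀ X : Q q, X ≠ 0 →
    0 < (2 * (n : ℝ) + 4) * g q X X - ∑ a, dForm (L.θ a) q X (L.ap a q X)

/-- `P` is an admissible three-plane field: over the domain of each local hyper CR structure, it is
spanned by an admissible triple of smooth vector fields. -/
def IsAdmissible (𝒜 : Set (LocalData n M)) (P : ∀ q : M, Submodule ℝ (Tan n q)) : Prop :=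
  ∀ L ∈ 𝒜, ∃ T : Fin 3 → ∀ q : M, Tan n q, ∀ q ∈ L.U,
    (∀ a, SmoothAt (T a) q) ∧ L.IsAdmissibleAt q (fun a => T a q) ∧
    P q = Submodule.span ℝ (range fun a => T a q)

/-- The form `g^⊥ = θ₁² + θ₂² + θ₃²`. -/
def gPerp (L : LocalData n M) (q : M) (u v : Tan n q) : ℝ := ∑ a, L.θ a q u * L.θ a q v

variable (n M) in
/-- Affine connections on `M`; `D Y q v` is `(∇_v Y)(q)`. -/
abbrev Connection : Type _ :=
  CovariantDerivative 𝓘(ℝ, Mdl n) (Mdl n) (fun q : M => TangentSpace 𝓘(ℝ, Mdl n) q)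

/-- `D` is the connection on `TM` associated with the pseudohermitian structure `𝒜` and with the
admissible three-plane field `P`: it is smooth, it preserves `Q` and `P`, it makes the Levi form `g`
and `g^⊥` parallel, and its torsion satisfies the four normalizations, in which components are
taken with respect to the splitting `TM = Q ⊕ P`. -/
structure IsAssociatedConnection (𝒜 : Set (LocalData n M))
    (Q : ∀ q : M, Submodule ℝ (Tan n q)) (g : ∀ q : M, LinearMap.BilinForm ℝ (Q q))
    (P : ∀ q : M, Submodule ℝ (Tan n q)) (D : Connection n M) : Prop where
  smooth : CovariantDerivative.ContMDiffCovariantDerivative D ∞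
  compl : ∀ q : M, IsCompl (Q q) (P q)
  preserves_Q : ∀ (q : M) (Y : ∀ p : M, Q p), SmoothAt (fun p => (Y p : Tan n p)) q →
    ∀ v : Tan n q, D (fun p => (Y p : Tan n p)) q v ∈ Q q
  preserves_P : ∀ (q : M) (V : ∀ p : M, P p), SmoothAt (fun p => (V p : Tan n p)) q →
    ∀ v : Tan n q, D (fun p => (V p : Tan n p)) q v ∈ P q
  parallel_g : ∀ (q : M) (Y Z : ∀ p : M, Q p),
    ∀ (hY : SmoothAt (fun p => (Y p : Tan n p)) q) (hZ : SmoothAt (fun p => (Z p : Tan n p)) q),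
    ∀ v : Tan n q, dirDeriv (fun p => g p (Y p) (Z p)) q v =
      g q ⟨D (fun p => (Y p : Tan n p)) q v, preserves_Q q Y hY v⟩ (Z q)
        + g q (Y q) ⟨D (fun p => (Z p : Tan n p)) q v, preserves_Q q Z hZ v⟩
  parallel_gPerp : ∀ L ∈ 𝒜, ∀ q ∈ L.U, ∀ V W : ∀ p : M, P p,
    SmoothAt (fun p => (V p : Tan n p)) q → SmoothAt (fun p => (W p : Tan n p)) q →
    ∀ v : Tan n q, dirDeriv (fun p => gPerp L p (V p) (W p)) q v =
      gPerp L q (D (fun p => (V p : Tan n p)) q v) (W q)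
        + gPerp L q (V q) (D (fun p => (W p : Tan n p)) q v)
  tor_a : ∀ (q : M) (X Y : Q q), (Q q).projectionOnto (P q) (compl q) (D.torsion q X Y) = 0
  tor_b : ∀ (q : M) (V W : P q),
    (P q).projectionOnto (Q q) (compl q).symm (D.torsion q V W) = 0
  tor_c : ∀ (q : M) (V : P q) (X Y : Q q),
    g q ((Q q).projectionOnto (P q) (compl q) (D.torsion q V X)) Y =
      g q X ((Q q).projectionOnto (P q) (compl q) (D.torsion q V Y))
  tor_d : ∀ L ∈ 𝒜, ∀ q ∈ L.U, ∀ (X : Q q) (V W : P q),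
    gPerp L q ((P q).projectionOnto (Q q) (compl q).symm (D.torsion q V X)) W =
      gPerp L q V ((P q).projectionOnto (Q q) (compl q).symm (D.torsion q W X))

/-- `ε` is an adapted local frame of `Q` near `q`: it is smooth and orthonormal for `g`, and
`ε (a, k) = I_a (ε (0, k))` for `a = 1, 2, 3`. -/
structure IsAdaptedFrameAt (L : LocalData n M)
    (Q : ∀ q : M, Submodule ℝ (Tan n q)) (g : ∀ q : M, LinearMap.BilinForm ℝ (Q q))
    (q : M) (ε : Fin 4 × Fin n → ∀ p : M, Q p) : Prop where
  smooth : ∀ i, SmoothAt (fun p => (ε i p : Tan n p)) q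
  orthonormal : ∀ᶠ p in 𝓝 q, ∀ i j, g p (ε i p) (ε j p) = if i = j then 1 else 0
  adapted : ∀ᶠ p in 𝓝 q, ∀ (a : Fin 3) (k : Fin n),
    (ε (a.succ, k) p : Tan n p) = L.ap a p (ε (0, k) p)

/-- The condition `ω^{E⊗H} = 0` on a connection preserving `Q`: in every adapted local frame, the
coefficients `w (i, j, k)` of the `Q`-partial connection, defined by
`∇_{ε_i} ε_j = ∑_k w (i, j, k) ε_k`, have vanishing `E ⊗ H`-component. -/
def EHVanishes (𝒜 : Set (LocalData n M))
    (Q : ∀ q : M, Submodule ℝ (Tan n q)) (g : ∀ q : M, LinearMap.BilinForm ℝ (Q q))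
    (D : Connection n M) : Prop :=
  ∀ L ∈ 𝒜, ∀ q ∈ L.U, ∀ ε : Fin 4 × Fin n → ∀ p : M, Q p, IsAdaptedFrameAt L Q g q ε →
  ∀ w : Tensor3 n,
    (∀ i j, D (fun p => (ε j p : Tan n p)) q (ε i q) = ∑ k, w (i, j, k) • (ε k q : Tan n q)) →
    omegaEH n w = 0

/-- `P` is admissible, and its associated connection satisfies `ω^{E⊗H} = 0`. -/
def SatisfiesEH (𝒜 : Set (LocalData n M))
    (Q : ∀ q : M, Submodule ℝ (Tan n q)) (g : ∀ q : M, LinearMap.BilinForm ℝ (Q q))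
    (P : ∀ q : M, Submodule ℝ (Tan n q)) : Prop :=
  IsAdmissible 𝒜 P ∧ ∃ D : Connection n M, IsAssociatedConnection 𝒜 Q g P D ∧ EHVanishes 𝒜 Q g D

/-- `P` is the canonical three-plane field of the pseudohermitian structure `𝒜`: the unique
admissible three-plane field whose associated connection satisfies `ω^{E⊗H} = 0`. -/
def IsCanonicalThreePlaneField (𝒜 : Set (LocalData n M))
    (Q : ∀ q : M, Submodule ℝ (Tan n q)) (g : ∀ q : M, LinearMap.BilinForm ℝ (Q q))
    (P : ∀ q : M, Submodule ℝ (Tan n q)) : Prop :=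
  SatisfiesEH 𝒜 Q g P ∧
    ∀ P' : ∀ q : M, Submodule ℝ (Tan n q), SatisfiesEH 𝒜 Q g P' → P' = P

/-- `D` is the canonical connection of the pseudohermitian structure `𝒜`: the connection associated
with the canonical three-plane field. -/
def IsCanonicalConnection (𝒜 : Set (LocalData n M))
    (Q : ∀ q : M, Submodule ℝ (Tan n q)) (g : ∀ q : M, LinearMap.BilinForm ℝ (Q q))
    (D : Connection n M) : Prop :=
  ∃ P : ∀ q : M, Submodule ℝ (Tan n q),
    IsCanonicalThreePlaneField 𝒜 Q g P ∧ IsAssociatedConnection 𝒜 Q g P D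

/-! ## Quaternionic contact structures -/

/-- Over the open set `U`, the `I_a` are smooth sections of the sphere bundle `𝕀` which satisfy the
quaternion relations and determine `𝕀`, and `η` is an `ℝ³`-valued one-form with kernel `Q` such that
`γ(I_a X, Y) = dη_a(X, Y)` on `Q`. -/
structure IsContactFrame (Q : ∀ q : M, Submodule ℝ (Tan n q))
    (γ : ∀ q : M, LinearMap.BilinForm ℝ (Q q)) (𝕀 : ∀ q : M, Set (Module.End ℝ (Q q)))
    (U : Opens M) (I : Fin 3 → ∀ q : M, Module.End ℝ (Q q))
    (η : Fin 3 → ∀ q : M, Tan n q →L[ℝ] ℝ) : Prop where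
  smooth_I : ∀ a, SmoothEndOn Q (I a) U
  quat : ∀ q ∈ U, I 0 q * I 1 q = I 2 q ∧ I 1 q * I 0 q = -I 2 q
  sphere : ∀ q ∈ U, 𝕀 q = {J | ∃ v : Fin 3 → ℝ, v ⬝ᵥ v = 1 ∧ J = ∑ a, v a • I a q}
  smooth_η : ∀ a, SmoothFormOn (η a) U
  ker : ∀ q ∈ U, ∀ v : Tan n q, v ∈ Q q ↔ ∀ a, η a q v = 0
  compat : ∀ q ∈ U, ∀ a, ∀ X Y : Q q, γ q (I a q X) Y = dForm (η a) q X Y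

variable (n M) in
/-- A quaternionic contact structure on the `(4n + 3)`-dimensional manifold `M`, with a choice of a
metric `γ` on `Q` in its conformal class. (All the conditions are invariant under a conformal change
of `γ`, with the corresponding change of the one-forms, so that such a structure is
the same as a quaternionic contact structure together with a metric in its conformal class.) -/
structure QCStructure where
  /-- the corank three bundle -/
  Q : ∀ q : M, Submodule ℝ (Tan n q)
  /-- the metric on it -/
  γ : ∀ q : M, LinearMap.BilinForm ℝ (Q q)
  /-- the two-sphere bundle of complex structures -/
  sphere : ∀ q : M, Set (Module.End ℝ (Q q))
  subbundle : IsSmoothSubbundleOn Q (4 * n) univ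
  smooth_γ : ∀ (q : M) (X Y : ∀ p : M, Q p), SmoothAt (fun p => (X p : Tan n p)) q →
    SmoothAt (fun p => (Y p : Tan n p)) q →
    ContMDiffAt 𝓘(ℝ, Mdl n) 𝓘(ℝ, ℝ) ∞ (fun p => γ p (X p) (Y p)) q
  symm : ∀ (q : M) (X Y : Q q), γ q X Y = γ q Y X
  pos : ∀ (q : M) (X : Q q), X ≠ 0 → 0 < γ q X X
  sq : ∀ q : M, ∀ I ∈ sphere q, I * I = -1
  hermitian : ∀ q : M, ∀ I ∈ sphere q, ∀ X Y : Q q, γ q (I X) (I Y) = γ q X Y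
  local_frame : ∀ q : M, ∃ U : Opens M, q ∈ U ∧ ∃ I η, IsContactFrame Q γ sphere U I η

namespace QCStructure

variable (C : QCStructure n M)

/-- `P` is the Reeb three-plane field: near every point it is spanned by vector fields `R₁, R₂, R₃`
with `η_a(R_b) = δ_ab` and `dη_a(R_a, X) = 0` for `X ∈ Q`, for some choice of the local
frame `(I, η)`. -/
def IsReebField (P : ∀ q : M, Submodule ℝ (Tan n q)) : Prop :=
  ∀ q : M, ∃ U : Opens M, q ∈ U ∧ ∃ I η, IsContactFrame C.Q C.γ C.sphere U I η ∧
    ∃ R : Fin 3 → ∀ p : M, Tan n p, ∀ p ∈ U,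
      (∀ a, SmoothAt (R a) p) ∧
      (∀ a b, η a p (R b p) = if a = b then 1 else 0) ∧
      (∀ a, ∀ X : C.Q p, dForm (η a) p (R a p) X = 0) ∧
      P p = Submodule.span ℝ (range fun a => R a p)

/-- The quaternionic pseudohermitian structure induced by `C` and a three-plane field `P`
complementary to `Q`. Its local data are obtained from the local frames `(I, η)` as follows:
`θ = η`, and if `t₁, t₂, t₃` in `P` are given by `η_a(t_b) = δ_ab`, then
`Q_a = Q ⊕ ℝ t_b ⊕ ℝ t_c`, and `I_a` is extended to `Q_a` by `I_a t_b = t_c`, `I_a t_c = -t_b`. -/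
def induced (P : ∀ q : M, Submodule ℝ (Tan n q)) : Set (LocalData n M) :=
  {L | ∃ I η, IsContactFrame C.Q C.γ C.sphere L.U I η ∧ ∀ q ∈ L.U,
    (∀ a, L.θ a q = η a q) ∧
    ∃ t : Fin 3 → Tan n q, (∀ a, t a ∈ P q) ∧ (∀ a b, η a q (t b) = if a = b then 1 else 0) ∧
      ∀ a, L.D a q = C.Q q ⊔ Submodule.span ℝ {t (a + 1), t (a + 2)} ∧
        (∀ X : C.Q q, L.ap a q X = (I a q X : Tan n q)) ∧
        L.ap a q (t (a + 1)) = t (a + 2) ∧ L.ap a q (t (a + 2)) = -t (a + 1)}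

end QCStructure

end Manifold

end QuaternionicCR

end

noncomputable section

namespace QuaternionicCR

/-! ## Linear algebra of the model `ℍⁿ` -/

section Model

variable {n : ℕ}

/-! Everything rests on one fact: `dη_a` is closed. In an adapted orthonormal frame of `Q` the
functions `dη_a(ε_i, ε_j)` are constant, so evaluating `d(dη_a) = 0` on three frame fields leaves
only the terms `dη_a([ε_i, ε_j], ε_k)`. Given a triple `t` dual to `η`, the brackets are encoded by
a tensor `w`, skew in its last two slots, and by the `t_b`. The result is the algebraic equation
`StructEq`, linking `w` to the forms `α_ab = dη_a(t_b, ·)` on `Q` (`structEq_of_bracket`). Tracing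
it against the complex structures gives linear relations between a few contractions of `w` and the
`α_ab`. If all `α_aa` equal one form `κ`, eliminating `w` gives `(4n - 4)(α_ab + α_ba) = 0` for `a ≠
b` (`structEq_antisymm`), and another combination gives `n · ehForm w = -3(2n + 1)(n - 1) κ`
(`ehForm_eq_of_structEq`). This is where `n ≥ 2` matters.

Reeb field: for a fixed contact frame, Reeb triples exist and are unique because `dη_a = γ(I_a ·,
·)` is nondegenerate on `Q`. When the frame changes by an `SO(3)`-valued function `S`, the rotated
triple is again Reeb (`isReeb_trans`): the derivative of `S` enters through half the derivative of
the squared length of a row, which is zero, and the remaining quadratic expression in the `α_ab`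
vanishes by the antisymmetry above. Hence the span is globally defined.

Induced structure: the brackets of sections of `Q` have `η_a`-component `-γ(I_a X, Y)`, and this is
all that integrability and the Levi form see. The form `h` equals `(2n + 1) γ`, and two local
structures are glued by the transition matrix of their contact frames.

Associated connection: `γ + ∑ η_a²` is a metric for which `TM = Q ⊕ P` is orthogonal. A Koszul
argument in orthonormal frames adapted to the splitting gives uniqueness (`IsAssocAt.unique`) and
local existence; uniqueness glues the local solutions (`exists_connection`).

Canonicity: every admissible plane field is spanned by vectors `t_a + I_a r`, where `t` is the Reeb
triple and `r` lies in `Q` (`admissible_eq`). For this triple `α_aa = -γ(r, ·)` for all `a`. The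
associated connection has no `Q`-torsion on `Q`, so its coefficients are a tensor `w` as above and
`ehForm w` is a nonzero multiple of `γ(r, ·)`. It remains to see that `ehForm w = 0` means `ω^{E⊗H}
= 0` (`omegaEH_eq_zero_iff`). The form `ehForm` is the pairing with an explicit equivariant map
`ehMap`, and `ℍⁿ` occurs only once in the module: every equivariant map is a multiple of `ehMap`
(`IsEquivariant.eq_smul_ehMap`). So the condition holds exactly for `r = 0`, the Reeb field. -/

theorem quatUnit_transpose (a : Fin 3) : (quatUnit a)ᵀ = -quatUnit a := by
  ext i j; fin_cases a <;> fin_cases i <;> fin_cases j <;> simp [quatUnit]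

theorem quatUnit_sq (a : Fin 3) : quatUnit a * quatUnit a = -1 := by
  ext i j
  fin_cases a <;> fin_cases i <;> fin_cases j <;>
    simp [quatUnit, Matrix.mul_apply, Fin.sum_univ_four]

theorem quatUnit_mul (a : Fin 3) : quatUnit a * quatUnit (a + 1) = quatUnit (a + 2) := by
  ext i j
  fin_cases a <;> fin_cases i <;> fin_cases j <;>
    simp [quatUnit, Matrix.mul_apply, Fin.sum_univ_four]

theorem quatUnit_mul' (a : Fin 3) : quatUnit (a + 1) * quatUnit a = -quatUnit (a + 2) := by
  ext i j
  fin_cases a <;> fin_cases i <;> fin_cases j <;>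
    simp [quatUnit, Matrix.mul_apply, Fin.sum_univ_four]

theorem blockDiagonal_const_neg (A : Matrix (Fin 4) (Fin 4) ℝ) :
    Matrix.blockDiagonal (fun _ : Fin n => -A) = -Matrix.blockDiagonal (fun _ : Fin n => A) :=
  Matrix.blockDiagonal_neg (fun _ : Fin n => A)

theorem blockDiagonal_const_one :
    Matrix.blockDiagonal (fun _ : Fin n => (1 : Matrix (Fin 4) (Fin 4) ℝ)) = 1 :=
  Matrix.blockDiagonal_one

theorem modelJ_transpose (a : Fin 3) : (modelJ n a)ᵀ = -modelJ n a := by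
  simp only [modelJ, Matrix.blockDiagonal_transpose, quatUnit_transpose, blockDiagonal_const_neg]

theorem modelJ_sq (a : Fin 3) : modelJ n a * modelJ n a = -1 := by
  simp only [modelJ, ← Matrix.blockDiagonal_mul, quatUnit_sq, blockDiagonal_const_neg,
    blockDiagonal_const_one]

theorem modelJ_mul (a : Fin 3) : modelJ n a * modelJ n (a + 1) = modelJ n (a + 2) := by
  simp only [modelJ, ← Matrix.blockDiagonal_mul, quatUnit_mul]

theorem modelJ_mul' (a : Fin 3) : modelJ n (a + 1) * modelJ n a = -modelJ n (a + 2) := by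
  simp only [modelJ, ← Matrix.blockDiagonal_mul, quatUnit_mul', blockDiagonal_const_neg]

/-- The multiplication table of the three standard complex structures. -/
theorem modelJ_table (a b : Fin 3) : modelJ n a * modelJ n b =
    if a = b then -1 else if b = a + 1 then modelJ n (a + 2) else -modelJ n (a + 1) := by
  have key := fun a => modelJ_mul (n := n) a
  have key' := fun a => modelJ_mul' (n := n) a
  have sq := fun a => modelJ_sq (n := n) a
  fin_cases a <;> fin_cases b <;>
    first
    | simpa using sq 0
    | simpa using sq 1
    | simpa using sq 2
    | simpa using key 0
    | simpa using key 1
    | simpa using key 2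
    | simpa using key' 0
    | simpa using key' 1
    | simpa using key' 2

theorem modelJ_apply (a : Fin 3) (i j : Fin 4 × Fin n) :
    modelJ n a i j = if i.2 = j.2 then quatUnit a i.1 j.1 else 0 := by
  simp [modelJ, Matrix.blockDiagonal_apply]

variable (n) in
/-- The complex structure `J_a` as a linear map. -/
def Jv (a : Fin 3) : (Fin 4 × Fin n → ℝ) →ₗ[ℝ] (Fin 4 × Fin n → ℝ) := (modelJ n a).mulVecLin

theorem Jv_eq (a : Fin 3) (x : Fin 4 × Fin n → ℝ) : Jv n a x = modelJ n a *ᵥ x := rfl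

theorem Jv_sq (a : Fin 3) (x : Fin 4 × Fin n → ℝ) : Jv n a (Jv n a x) = -x := by
  simp [Jv_eq, modelJ_sq, Matrix.neg_mulVec]

theorem Jv_mul (a : Fin 3) (x : Fin 4 × Fin n → ℝ) :
    Jv n a (Jv n (a + 1) x) = Jv n (a + 2) x := by
  simp [Jv_eq, modelJ_mul]

theorem Jv_mul' (a : Fin 3) (x : Fin 4 × Fin n → ℝ) :
    Jv n (a + 1) (Jv n a x) = -Jv n (a + 2) x := by
  simp [Jv_eq, modelJ_mul', Matrix.neg_mulVec]

theorem Jv_dot (a : Fin 3) (x y : Fin 4 × Fin n → ℝ) :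
    Jv n a x ⬝ᵥ y = -(x ⬝ᵥ Jv n a y) := by
  rw [Jv_eq, Jv_eq, Matrix.dotProduct_mulVec, ← Matrix.mulVec_transpose, modelJ_transpose,
    Matrix.neg_mulVec, neg_dotProduct, neg_neg]

/-- The standard basis vector. -/
def bv (i : Fin 4 × Fin n) : Fin 4 × Fin n → ℝ := Pi.single i 1

theorem bv_apply (i j : Fin 4 × Fin n) : bv i j = if j = i then 1 else 0 := by
  simp [bv, Pi.single_apply]

theorem dot_bv (x : Fin 4 × Fin n → ℝ) (i : Fin 4 × Fin n) : x ⬝ᵥ bv i = x i := by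
  simp [bv]

theorem bv_dot (x : Fin 4 × Fin n → ℝ) (i : Fin 4 × Fin n) : bv i ⬝ᵥ x = x i := by
  simp [bv]

theorem sum_smul_bv (x : Fin 4 × Fin n → ℝ) : ∑ i, x i • bv i = x := by
  ext j
  simp [Finset.sum_apply, bv_apply]

theorem Jv_bv_apply (a : Fin 3) (i j : Fin 4 × Fin n) : Jv n a (bv i) j = modelJ n a j i := by
  simp [Jv_eq, bv]

/-- The trilinear form of a tensor. -/
def tri (w : Tensor3 n) : (Fin 4 × Fin n → ℝ) →ₗ[ℝ] (Fin 4 × Fin n → ℝ) →ₗ[ℝ]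
    (Fin 4 × Fin n → ℝ) →ₗ[ℝ] ℝ :=
  ∑ i, ∑ j, ∑ k, w (i, j, k) •
    (LinearMap.proj i).smulRight ((LinearMap.proj j).smulRight (LinearMap.proj k))

theorem tri_apply (w : Tensor3 n) (x y z : Fin 4 × Fin n → ℝ) :
    tri w x y z = ∑ i, ∑ j, ∑ k, w (i, j, k) * (x i * (y j * z k)) := by
  simp [tri, LinearMap.sum_apply]

theorem tri_bv (w : Tensor3 n) (i j k : Fin 4 × Fin n) :
    tri w (bv i) (bv j) (bv k) = w (i, j, k) := by
  simp [tri_apply, bv_apply]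

/-- Both sides are `∑ A l i * B (e_l) (e_i)`: in a full contraction a matrix moves across as its
transpose. -/
theorem bilin_sum_bv (B : (Fin 4 × Fin n → ℝ) →ₗ[ℝ] (Fin 4 × Fin n → ℝ) →ₗ[ℝ] ℝ)
    (A : Matrix (Fin 4 × Fin n) (Fin 4 × Fin n) ℝ) :
    ∑ i, B (A *ᵥ bv i) (bv i) = ∑ i, B (bv i) (Aᵀ *ᵥ bv i) := by
  have h : ∀ (A : Matrix (Fin 4 × Fin n) (Fin 4 × Fin n) ℝ) i, A *ᵥ bv i = ∑ l, A l i • bv l := by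
    intro A i
    conv_lhs => rw [← sum_smul_bv (A *ᵥ bv i)]
    simp [bv]
  simp only [h, map_sum, map_smul, LinearMap.sum_apply, LinearMap.smul_apply,
    Matrix.transpose_apply]
  rw [Finset.sum_comm]

theorem sum_Jv_bv (B : (Fin 4 × Fin n → ℝ) →ₗ[ℝ] (Fin 4 × Fin n → ℝ) →ₗ[ℝ] ℝ) (a : Fin 3) :
    ∑ i, B (Jv n a (bv i)) (bv i) = -∑ i, B (bv i) (Jv n a (bv i)) := by
  simp only [Jv_eq]
  rw [bilin_sum_bv, modelJ_transpose]
  simp [Matrix.neg_mulVec]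

/-- A tensor is skew if it is skew-symmetric in the last two indices. -/
def IsSkew (w : Tensor3 n) : Prop := ∀ i j k, w (i, j, k) = -w (i, k, j)

theorem IsSkew.tri {w : Tensor3 n} (hw : IsSkew w) (x y z : Fin 4 × Fin n → ℝ) :
    tri w x y z = -QuaternionicCR.tri w x z y := by
  rw [tri_apply, tri_apply, ← Finset.sum_neg_distrib]
  refine Finset.sum_congr rfl fun i _ => ?_
  rw [Finset.sum_comm, ← Finset.sum_neg_distrib]
  refine Finset.sum_congr rfl fun j _ => ?_
  rw [← Finset.sum_neg_distrib]
  refine Finset.sum_congr rfl fun k _ => ?_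
  rw [hw i k j]; ring

/-! ### The equations satisfied by the connection coefficients -/

/-- The functional `Z ↦ ∑ w(e_i, e_i, Z)`. -/
def div0 (w : Tensor3 n) (z : Fin 4 × Fin n → ℝ) : ℝ := ∑ i, tri w (bv i) (bv i) z

/-- The functional `Z ↦ ∑ w(e_i, J_d e_i, Z)`. -/
def divJ (w : Tensor3 n) (d : Fin 3) (z : Fin 4 × Fin n → ℝ) : ℝ :=
  ∑ i, tri w (bv i) (Jv n d (bv i)) z

/-- The functional `X ↦ ∑ w(X, e_i, J_d e_i)`. -/
def trJ (w : Tensor3 n) (d : Fin 3) (x : Fin 4 × Fin n → ℝ) : ℝ :=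
  ∑ i, tri w x (bv i) (Jv n d (bv i))

/-- The functional detecting the component of type `E ⊗ H`. -/
def ehForm (w : Tensor3 n) (z : Fin 4 × Fin n → ℝ) : ℝ :=
  ∑ a, divJ w a (Jv n a z) - 3 * div0 w z - (1 / (n : ℝ)) * ∑ a, trJ w a (Jv n a z)

/-- The equation expressing that `dη_a` is closed. -/
def StructEq (w : Tensor3 n) (α : Fin 3 → (Fin 4 × Fin n → ℝ) →ₗ[ℝ] ℝ) (a : Fin 3) : Prop :=
  ∀ x y z,
    (tri w x y (Jv n a z) - tri w y x (Jv n a z) + ∑ b, (Jv n b x ⬝ᵥ y) * α b z) +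
    (tri w y z (Jv n a x) - tri w z y (Jv n a x) + ∑ b, (Jv n b y ⬝ᵥ z) * α b x) +
    (tri w z x (Jv n a y) - tri w x z (Jv n a y) + ∑ b, (Jv n b z ⬝ᵥ x) * α b y) = 0

theorem functional_sum_bv (f : (Fin 4 × Fin n → ℝ) →ₗ[ℝ] ℝ) (x : Fin 4 × Fin n → ℝ) :
    ∑ i, (bv i ⬝ᵥ x) * f (bv i) = f x := by
  conv_rhs => rw [← sum_smul_bv x]
  simp [bv_dot]

theorem sum_Jv_dot_Jv (b d : Fin 3) :
    ∑ i, Jv n b (bv i) ⬝ᵥ Jv n d (bv i) = if b = d then 4 * (n : ℝ) else 0 := by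
  have h : ∀ b d (i : Fin 4 × Fin n), Jv n b (bv i) ⬝ᵥ Jv n d (bv i)
      = -(modelJ n b * modelJ n d) i i := by
    intro b d i
    rw [Jv_dot, bv_dot, Jv_eq, Jv_eq, Matrix.mulVec_mulVec]
    simp [bv]
  have hd : ∀ (a : Fin 3) (i : Fin 4 × Fin n), modelJ n a i i = 0 := by
    intro a i
    rw [modelJ_apply]
    obtain ⟨p, k⟩ := i
    fin_cases a <;> fin_cases p <;> simp [quatUnit]
  simp only [h, modelJ_table]
  by_cases hbd : b = d
  · simp [hbd]
  · by_cases h1 : d = b + 1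
    · simp [h1, hd]
    · simp [hbd, h1, hd]

/-- Contraction over `x = e_i`, `y = J_d e_i`. Moving `J_d` across and using skewness in the last
two slots makes the six `w`-terms equal in pairs, whence the factors `2`. The first `α`-term sees
the trace of `J_b` against `J_d`, the other two give equal sums. -/
theorem structEq_trace {w : Tensor3 n} (hw : IsSkew w)
    {α : Fin 3 → (Fin 4 × Fin n → ℝ) →ₗ[ℝ] ℝ} {a : Fin 3} (h : StructEq w α a) (d : Fin 3)
    (z : Fin 4 × Fin n → ℝ) :
    2 * divJ w d (Jv n a z) + 2 * ∑ i, tri w (bv i) (Jv n a (Jv n d (bv i))) z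
      + 2 * ∑ i, tri w z (bv i) (Jv n a (Jv n d (bv i)))
      + 4 * n * α d z + 2 * ∑ b, α b (Jv n d (Jv n b z)) = 0 := by
  have h0 : ∑ i, _ = ∑ i : Fin 4 × Fin n, (0 : ℝ) :=
    Finset.sum_congr rfl fun i _ => h (bv i) (Jv n d (bv i)) z
  simp only [Finset.sum_add_distrib, Finset.sum_sub_distrib, Finset.sum_const_zero] at h0
  have e1 : ∑ i, tri w (Jv n d (bv i)) (bv i) (Jv n a z) = -divJ w d (Jv n a z) := by
    have key := sum_Jv_bv (LinearMap.mk₂ ℝ (fun x y => tri w x y (Jv n a z)) (by simp) (by simp)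
      (by simp) (by simp)) d
    simpa [divJ] using key
  have e2 : ∑ i, tri w (Jv n d (bv i)) z (Jv n a (bv i))
      = ∑ i, tri w (bv i) (Jv n a (Jv n d (bv i))) z := by
    have key := sum_Jv_bv (LinearMap.mk₂ ℝ (fun x y => tri w x z (Jv n a y)) (by simp) (by simp)
      (by simp) (by simp)) d
    simp only [LinearMap.mk₂_apply] at key
    rw [key, ← Finset.sum_neg_distrib]
    exact Finset.sum_congr rfl fun i _ => by rw [hw.tri, neg_neg]
  have e3 : ∑ i, tri w z (Jv n d (bv i)) (Jv n a (bv i))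
      = -∑ i, tri w z (bv i) (Jv n a (Jv n d (bv i))) := by
    have key := sum_Jv_bv (LinearMap.mk₂ ℝ (fun x y => tri w z x (Jv n a y)) (by simp) (by simp)
      (by simp) (by simp)) d
    simpa using key
  have e4 : ∑ i, tri w (bv i) z (Jv n a (Jv n d (bv i)))
      = -∑ i, tri w (bv i) (Jv n a (Jv n d (bv i))) z := by
    rw [← Finset.sum_neg_distrib]
    exact Finset.sum_congr rfl fun i _ => by rw [hw.tri]
  have e5 : ∑ i, ∑ b, (Jv n b (bv i) ⬝ᵥ Jv n d (bv i)) * α b z = 4 * n * α d z := by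
    rw [Finset.sum_comm]
    simp_rw [← Finset.sum_mul, sum_Jv_dot_Jv]
    simp
  have e6 : ∑ i, ∑ b, (Jv n b (Jv n d (bv i)) ⬝ᵥ z) * α b (bv i)
      = ∑ b, α b (Jv n d (Jv n b z)) := by
    rw [Finset.sum_comm]
    refine Finset.sum_congr rfl fun b _ => ?_
    rw [← functional_sum_bv (α b)]
    refine Finset.sum_congr rfl fun i _ => ?_
    rw [Jv_dot, Jv_dot, neg_neg]
  have e7 : ∑ i, ∑ b, (Jv n b z ⬝ᵥ bv i) * α b (Jv n d (bv i))
      = ∑ b, α b (Jv n d (Jv n b z)) := by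
    rw [Finset.sum_comm]
    refine Finset.sum_congr rfl fun b _ => ?_
    rw [← LinearMap.comp_apply, ← functional_sum_bv ((α b).comp (Jv n d))]
    refine Finset.sum_congr rfl fun i _ => ?_
    rw [dotProduct_comm, LinearMap.comp_apply]
  rw [e1, e2, e3, e4, e5, e6, e7] at h0
  simp only [divJ] at h0 ⊢
  linarith

end Model

/-! ### Consequences of the traced structure equations -/

section Model

variable {n : ℕ}

theorem Jv_01 (x : Fin 4 × Fin n → ℝ) : Jv n 0 (Jv n 1 x) = Jv n 2 x := Jv_mul 0 x
theorem Jv_12 (x : Fin 4 × Fin n → ℝ) : Jv n 1 (Jv n 2 x) = Jv n 0 x := Jv_mul 1 x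
theorem Jv_20 (x : Fin 4 × Fin n → ℝ) : Jv n 2 (Jv n 0 x) = Jv n 1 x := Jv_mul 2 x
theorem Jv_10 (x : Fin 4 × Fin n → ℝ) : Jv n 1 (Jv n 0 x) = -Jv n 2 x := Jv_mul' 0 x
theorem Jv_21 (x : Fin 4 × Fin n → ℝ) : Jv n 2 (Jv n 1 x) = -Jv n 0 x := Jv_mul' 1 x
theorem Jv_02 (x : Fin 4 × Fin n → ℝ) : Jv n 0 (Jv n 2 x) = -Jv n 1 x := Jv_mul' 2 x

theorem IsSkew.tri_self {w : Tensor3 n} (hw : IsSkew w) (x y : Fin 4 × Fin n → ℝ) :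
    QuaternionicCR.tri w x y y = 0 := by
  have := hw.tri x y y
  linarith

/-- The diagonal traces of the structure equation. -/
theorem structEq_trace_diag {w : Tensor3 n} (hw : IsSkew w)
    {α : Fin 3 → (Fin 4 × Fin n → ℝ) →ₗ[ℝ] ℝ} {a : Fin 3} (h : StructEq w α a)
    (z : Fin 4 × Fin n → ℝ) :
    2 * divJ w a (Jv n a z) - 2 * div0 w z + 4 * n * α a z
      + 2 * ∑ b, α b (Jv n a (Jv n b z)) = 0 := by
  have key := structEq_trace hw h a z
  simp only [Jv_sq, map_neg, LinearMap.neg_apply, Finset.sum_neg_distrib, hw.tri_self,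
    Finset.sum_const_zero] at key
  simp only [div0]
  linarith

/-- For `d = a + 1` the product `J_a J_d` is `J_{a+2}`, so the remaining contractions are again of
the types `divJ` and `trJ`. In `structEq_trace_prev` the factors come in the other order, which
flips the sign of exactly these two terms. -/
theorem structEq_trace_next {w : Tensor3 n} (hw : IsSkew w)
    {α : Fin 3 → (Fin 4 × Fin n → ℝ) →ₗ[ℝ] ℝ} {a : Fin 3} (h : StructEq w α a)
    (z : Fin 4 × Fin n → ℝ) :
    2 * divJ w (a + 1) (Jv n a z) + 2 * divJ w (a + 2) z + 2 * trJ w (a + 2) z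
      + 4 * n * α (a + 1) z + 2 * ∑ b, α b (Jv n (a + 1) (Jv n b z)) = 0 := by
  have key := structEq_trace hw h (a + 1) z
  simp only [Jv_mul] at key
  exact key

theorem structEq_trace_prev {w : Tensor3 n} (hw : IsSkew w)
    {α : Fin 3 → (Fin 4 × Fin n → ℝ) →ₗ[ℝ] ℝ} {a : Fin 3} (h : StructEq w α (a + 1))
    (z : Fin 4 × Fin n → ℝ) :
    2 * divJ w a (Jv n (a + 1) z) - 2 * divJ w (a + 2) z - 2 * trJ w (a + 2) z
      + 4 * n * α a z + 2 * ∑ b, α b (Jv n a (Jv n b z)) = 0 := by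
  have key := structEq_trace hw h a z
  simp only [Jv_mul', map_neg, LinearMap.neg_apply, Finset.sum_neg_distrib] at key
  simp only [divJ, trJ]
  simp only [divJ] at key
  linarith

theorem divJ_neg (w : Tensor3 n) (d : Fin 3) (z : Fin 4 × Fin n → ℝ) :
    divJ w d (-z) = -divJ w d z := by
  simp [divJ]

/-- The two off-diagonal traces are added, and the difference of two diagonal traces taken at
`J_{a+2} z` is added to them. All contractions of `w` and all terms with `κ` cancel, and `4n - 4`
times the symmetric part survives; for `n = 1` nothing would follow. -/
theorem structEq_antisymm {w : Tensor3 n} (hn : 2 ≤ n) (hw : IsSkew w)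
    {α : Fin 3 → Fin 3 → (Fin 4 × Fin n → ℝ) →ₗ[ℝ] ℝ} {κ : (Fin 4 × Fin n → ℝ) →ₗ[ℝ] ℝ}
    (h : ∀ a, StructEq w (α a) a) (hκ : ∀ a, α a a = κ) (a : Fin 3) (z : Fin 4 × Fin n → ℝ) :
    α a (a + 1) z + α (a + 1) a z = 0 := by
  have e1 := structEq_trace_next hw (h a) z
  have e2 := structEq_trace_prev hw (h (a + 1)) z
  have e3 := structEq_trace_diag hw (h a) (Jv n (a + 2) z)
  have e4 := structEq_trace_diag hw (h (a + 1)) (Jv n (a + 2) z)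
  have hn' : (2 : ℝ) ≤ n := by exact_mod_cast hn
  suffices H : (4 * (n : ℝ) - 4) * (α a (a + 1) z + α (a + 1) a z) = 0 by
    rcases mul_eq_zero.1 H with H | H
    · linarith
    · exact H
  have k0 := hκ 0
  have k1 := hκ 1
  have k2 := hκ 2
  fin_cases a <;>
  simp [Fin.sum_univ_three, Jv_01, Jv_12, Jv_20, Jv_10, Jv_21, Jv_02, Jv_sq, k0, k1, k2, divJ_neg,
    -mul_eq_zero]
    at e1 e2 e3 e4 ⊢ <;>
  linear_combination e1 + e2 + e3 - e4

/-- The diagonal traces produce the first part of `ehForm`. The off-diagonal traces at `J_{a+2} z`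
produce its `trJ`-part, since their `divJ`-terms telescope around the cycle. The off-diagonal forms
`α_ab` then occur only through `α_ab + α_ba` and drop out, leaving `κ`. -/
theorem ehForm_eq_of_structEq {w : Tensor3 n} (hn : 2 ≤ n) (hw : IsSkew w)
    {α : Fin 3 → Fin 3 → (Fin 4 × Fin n → ℝ) →ₗ[ℝ] ℝ} {κ : (Fin 4 × Fin n → ℝ) →ₗ[ℝ] ℝ}
    (h : ∀ a, StructEq w (α a) a) (hκ : ∀ a, α a a = κ) (z : Fin 4 × Fin n → ℝ) :
    n * ehForm w z = -3 * (2 * n + 1) * (n - 1) * κ z := by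
  have anti := fun a z => structEq_antisymm hn hw h hκ a z
  have hn' : (2 : ℝ) ≤ n := by exact_mod_cast hn
  have hn0 : (n : ℝ) ≠ 0 := by positivity
  have k0 := hκ 0
  have k1 := hκ 1
  have k2 := hκ 2
  have d0 := structEq_trace_diag hw (h 0) z
  have d1 := structEq_trace_diag hw (h 1) z
  have d2 := structEq_trace_diag hw (h 2) z
  have e0 := structEq_trace_next hw (h 0) (Jv n 2 z)
  have e1 := structEq_trace_next hw (h 1) (Jv n 0 z)
  have e2 := structEq_trace_next hw (h 2) (Jv n 1 z)
  have s0 := anti 0 (Jv n 2 z)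
  have s1 := anti 1 (Jv n 0 z)
  have s2 := anti 2 (Jv n 1 z)
  have hF : (n : ℝ) * ehForm w z = n * (∑ a, divJ w a (Jv n a z) - 3 * div0 w z)
      - ∑ a, trJ w a (Jv n a z) := by
    rw [ehForm]; field_simp
  rw [hF]
  simp [Fin.sum_univ_three, Jv_01, Jv_12, Jv_20, Jv_10, Jv_21, Jv_02, Jv_sq, k0, k1, k2, divJ_neg]
    at d0 d1 d2 e0 e1 e2 s0 s1 s2 ⊢
  linear_combination (n / 2 : ℝ) * (d0 + d1 + d2) - (1 / 2) * (e0 + e1 + e2)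
    + (n - 1 : ℝ) * (s0 + s1 + s2)

end Model

section Model

variable {n : ℕ}

/-! ### The module of type `E ⊗ H` -/

/-- The `4 × 4`-matrix of left multiplication by a quaternion. -/
def lmat (c₀ : ℝ) (c : Fin 3 → ℝ) : Matrix (Fin 4) (Fin 4) ℝ :=
  !![c₀, -c 0, -c 1, -c 2; c 0, c₀, -c 2, c 1; c 1, c 2, c₀, -c 0; c 2, -c 1, c 0, c₀]

theorem lmat_eq (c₀ : ℝ) (c : Fin 3 → ℝ) : lmat c₀ c = c₀ • 1 + ∑ a, c a • quatUnit a := by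
  ext i j
  fin_cases i <;> fin_cases j <;>
    simp [lmat, quatUnit, Fin.sum_univ_three]

theorem blockDiagonal_lmat (c₀ : ℝ) (c : Fin 3 → ℝ) :
    Matrix.blockDiagonal (fun _ : Fin n => lmat c₀ c) = c₀ • 1 + ∑ a, c a • modelJ n a := by
  ext i j
  simp only [Matrix.blockDiagonal_apply, lmat_eq, Matrix.add_apply, Matrix.smul_apply,
    Matrix.sum_apply, modelJ_apply, Matrix.one_apply, Prod.ext_iff]
  split_ifs <;> simp_all

/-- The rotation of `Im ℍ` given by conjugation with a quaternion. -/
def rot (c₀ : ℝ) (c : Fin 3 → ℝ) : Matrix (Fin 3) (Fin 3) ℝ :=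
  !![c₀ ^ 2 + c 0 ^ 2 - c 1 ^ 2 - c 2 ^ 2, 2 * (c 0 * c 1 - c₀ * c 2), 2 * (c 0 * c 2 + c₀ * c 1);
    2 * (c 0 * c 1 + c₀ * c 2), c₀ ^ 2 - c 0 ^ 2 + c 1 ^ 2 - c 2 ^ 2, 2 * (c 1 * c 2 - c₀ * c 0);
    2 * (c 0 * c 2 - c₀ * c 1), 2 * (c 1 * c 2 + c₀ * c 0), c₀ ^ 2 - c 0 ^ 2 - c 1 ^ 2 + c 2 ^ 2]

theorem rot_mul_transpose {c₀ : ℝ} {c : Fin 3 → ℝ} (hc : c₀ ^ 2 + ∑ a, c a ^ 2 = 1) :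
    rot c₀ c * (rot c₀ c)ᵀ = 1 := by
  rw [Fin.sum_univ_three] at hc
  -- The entries of the product are homogeneous of degree four in the quaternion, so the square of
  -- its norm is needed.
  have hsq : (c₀ ^ 2 + (c 0 ^ 2 + c 1 ^ 2 + c 2 ^ 2)) ^ 2 = 1 := by rw [hc]; norm_num
  ext i j
  fin_cases i <;> fin_cases j <;>
    simp [rot, Matrix.mul_apply, Fin.sum_univ_three] <;>
    first
    | ring1
    | linear_combination hsq

set_option maxHeartbeats 1000000 in
theorem lmat_conj (c₀ : ℝ) (c : Fin 3 → ℝ) (a : Fin 3) :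
    lmat c₀ c * quatUnit a * (lmat c₀ c)ᵀ = ∑ b, rot c₀ c b a • quatUnit b := by
  ext i j
  fin_cases a <;> fin_cases i <;> fin_cases j <;>
    simp [lmat, quatUnit, rot, Matrix.mul_apply, Fin.sum_univ_four, Fin.sum_univ_three] <;> ring

theorem lmat_mul_transpose {c₀ : ℝ} {c : Fin 3 → ℝ} (hc : c₀ ^ 2 + ∑ a, c a ^ 2 = 1) :
    lmat c₀ c * (lmat c₀ c)ᵀ = 1 := by
  rw [Fin.sum_univ_three] at hc
  ext i j
  fin_cases i <;> fin_cases j <;>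
    simp [lmat, Matrix.mul_apply, Fin.sum_univ_four] <;>
    first
    | ring1
    | linear_combination hc

theorem SpSp1.orthogonal {A : Matrix (Fin 4 × Fin n) (Fin 4 × Fin n) ℝ} (hA : A ∈ SpSp1 n) :
    A * Aᵀ = 1 := by
  obtain ⟨B, c₀, c, hB, -, hc, rfl⟩ := hA
  have hB' : B * Bᵀ = 1 := mul_eq_one_comm.1 hB
  rw [← blockDiagonal_lmat, Matrix.transpose_mul, Matrix.blockDiagonal_transpose,
    mul_assoc, ← mul_assoc (Matrix.blockDiagonal _), ← Matrix.blockDiagonal_mul]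
  simp only [lmat_mul_transpose hc, blockDiagonal_const_one, one_mul, hB']

/-- The factor in `Sp(n)` commutes with the `J_a`, and the unit quaternion rotates them as
conjugation rotates `Im ℍ`. Orthogonality of the rotation is all that `SpSp1.quad` needs. -/
theorem SpSp1.conj {A : Matrix (Fin 4 × Fin n) (Fin 4 × Fin n) ℝ} (hA : A ∈ SpSp1 n) :
    ∃ s : Matrix (Fin 3) (Fin 3) ℝ, s * sᵀ = 1 ∧
      ∀ a, A * modelJ n a * Aᵀ = ∑ b, s b a • modelJ n b := by
  obtain ⟨B, c₀, c, hB, hBJ, hc, rfl⟩ := hA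
  have hB' : B * Bᵀ = 1 := mul_eq_one_comm.1 hB
  refine ⟨rot c₀ c, rot_mul_transpose hc, fun a => ?_⟩
  have h1 : Matrix.blockDiagonal (fun _ : Fin n => lmat c₀ c) * modelJ n a *
      (Matrix.blockDiagonal (fun _ : Fin n => lmat c₀ c))ᵀ = ∑ b, rot c₀ c b a • modelJ n b := by
    rw [modelJ, ← Matrix.blockDiagonal_mul, Matrix.blockDiagonal_transpose,
      ← Matrix.blockDiagonal_mul]
    ext i j
    simp only [Matrix.blockDiagonal_apply, lmat_conj, Matrix.sum_apply, Matrix.smul_apply,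
      modelJ_apply]
    split_ifs <;> simp
  rw [← blockDiagonal_lmat, Matrix.transpose_mul]
  calc _ = B * (Matrix.blockDiagonal (fun _ : Fin n => lmat c₀ c) * modelJ n a *
      (Matrix.blockDiagonal (fun _ : Fin n => lmat c₀ c))ᵀ) * Bᵀ := by simp only [mul_assoc]
    _ = _ := by
      rw [h1, Finset.mul_sum, Finset.sum_mul]
      refine Finset.sum_congr rfl fun b _ => ?_
      rw [mul_smul_comm, smul_mul_assoc, hBJ, mul_assoc, hB', mul_one]

theorem dot_mulVec_transpose (A : Matrix (Fin 4 × Fin n) (Fin 4 × Fin n) ℝ)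
    (x y : Fin 4 × Fin n → ℝ) : x ⬝ᵥ Aᵀ *ᵥ y = (A *ᵥ x) ⬝ᵥ y := by
  rw [Matrix.dotProduct_mulVec, Matrix.vecMul_transpose]

theorem SpSp1.dot {A : Matrix (Fin 4 × Fin n) (Fin 4 × Fin n) ℝ} (hA : A ∈ SpSp1 n)
    (x y : Fin 4 × Fin n → ℝ) : (Aᵀ *ᵥ x) ⬝ᵥ (Aᵀ *ᵥ y) = x ⬝ᵥ y := by
  rw [dot_mulVec_transpose, Matrix.mulVec_mulVec, SpSp1.orthogonal hA, Matrix.one_mulVec]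

/-- The individual `J_a` are not invariant, but they are rotated by an orthogonal matrix, so the
tensor `∑ J_a ⊗ J_a` is. Together with the dot product it is the building block of `ehMap`. -/
theorem SpSp1.quad {A : Matrix (Fin 4 × Fin n) (Fin 4 × Fin n) ℝ} (hA : A ∈ SpSp1 n)
    (p q r s : Fin 4 × Fin n → ℝ) :
    ∑ a, (Jv n a (Aᵀ *ᵥ p) ⬝ᵥ (Aᵀ *ᵥ q)) * (Jv n a (Aᵀ *ᵥ r) ⬝ᵥ (Aᵀ *ᵥ s)) =
      ∑ a, (Jv n a p ⬝ᵥ q) * (Jv n a r ⬝ᵥ s) := by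
  obtain ⟨S, hS, hconj⟩ := SpSp1.conj hA
  have h : ∀ a p q, Jv n a (Aᵀ *ᵥ p) ⬝ᵥ (Aᵀ *ᵥ q) = ∑ b, S b a * (Jv n b p ⬝ᵥ q) := by
    intro a p q
    rw [dot_mulVec_transpose, Jv_eq, Matrix.mulVec_mulVec, Matrix.mulVec_mulVec,
      hconj, Matrix.sum_mulVec, sum_dotProduct]
    simp only [Matrix.smul_mulVec, smul_dotProduct, smul_eq_mul, Jv_eq]
  have hS' : ∀ b c, ∑ a, S b a * S c a = if b = c then 1 else 0 := by
    intro b c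
    have := congrFun (congrFun hS b) c
    rw [Matrix.mul_apply, Matrix.one_apply] at this
    simpa using this
  simp only [h, Fin.sum_univ_three] at hS' ⊢
  have h00 := hS' 0 0
  have h01 := hS' 0 1
  have h02 := hS' 0 2
  have h11 := hS' 1 1
  have h12 := hS' 1 2
  have h22 := hS' 2 2
  simp at h00 h01 h02 h11 h12 h22
  generalize Jv n 0 p ⬝ᵥ q = x0
  generalize Jv n 1 p ⬝ᵥ q = x1
  generalize Jv n 2 p ⬝ᵥ q = x2
  generalize Jv n 0 r ⬝ᵥ s = y0
  generalize Jv n 1 r ⬝ᵥ s = y1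
  generalize Jv n 2 r ⬝ᵥ s = y2
  linear_combination x0 * y0 * h00 + x1 * y1 * h11 + x2 * y2 * h22 + (x0 * y1 + x1 * y0) * h01
    + (x0 * y2 + x2 * y0) * h02 + (x1 * y2 + x2 * y1) * h12

variable (n) in
/-- The generator of the component of type `E ⊗ H`. -/
def ehMap : (Fin 4 × Fin n → ℝ) →ₗ[ℝ] Tensor3 n where
  -- The coefficient `3` makes the values orthogonal to `sp(n)`, the coefficient `1 / n` makes them
  -- orthogonal to `sp(1)`, and `1 / 2` compensates the antisymmetrization when pairing with a skew
  -- tensor.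
  toFun v := WithLp.toLp 2 fun m =>
    (1 / 2) * (∑ a, (modelJ n a m.2.1 m.1 * Jv n a v m.2.2 - modelJ n a m.2.2 m.1 * Jv n a v m.2.1)
      - 3 * ((if m.1 = m.2.1 then 1 else 0) * v m.2.2 - (if m.1 = m.2.2 then 1 else 0) * v m.2.1))
      - (1 / (n : ℝ)) * ∑ a, Jv n a v m.1 * modelJ n a m.2.2 m.2.1
  map_add' u v := by
    ext m
    simp only [map_add, Pi.add_apply, PiLp.add_apply, Fin.sum_univ_three]
    ring
  map_smul' c v := by
    ext m
    simp only [map_smul, Pi.smul_apply, PiLp.smul_apply, Fin.sum_univ_three, smul_eq_mul,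
      RingHom.id_apply]
    ring

theorem ehMap_apply (v : Fin 4 × Fin n → ℝ) (i j k : Fin 4 × Fin n) :
    ehMap n v (i, j, k) =
    (1 / 2) * (∑ a, (modelJ n a j i * Jv n a v k - modelJ n a k i * Jv n a v j)
      - 3 * ((if i = j then 1 else 0) * v k - (if i = k then 1 else 0) * v j))
      - (1 / (n : ℝ)) * ∑ a, Jv n a v i * modelJ n a k j := rfl

theorem tensor_ext_tri {w w' : Tensor3 n} (h : tri w = tri w') : w = w' := by
  ext ⟨i, j, k⟩
  rw [← tri_bv, ← tri_bv, h]

theorem tri_add (w w' : Tensor3 n) : tri (w + w') = tri w + tri w' := by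
  simp [tri, add_smul, Finset.sum_add_distrib]

theorem tri_smul (c : ℝ) (w : Tensor3 n) : tri (c • w) = c • tri w := by
  simp [tri, mul_smul, Finset.smul_sum]

theorem modelJ_skew (a : Fin 3) (i j : Fin 4 × Fin n) : modelJ n a i j = -modelJ n a j i := by
  have := congrFun (congrFun (modelJ_transpose (n := n) a) j) i
  simpa using this

theorem ehMap_skew (v : Fin 4 × Fin n → ℝ) : IsSkew (ehMap n v) := by
  intro i j k
  rw [ehMap_apply, ehMap_apply]
  simp only [Fin.sum_univ_three, modelJ_skew _ k j]
  ring

/-- In this form only dot products and products summed over `a` occur, so that equivariance can be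
read off from `SpSp1.dot` and `SpSp1.quad`. -/
theorem tri_ehMap (v x y z : Fin 4 × Fin n → ℝ) :
    tri (ehMap n v) x y z = (1 / 2) * (∑ a, ((Jv n a x ⬝ᵥ y) * (Jv n a v ⬝ᵥ z)
      - (Jv n a x ⬝ᵥ z) * (Jv n a v ⬝ᵥ y)) - 3 * ((x ⬝ᵥ y) * (v ⬝ᵥ z) - (x ⬝ᵥ z) * (v ⬝ᵥ y)))
      - (1 / (n : ℝ)) * ∑ a, (Jv n a v ⬝ᵥ x) * (Jv n a y ⬝ᵥ z) := by
  have key : ∀ T T' : (Fin 4 × Fin n → ℝ) →ₗ[ℝ] (Fin 4 × Fin n → ℝ) →ₗ[ℝ]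
      (Fin 4 × Fin n → ℝ) →ₗ[ℝ] ℝ, (∀ i j k, T (bv i) (bv j) (bv k) = T' (bv i) (bv j) (bv k)) →
      T = T' := by
    intro T T' h
    refine (Pi.basisFun ℝ _).ext fun i => (Pi.basisFun ℝ _).ext fun j =>
      (Pi.basisFun ℝ _).ext fun k => ?_
    simpa [bv] using h i j k
  let D : (Fin 4 × Fin n → ℝ) →ₗ[ℝ] (Fin 4 × Fin n → ℝ) →ₗ[ℝ] ℝ := dotProductBilin ℝ ℝ
  let T' : (Fin 4 × Fin n → ℝ) →ₗ[ℝ] (Fin 4 × Fin n → ℝ) →ₗ[ℝ]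
      (Fin 4 × Fin n → ℝ) →ₗ[ℝ] ℝ := LinearMap.mk₂ ℝ
    (fun x y => (1 / 2 : ℝ) • (∑ a, ((Jv n a x ⬝ᵥ y) • D (Jv n a v)
      - (Jv n a v ⬝ᵥ y) • D (Jv n a x)) - (3 : ℝ) • ((x ⬝ᵥ y) • D v - (v ⬝ᵥ y) • D x))
      - (1 / (n : ℝ)) • ∑ a, (Jv n a v ⬝ᵥ x) • D (Jv n a y))
    (by intros; simp only [map_add, add_dotProduct, dotProduct_add, Fin.sum_univ_three]; module)
    (by intros; simp only [map_smul, smul_dotProduct, dotProduct_smul, Fin.sum_univ_three,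
          smul_eq_mul]; module)
    (by intros; simp only [map_add, dotProduct_add, Fin.sum_univ_three]; module)
    (by intros; simp only [map_smul, dotProduct_smul, Fin.sum_univ_three,
          smul_eq_mul]; module)
  have hT : tri (ehMap n v) = T' := by
    refine key _ _ fun i j k => ?_
    rw [tri_bv, ehMap_apply]
    simp only [T', D, LinearMap.mk₂_apply, LinearMap.sub_apply, LinearMap.smul_apply,
      LinearMap.sum_apply, dotProductBilin_apply_apply, dot_bv, Jv_bv_apply, smul_eq_mul]
    simp only [bv_apply, Fin.sum_univ_three, eq_comm (a := i)]
    ring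
  rw [hT]
  simp only [T', D, LinearMap.mk₂_apply, LinearMap.sub_apply, LinearMap.smul_apply,
    LinearMap.add_apply, dotProductBilin_apply_apply, smul_eq_mul, Fin.sum_univ_three]
  ring

theorem transpose_mulVec_bv (A : Matrix (Fin 4 × Fin n) (Fin 4 × Fin n) ℝ)
    (i i' : Fin 4 × Fin n) : (Aᵀ *ᵥ bv i) i' = A i i' := by
  simp [bv]

theorem tri_transpose_bv (w : Tensor3 n) (A : Matrix (Fin 4 × Fin n) (Fin 4 × Fin n) ℝ)
    (i j k : Fin 4 × Fin n) : tri w (Aᵀ *ᵥ bv i) (Aᵀ *ᵥ bv j) (Aᵀ *ᵥ bv k) =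
      ∑ i', ∑ j', ∑ k', A i i' * A j j' * A k k' * w (i', j', k') := by
  simp only [tri_apply, transpose_mulVec_bv]
  refine Finset.sum_congr rfl fun _ _ => Finset.sum_congr rfl fun _ _ =>
    Finset.sum_congr rfl fun _ _ => by ring

theorem mulVec_transpose_self {A : Matrix (Fin 4 × Fin n) (Fin 4 × Fin n) ℝ} (hA : A ∈ SpSp1 n)
    (v : Fin 4 × Fin n → ℝ) : Aᵀ *ᵥ (A *ᵥ v) = v := by
  rw [Matrix.mulVec_mulVec, mul_eq_one_comm.1 (SpSp1.orthogonal hA), Matrix.one_mulVec]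

theorem ehMap_equivariant {A : Matrix (Fin 4 × Fin n) (Fin 4 × Fin n) ℝ} (hA : A ∈ SpSp1 n)
    (v : Fin 4 × Fin n → ℝ) (i j k : Fin 4 × Fin n) : ehMap n (A *ᵥ v) (i, j, k) =
      ∑ i', ∑ j', ∑ k', A i i' * A j j' * A k k' * ehMap n v (i', j', k') := by
  rw [← tri_transpose_bv, ← tri_bv]
  generalize bv i = x
  generalize bv j = y
  generalize bv k = z
  -- With `v = Aᵀ u` all four arguments on the right carry `Aᵀ`, which is the shape of the
  -- invariance lemmas.
  obtain ⟨u, rfl⟩ : ∃ u, v = Aᵀ *ᵥ u := ⟨A *ᵥ v, (mulVec_transpose_self hA v).symm⟩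
  rw [Matrix.mulVec_mulVec, SpSp1.orthogonal hA, Matrix.one_mulVec, tri_ehMap, tri_ehMap,
    Finset.sum_sub_distrib, Finset.sum_sub_distrib]
  simp only [SpSp1.dot hA, SpSp1.quad hA]

theorem sum_dot_mul_dot (C : Matrix (Fin 4 × Fin n) (Fin 4 × Fin n) ℝ)
    (p q : Fin 4 × Fin n → ℝ) :
    ∑ k, (p ⬝ᵥ C *ᵥ bv k) * (q ⬝ᵥ bv k) = p ⬝ᵥ C *ᵥ q := by
  have : ∀ k, p ⬝ᵥ C *ᵥ bv k = (Cᵀ *ᵥ p) k := by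
    intro k
    rw [← dot_bv (Cᵀ *ᵥ p) k, dotProduct_comm _ (bv k), dot_mulVec_transpose, dotProduct_comm]
  simp only [this, dot_bv]
  change (Cᵀ *ᵥ p) ⬝ᵥ q = _
  rw [dotProduct_comm, dot_mulVec_transpose, dotProduct_comm]

theorem sum_ehMap_mul (v : Fin 4 × Fin n → ℝ) (i : Fin 4 × Fin n)
    {C : Matrix (Fin 4 × Fin n) (Fin 4 × Fin n) ℝ} (hC : Cᵀ = -C) :
    ∑ j, ∑ k, ehMap n v (i, j, k) * C j k =
      ∑ a, Jv n a (bv i) ⬝ᵥ C *ᵥ Jv n a v - 3 * (bv i ⬝ᵥ C *ᵥ v)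
        - (1 / (n : ℝ)) * ∑ a, (Jv n a v ⬝ᵥ bv i) * (modelJ n a * C).trace := by
  have h1 : ∀ k, ∑ j, ehMap n v (i, j, k) * C j k = tri (ehMap n v) (bv i) (C *ᵥ bv k) (bv k) := by
    intro k
    conv_rhs => rw [← sum_smul_bv (C *ᵥ bv k)]
    simp only [map_sum, map_smul, LinearMap.sum_apply, LinearMap.smul_apply, tri_bv, smul_eq_mul]
    exact Finset.sum_congr rfl fun j _ => by simp [bv, mul_comm]
  have hskew : ∀ p q : Fin 4 × Fin n → ℝ, p ⬝ᵥ C *ᵥ q = -(q ⬝ᵥ C *ᵥ p) := by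
    intro p q
    have := dot_mulVec_transpose C q p
    rw [hC, Matrix.neg_mulVec, dotProduct_neg, dotProduct_comm _ p] at this
    linarith
  have htr : ∀ a, ∑ k, Jv n a (C *ᵥ bv k) ⬝ᵥ bv k = (modelJ n a * C).trace := by
    intro a
    simp only [Jv_eq, Matrix.mulVec_mulVec, dot_bv, Matrix.trace, Matrix.diag]
    exact Finset.sum_congr rfl fun k _ => by simp [bv]
  rw [Finset.sum_comm]
  simp only [h1, tri_ehMap]
  simp only [Finset.sum_sub_distrib, ← Finset.mul_sum]
  rw [Finset.sum_comm (f := fun k a => (Jv n a (bv i) ⬝ᵥ C *ᵥ bv k) * (Jv n a v ⬝ᵥ bv k)),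
    Finset.sum_comm (f := fun k a => (Jv n a (bv i) ⬝ᵥ bv k) * (Jv n a v ⬝ᵥ C *ᵥ bv k)),
    Finset.sum_comm (f := fun k a => (Jv n a v ⬝ᵥ bv i) * (Jv n a (C *ᵥ bv k) ⬝ᵥ bv k))]
  simp only [← Finset.mul_sum, htr]
  have hs : ∀ p q : Fin 4 × Fin n → ℝ,
      ∑ k, (q ⬝ᵥ bv k) * (p ⬝ᵥ C *ᵥ bv k) = p ⬝ᵥ C *ᵥ q := fun p q => by
    simp only [mul_comm (q ⬝ᵥ bv _), sum_dot_mul_dot]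
  have hneg : ∑ a, Jv n a v ⬝ᵥ C *ᵥ Jv n a (bv i) = -∑ a, Jv n a (bv i) ⬝ᵥ C *ᵥ Jv n a v := by
    rw [← Finset.sum_neg_distrib]
    exact Finset.sum_congr rfl fun a _ => hskew _ _
  simp only [sum_dot_mul_dot, hs, hneg]
  rw [hskew v]
  ring

/-- Multiplying `J_a C` by `J_{a+1}` on both sides reproduces it, since `C` commutes with `J_{a+1}`;
by cyclicity of the trace and `J_{a+1}² = -1` it also changes the sign of the trace. -/
theorem trace_modelJ_mul {C : Matrix (Fin 4 × Fin n) (Fin 4 × Fin n) ℝ}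
    (hC : ∀ a, C * modelJ n a = modelJ n a * C) (a : Fin 3) : (modelJ n a * C).trace = 0 := by
  have h3 : modelJ n (a + 1) * modelJ n (a + 2) = modelJ n a := by
    fin_cases a
    exacts [modelJ_mul 1, modelJ_mul 2, modelJ_mul 0]
  have h : modelJ n (a + 1) * (modelJ n a * C) * modelJ n (a + 1) = modelJ n a * C := by
    rw [mul_assoc, mul_assoc, hC, ← mul_assoc (modelJ n a), modelJ_mul, ← mul_assoc, h3]
  have h2 : (modelJ n (a + 1) * (modelJ n a * C) * modelJ n (a + 1)).trace
      = -(modelJ n a * C).trace := by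
    rw [Matrix.trace_mul_comm, ← mul_assoc, modelJ_sq, neg_mul, one_mul, Matrix.trace_neg]
  rw [h] at h2
  linarith

theorem trace_modelJ (a : Fin 3) : (modelJ n a).trace = 0 := by
  simpa using trace_modelJ_mul (C := (1 : Matrix (Fin 4 × Fin n) (Fin 4 × Fin n) ℝ)) (by simp) a

theorem ehMap_mem_obsSpace (hn : n ≠ 0) (v : Fin 4 × Fin n → ℝ) : ehMap n v ∈ obsSpace n := by
  intro i
  refine ⟨fun j k => ehMap_skew v i j k, fun C hC => ?_⟩
  obtain ⟨C₁, h₁, C₂, h₂, rfl⟩ := Submodule.mem_sup.1 hC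
  simp only [Matrix.add_apply, mul_add, Finset.sum_add_distrib]
  -- On `sp(n)` the three summands of the first sum coincide and cancel the term with coefficient
  -- `3`; the traces vanish.
  have e1 : ∑ j, ∑ k, ehMap n v (i, j, k) * C₁ j k = 0 := by
    rw [sum_ehMap_mul v i h₁.1]
    simp only [trace_modelJ_mul h₁.2, mul_zero, Finset.sum_const_zero, sub_zero]
    have : ∀ a, Jv n a (bv i) ⬝ᵥ C₁ *ᵥ Jv n a v = bv i ⬝ᵥ C₁ *ᵥ v := by
      intro a
      rw [Jv_eq a v, Matrix.mulVec_mulVec, h₁.2, ← Matrix.mulVec_mulVec, ← Jv_eq, Jv_dot, Jv_sq,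
        dotProduct_neg, neg_neg]
    simp [this]
  -- For `C = J_d` the first two terms of `sum_ehMap_mul` add up to `-4 ⟨e_i, J_d v⟩`, and `tr(J_d
  -- J_d) = -4n` turns the term with `1 / n` into the opposite.
  have e2 : ∑ j, ∑ k, ehMap n v (i, j, k) * C₂ j k = 0 := by
    clear hC
    induction h₂ using Submodule.span_induction with
    | mem C hd =>
      obtain ⟨d, rfl⟩ := hd
      rw [sum_ehMap_mul v i (modelJ_transpose d)]
      have hn' : (n : ℝ) ≠ 0 := by exact_mod_cast hn
      have htr1 : (1 : Matrix (Fin 4 × Fin n) (Fin 4 × Fin n) ℝ).trace = 4 * n := by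
        simp [Matrix.trace_one]
      have hv : ∀ a, v ⬝ᵥ Jv n a (bv i) = -Jv n a v i := fun a => by
        rw [← dot_bv (Jv n a v) i, Jv_dot, neg_neg]
      simp only [← Jv_eq, Jv_dot, hv]
      simp only [bv_dot, modelJ_table, Fin.sum_univ_three]
      fin_cases d <;>
      simp [Jv_01, Jv_12, Jv_20, Jv_10, Jv_21, Jv_02, Jv_sq, trace_modelJ, htr1] <;>
      field_simp <;> ring
    | zero => simp
    | add C C' _ _ h h' =>
      simp only [Matrix.add_apply, mul_add, Finset.sum_add_distrib, h, h', add_zero]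
    | smul c C _ h =>
      simp only [Matrix.smul_apply, smul_eq_mul, mul_left_comm _ c, ← Finset.mul_sum, h, mul_zero]
  rw [e1, e2, add_zero]

theorem isEquivariant_ehMap (hn : n ≠ 0) : IsEquivariant n (ehMap n) :=
  ⟨ehMap_mem_obsSpace hn, fun _ hA w i j k => ehMap_equivariant hA w i j k⟩

/-- The three kinds of terms of `ehMap` pair with `w` to the contractions `divJ`, `div0` and `trJ`;
the antisymmetrized partners contribute equally because `w` is skew. -/
theorem inner_ehMap {w : Tensor3 n} (hw : IsSkew w) (v : Fin 4 × Fin n → ℝ) :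
    inner ℝ (ehMap n v) w = ehForm w v := by
  have hT : ∀ (A : Matrix (Fin 4 × Fin n) (Fin 4 × Fin n) ℝ) (u : Fin 4 × Fin n → ℝ),
      ∑ i, ∑ j, ∑ k, A j i * u k * w (i, j, k) = ∑ i, tri w (bv i) (A *ᵥ bv i) u := by
    intro A u
    simp only [tri_apply, bv_apply]
    simp [bv, mul_comm]
  have hT' : ∀ (A : Matrix (Fin 4 × Fin n) (Fin 4 × Fin n) ℝ) (u : Fin 4 × Fin n → ℝ),
      ∑ i, ∑ j, ∑ k, A k i * u j * w (i, j, k) = -∑ i, tri w (bv i) (A *ᵥ bv i) u := by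
    intro A u
    rw [← hT, ← Finset.sum_neg_distrib]
    refine Finset.sum_congr rfl fun i _ => ?_
    rw [Finset.sum_comm, ← Finset.sum_neg_distrib]
    refine Finset.sum_congr rfl fun k _ => ?_
    rw [← Finset.sum_neg_distrib]
    refine Finset.sum_congr rfl fun j _ => ?_
    rw [hw i j k]; ring
  have hR : ∀ (A : Matrix (Fin 4 × Fin n) (Fin 4 × Fin n) ℝ) (u : Fin 4 × Fin n → ℝ),
      ∑ i, ∑ j, ∑ k, u i * A k j * w (i, j, k) = ∑ i, tri w u (bv i) (A *ᵥ bv i) := by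
    intro A u
    rw [Finset.sum_comm]
    refine Finset.sum_congr rfl fun j _ => ?_
    simp only [tri_apply, bv_apply]
    simp [bv, mul_comm]
  have e : inner ℝ (ehMap n v) w = ∑ i, ∑ j, ∑ k, ehMap n v (i, j, k) * w (i, j, k) := by
    simp only [PiLp.inner_apply, Fintype.sum_prod_type (f := fun m : (Fin 4 × Fin n) ×
      (Fin 4 × Fin n) × (Fin 4 × Fin n) => inner ℝ (ehMap n v m) (w m))]
    refine Finset.sum_congr rfl fun i _ => ?_
    rw [Fintype.sum_prod_type]
    refine Finset.sum_congr rfl fun j _ => Finset.sum_congr rfl fun k _ => ?_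
    simp [mul_comm]
  have e2 : ∀ i j k, ehMap n v (i, j, k) * w (i, j, k) =
      (1 / 2) * (∑ a, (modelJ n a j i * Jv n a v k * w (i, j, k))
        - ∑ a, (modelJ n a k i * Jv n a v j * w (i, j, k)))
      - (3 / 2) * ((1 : Matrix (Fin 4 × Fin n) (Fin 4 × Fin n) ℝ) j i * v k * w (i, j, k)
        - (1 : Matrix (Fin 4 × Fin n) (Fin 4 × Fin n) ℝ) k i * v j * w (i, j, k))
      - (1 / (n : ℝ)) * ∑ a, Jv n a v i * modelJ n a k j * w (i, j, k) := by
    intro i j k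
    rw [ehMap_apply]
    simp only [Fin.sum_univ_three, Matrix.one_apply, eq_comm (a := i)]
    ring
  rw [e]
  simp only [e2, Fin.sum_univ_three, Finset.sum_sub_distrib, ← Finset.mul_sum,
    Finset.sum_add_distrib, hT, hT', hR]
  simp only [ehForm, divJ, div0, trJ, Matrix.one_mulVec, Fin.sum_univ_three, Jv_eq]
  ring

end Model

section Model

variable {n : ℕ}

/-! ### Multiplicity one -/

/-- The matrix `C = K - ∑ J_a K J_a` is four times the orthogonal projection of `K` to the commutant
of the `J_a`, and it lies in `sp(n)`. Hence `|C|² = 4 ⟨K, C⟩ = 0`. -/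
theorem eq_sum_conj_modelJ {K : Matrix (Fin 4 × Fin n) (Fin 4 × Fin n) ℝ} (hK : Kᵀ = -K)
    (h : ∀ C ∈ spAlg n, ∑ j, ∑ k, K j k * C j k = 0) :
    K = ∑ a, modelJ n a * K * modelJ n a := by
  have tab' : ∀ (a b : Fin 3) (X : Matrix (Fin 4 × Fin n) (Fin 4 × Fin n) ℝ),
      modelJ n a * (modelJ n b * X) = (if a = b then -1 else
        if b = a + 1 then modelJ n (a + 2) else -modelJ n (a + 1)) * X := by
    intro a b X
    rw [← mul_assoc, modelJ_table]
  set C := K - ∑ a, modelJ n a * K * modelJ n a with hC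
  have hskew : Cᵀ = -C := by
    simp only [hC, Fin.sum_univ_three, Matrix.transpose_sub, Matrix.transpose_add,
      Matrix.transpose_mul, modelJ_transpose, hK]
    noncomm_ring
  have hcomm : ∀ b, C * modelJ n b = modelJ n b * C := by
    intro b
    simp only [hC, Fin.sum_univ_three, sub_mul, mul_sub, add_mul, mul_add, mul_assoc]
    fin_cases b <;> simp [modelJ_table, tab'] <;> abel
  have h1 : ∀ X Y : Matrix (Fin 4 × Fin n) (Fin 4 × Fin n) ℝ,
      ∑ j, ∑ k, X j k * Y j k = (X * Yᵀ).trace := by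
    intro X Y
    simp [Matrix.trace, Matrix.mul_apply]
  have h2 := h C ⟨hskew, hcomm⟩
  rw [h1] at h2
  have h3 : ∀ a, (modelJ n a * K * modelJ n a * Cᵀ).trace = -(K * Cᵀ).trace := by
    intro a
    have e : modelJ n a * K * modelJ n a * Cᵀ = modelJ n a * (K * (modelJ n a * Cᵀ)) := by
      simp only [mul_assoc]
    rw [e, Matrix.trace_mul_comm, mul_assoc, mul_assoc, hskew, neg_mul, hcomm, ← mul_neg,
      ← mul_assoc (modelJ n a), modelJ_sq]
    simp
  have h4 : (C * Cᵀ).trace = 0 := by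
    have e : C * Cᵀ = K * Cᵀ - ∑ a, modelJ n a * K * modelJ n a * Cᵀ := by
      rw [← Finset.sum_mul, ← sub_mul]
    rw [e, Matrix.trace_sub, Matrix.trace_sum]
    simp [h3, h2]
  have h5 : C = 0 := by
    rw [← h1] at h4
    ext j k
    have := (Finset.sum_eq_zero_iff_of_nonneg (fun j _ => Finset.sum_nonneg
      fun k _ => mul_self_nonneg (C j k))).1 h4 j (Finset.mem_univ _)
    have := (Finset.sum_eq_zero_iff_of_nonneg (fun k _ => mul_self_nonneg (C j k))).1 this k
      (Finset.mem_univ _)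
    simpa using this
  exact sub_eq_zero.1 h5

/-- A skew bilinear form which is orthogonal to `sp(n)`. -/
theorem tri_eq_of_mem_obsSpace {w : Tensor3 n} (hw : w ∈ obsSpace n) (x y z : Fin 4 × Fin n → ℝ) :
    tri w x y z = -∑ a, tri w x (Jv n a y) (Jv n a z) := by
  have hlin : ∀ K : Matrix (Fin 4 × Fin n) (Fin 4 × Fin n) ℝ,
      ∀ x y : Fin 4 × Fin n → ℝ, x ⬝ᵥ K *ᵥ y = ∑ j, ∑ k, K j k * (x j * y k) := by
    intro K x y
    simp only [dotProduct, Matrix.mulVec, Finset.mul_sum]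
    exact Finset.sum_congr rfl fun j _ => Finset.sum_congr rfl fun k _ => by ring
  have key : ∀ i, tri w (bv i) y z = -∑ a, tri w (bv i) (Jv n a y) (Jv n a z) := by
    intro i
    have hK := eq_sum_conj_modelJ (K := Matrix.of fun j k => w (i, j, k))
      (by ext j k; simpa using (hw i).1 k j)
      (fun C hC => (hw i).2 C (Submodule.mem_sup_left hC))
    have e : ∀ y z, tri w (bv i) y z = y ⬝ᵥ (Matrix.of fun j k => w (i, j, k)) *ᵥ z := by
      intro y z
      rw [hlin, tri_apply]
      simp [bv_apply]
    simp only [e]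
    conv_lhs => rw [hK]
    rw [Matrix.sum_mulVec, dotProduct_sum, ← Finset.sum_neg_distrib]
    refine Finset.sum_congr rfl fun a _ => ?_
    rw [← Matrix.mulVec_mulVec, ← Matrix.mulVec_mulVec, ← Jv_eq, ← Jv_eq, Jv_dot, neg_neg]
  rw [← sum_smul_bv x]
  simp only [map_sum, map_smul, LinearMap.sum_apply, LinearMap.smul_apply, key, smul_eq_mul]
  rw [Finset.sum_comm, ← Finset.sum_neg_distrib]
  exact Finset.sum_congr rfl fun i _ => by simp [Finset.mul_sum]

theorem isSkew_of_mem_obsSpace {w : Tensor3 n} (hw : w ∈ obsSpace n) : IsSkew w :=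
  fun i j k => (hw i).1 j k

/-- An element of `obsSpace` is determined by the quadratic forms `y ↦ w(x, J_a y, y)`. If they
vanish, polarization gives `w(x, J_a y, J_a z) = -w(x, y, z)`, and `tri_eq_of_mem_obsSpace` then
reads `w = 3 w`. -/
theorem eq_zero_of_tri_Jv {w : Tensor3 n} (hw : w ∈ obsSpace n)
    (h : ∀ a x y, tri w x (Jv n a y) y = 0) : w = 0 := by
  have h1 : ∀ a x y z, tri w x (Jv n a y) (Jv n a z) = -tri w x y z := by
    intro a x y z
    have e := h a x (y + Jv n a z)
    simp only [map_add, LinearMap.add_apply, h, Jv_sq, zero_add, map_neg,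
      LinearMap.neg_apply] at e
    rw [(isSkew_of_mem_obsSpace hw).tri x z y, (isSkew_of_mem_obsSpace hw).tri x z (Jv n a z),
      h] at e
    linarith
  refine tensor_ext_tri ?_
  ext x y z
  have := tri_eq_of_mem_obsSpace hw (Pi.single x 1) (Pi.single y 1) (Pi.single z 1)
  simp only [h1, Fin.sum_univ_three] at this
  simp only [LinearMap.coe_comp, Function.comp_apply, LinearMap.coe_single]
  have h0 : tri (0 : Tensor3 n) = 0 := by simp [tri]
  rw [h0]
  simp only [LinearMap.zero_apply]
  linarith

/-- Let `s(y) = w(x, J_a y, y)`. Skewness gives `s(J_a y) = s(y)`, and orthogonality to `sp(n)`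
gives `2 s(y) = s(J_{a+1} y) + s(J_{a+2} y)`. Replacing `y` by `J_{a+1} y` in the latter gives the
invariance under `J_{a+1}`, and then under `J_{a+2}`. -/
theorem tri_Jv_Jv {w : Tensor3 n} (hw : w ∈ obsSpace n) (a b : Fin 3) (x y : Fin 4 × Fin n → ℝ) :
    tri w x (Jv n a (Jv n b y)) (Jv n b y) = tri w x (Jv n a y) y := by
  have hs := (isSkew_of_mem_obsSpace hw).tri
  have key : ∀ a y, 2 * tri w x (Jv n a y) y =
      tri w x (Jv n a (Jv n (a + 1) y)) (Jv n (a + 1) y) +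
        tri w x (Jv n a (Jv n (a + 2) y)) (Jv n (a + 2) y) := by
    intro a y
    have e := tri_eq_of_mem_obsSpace hw x (Jv n a y) y
    have h3 : ∑ b, tri w x (Jv n b (Jv n a y)) (Jv n b y) =
        tri w x (Jv n a (Jv n a y)) (Jv n a y)
        + tri w x (Jv n (a + 1) (Jv n a y)) (Jv n (a + 1) y)
        + tri w x (Jv n (a + 2) (Jv n a y)) (Jv n (a + 2) y) := by
      rw [Fin.sum_univ_three]
      fin_cases a <;> simp <;> ring
    have h4 : Jv n (a + 1) (Jv n a y) = -Jv n a (Jv n (a + 1) y) := by rw [Jv_mul, Jv_mul']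
    have h5 : Jv n (a + 2) (Jv n a y) = -Jv n a (Jv n (a + 2) y) := by
      have h6 := Jv_mul (a + 2) y
      have h7 := Jv_mul' (a + 2) y
      have h8 : a + 2 + 1 = a := by fin_cases a <;> rfl
      rw [h8] at h6 h7
      rw [h6, h7, neg_neg]
    rw [h3, Jv_sq, h4, h5] at e
    have := hs x y (Jv n a y)
    simp only [map_neg, LinearMap.neg_apply] at e
    linarith
  have haa : ∀ a y, tri w x (Jv n a (Jv n a y)) (Jv n a y) = tri w x (Jv n a y) y := by
    intro a y
    rw [Jv_sq, map_neg, LinearMap.neg_apply, hs, neg_neg]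
  have e0 := key 0 (Jv n 0 y)
  have h1 : ∀ a, tri w x (Jv n a (Jv n (a + 1) y)) (Jv n (a + 1) y) = tri w x (Jv n a y) y := by
    intro a
    have e := key a (Jv n (a + 1) y)
    have h8 : Jv n (a + 2) (Jv n (a + 1) y) = -Jv n a y := by
      have := Jv_mul' (a + 1) y
      rwa [show a + 1 + 1 = a + 2 by fin_cases a <;> rfl,
        show a + 1 + 2 = a by fin_cases a <;> rfl] at this
    simp only [Jv_sq, h8, map_neg, LinearMap.neg_apply, neg_neg] at e
    have := haa a y
    simp only [Jv_sq, map_neg, LinearMap.neg_apply] at this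
    linarith
  have h2 : tri w x (Jv n a (Jv n (a + 2) y)) (Jv n (a + 2) y) = tri w x (Jv n a y) y := by
    linarith [key a y, h1 a]
  have hb : b = a ∨ b = a + 1 ∨ b = a + 2 := by fin_cases a <;> fin_cases b <;> simp
  rcases hb with rfl | rfl | rfl
  exacts [haa _ _, h1 _, h2]

theorem Jv_bv_zero (a : Fin 3) (l : Fin n) : Jv n a (bv (0, l)) = bv (a.succ, l) := by
  ext ⟨c, k⟩
  rw [Jv_bv_apply, modelJ_apply, bv_apply]
  fin_cases a <;> fin_cases c <;> simp [quatUnit]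

/-- Orthogonality to `J_a` says that the trace over all basis vectors vanishes; by `tri_Jv_Jv` the
four vectors of each quaternionic line contribute equally. -/
theorem sum_tri_bv_zero {w : Tensor3 n} (hw : w ∈ obsSpace n) (a : Fin 3)
    (x : Fin 4 × Fin n → ℝ) : ∑ l, tri w x (Jv n a (bv (0, l))) (bv (0, l)) = 0 := by
  have h1 : ∀ i, ∑ j, tri w (bv i) (Jv n a (bv j)) (bv j) = 0 := by
    intro i
    have h := (hw i).2 (modelJ n a) (Submodule.mem_sup_right (Submodule.subset_span ⟨a, rfl⟩))
    rw [Finset.sum_comm] at h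
    rw [← h]
    refine Finset.sum_congr rfl fun j _ => ?_
    rw [← sum_smul_bv (Jv n a (bv j))]
    simp only [map_sum, map_smul, LinearMap.sum_apply, LinearMap.smul_apply, tri_bv, smul_eq_mul,
      Jv_bv_apply]
    exact Finset.sum_congr rfl fun k _ => by ring
  have h2 : ∑ j, tri w x (Jv n a (bv j)) (bv j) = 0 := by
    rw [← sum_smul_bv x]
    simp only [map_sum, map_smul, LinearMap.sum_apply, LinearMap.smul_apply, smul_eq_mul]
    rw [Finset.sum_comm]
    simp [← Finset.mul_sum, h1]
  rw [Fintype.sum_prod_type, Finset.sum_comm] at h2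
  have h3 : ∀ (l : Fin n) (c : Fin 4), tri w x (Jv n a (bv (c, l))) (bv (c, l)) =
      tri w x (Jv n a (bv (0, l))) (bv (0, l)) := by
    intro l c
    refine Fin.cases rfl (fun b => ?_) c
    rw [← Jv_bv_zero, tri_Jv_Jv hw]
  simp only [h3, Finset.sum_const, Finset.card_univ, Fintype.card_fin, nsmul_eq_mul,
    ← Finset.mul_sum] at h2
  simpa using h2

/-! Elements of `Sp(n)·Sp(1)`. -/

/-- The `4 × 4`-matrix of right multiplication by a quaternion. -/
def rmat (c₀ : ℝ) (c : Fin 3 → ℝ) : Matrix (Fin 4) (Fin 4) ℝ :=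
  !![c₀, -c 0, -c 1, -c 2; c 0, c₀, c 2, -c 1; c 1, -c 2, c₀, c 0; c 2, c 1, -c 0, c₀]

theorem rmat_comm (c₀ : ℝ) (c : Fin 3 → ℝ) (a : Fin 3) :
    rmat c₀ c * quatUnit a = quatUnit a * rmat c₀ c := by
  ext i j
  fin_cases a <;> fin_cases i <;> fin_cases j <;>
    simp [rmat, quatUnit, Matrix.mul_apply, Fin.sum_univ_four]

theorem rmat_transpose_mul {c₀ : ℝ} {c : Fin 3 → ℝ} (hc : c₀ ^ 2 + ∑ a, c a ^ 2 = 1) :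
    (rmat c₀ c)ᵀ * rmat c₀ c = 1 := by
  rw [Fin.sum_univ_three] at hc
  ext i j
  fin_cases i <;> fin_cases j <;>
    simp [rmat, Matrix.mul_apply, Fin.sum_univ_four] <;>
    first
    | ring1
    | linear_combination hc

/-- The group `Sp(n)`. -/
def IsSp (B : Matrix (Fin 4 × Fin n) (Fin 4 × Fin n) ℝ) : Prop :=
  Bᵀ * B = 1 ∧ ∀ a, B * modelJ n a = modelJ n a * B

theorem IsSp.mem {B : Matrix (Fin 4 × Fin n) (Fin 4 × Fin n) ℝ} (hB : IsSp B) : B ∈ SpSp1 n :=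
  ⟨B, 1, 0, hB.1, hB.2, by simp, by simp⟩

theorem IsSp.mul {A B : Matrix (Fin 4 × Fin n) (Fin 4 × Fin n) ℝ} (hA : IsSp A) (hB : IsSp B) :
    IsSp (A * B) := by
  refine ⟨?_, fun a => ?_⟩
  · rw [Matrix.transpose_mul, mul_assoc, ← mul_assoc _ A, hA.1, one_mul, hB.1]
  · rw [mul_assoc, hB.2, ← mul_assoc, hA.2, mul_assoc]

theorem isSp_blockDiagonal_rmat {u₀ : Fin n → ℝ} {u : Fin n → Fin 3 → ℝ}
    (hu : ∀ k, u₀ k ^ 2 + ∑ a, u k a ^ 2 = 1) :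
    IsSp (Matrix.blockDiagonal (fun k => rmat (u₀ k) (u k))) := by
  refine ⟨?_, fun a => ?_⟩
  · rw [Matrix.blockDiagonal_transpose, ← Matrix.blockDiagonal_mul]
    simp only [rmat_transpose_mul (hu _), blockDiagonal_const_one]
  · rw [modelJ, ← Matrix.blockDiagonal_mul, ← Matrix.blockDiagonal_mul]
    simp only [rmat_comm]

theorem blockDiagonal_mulVec_apply (B : Fin n → Matrix (Fin 4) (Fin 4) ℝ)
    (x : Fin 4 × Fin n → ℝ) (c : Fin 4) (k : Fin n) :
    (Matrix.blockDiagonal B *ᵥ x) (c, k) = ∑ d, B k c d * x (d, k) := by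
  simp [Matrix.mulVec, dotProduct, Matrix.blockDiagonal_apply, Fintype.sum_prod_type]

/-- An orthogonal matrix of size `n` acting on `ℍⁿ`. -/
def realMat (O : Matrix (Fin n) (Fin n) ℝ) : Matrix (Fin 4 × Fin n) (Fin 4 × Fin n) ℝ :=
  Matrix.of fun i j => if i.1 = j.1 then O i.2 j.2 else 0

theorem realMat_mulVec_apply (O : Matrix (Fin n) (Fin n) ℝ) (x : Fin 4 × Fin n → ℝ) (c : Fin 4)
    (k : Fin n) : (realMat O *ᵥ x) (c, k) = ∑ l, O k l * x (c, l) := by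
  simp [realMat, Matrix.mulVec, dotProduct, Fintype.sum_prod_type]

theorem isSp_realMat {O : Matrix (Fin n) (Fin n) ℝ} (hO : Oᵀ * O = 1) : IsSp (realMat O) := by
  have hO' : ∀ k l, ∑ m, O m k * O m l = if k = l then 1 else 0 := by
    intro k l
    have := congrFun (congrFun hO k) l
    simpa [Matrix.mul_apply, Matrix.one_apply] using this
  refine ⟨?_, fun a => ?_⟩
  · ext ⟨c, k⟩ ⟨d, l⟩
    simp only [realMat, Matrix.mul_apply, Fintype.sum_prod_type, Matrix.transpose_apply,
      Matrix.of_apply, Matrix.one_apply, Prod.mk.injEq]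
    rw [Finset.sum_eq_single c (by intro e _ he; simp [he]) (by simp)]
    by_cases h : c = d
    · simp [h, hO']
    · simp [h]
  · ext ⟨c, k⟩ ⟨d, l⟩
    simp only [realMat, Matrix.mul_apply, Fintype.sum_prod_type, Matrix.of_apply, modelJ_apply]
    rw [Finset.sum_eq_single c (by intro e _ he; simp [he.symm]) (by simp),
      Finset.sum_eq_single d (by intro e _ he; simp [he]) (by simp)]
    simp [mul_comm]

/-- Conjugation by a unit quaternion. -/
theorem blockDiagonal_conj_mem {c₀ : ℝ} {c : Fin 3 → ℝ} (hc : c₀ ^ 2 + ∑ a, c a ^ 2 = 1) :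
    Matrix.blockDiagonal (fun _ : Fin n => rmat c₀ (-c) * lmat c₀ c) ∈ SpSp1 n := by
  have hB := isSp_blockDiagonal_rmat (u₀ := fun _ : Fin n => c₀) (u := fun _ => -c)
    (fun _ => by simpa using hc)
  exact ⟨_, c₀, c, hB.1, hB.2, hc, by rw [← blockDiagonal_lmat, Matrix.blockDiagonal_mul]⟩

end Model

/-! ### Rigidity of equivariant maps -/

section Model

variable {n : ℕ}

theorem IsEquivariant.tri {f : (Fin 4 × Fin n → ℝ) →ₗ[ℝ] Tensor3 n} (hf : IsEquivariant n f)
    {A : Matrix (Fin 4 × Fin n) (Fin 4 × Fin n) ℝ} (hA : A ∈ SpSp1 n)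
    (v x y z : Fin 4 × Fin n → ℝ) :
    tri (f (A *ᵥ v)) (A *ᵥ x) (A *ᵥ y) (A *ᵥ z) = QuaternionicCR.tri (f v) x y z := by
  have key : ∀ x y z, QuaternionicCR.tri (f (A *ᵥ v)) x y z =
      QuaternionicCR.tri (f v) (Aᵀ *ᵥ x) (Aᵀ *ᵥ y) (Aᵀ *ᵥ z) := by
    intro x y z
    have h : ∀ i j k, QuaternionicCR.tri (f v) (Aᵀ *ᵥ bv i) (Aᵀ *ᵥ bv j) (Aᵀ *ᵥ bv k) =
        QuaternionicCR.tri (f (A *ᵥ v)) (bv i) (bv j) (bv k) := by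
      intro i j k
      rw [tri_transpose_bv, ← hf.2 A hA, tri_bv]
    rw [← sum_smul_bv x, ← sum_smul_bv y, ← sum_smul_bv z]
    simp only [Matrix.mulVec_sum, Matrix.mulVec_smul, map_sum, map_smul, LinearMap.sum_apply,
      LinearMap.smul_apply, h]
  rw [key, mulVec_transpose_self hA, mulVec_transpose_self hA, mulVec_transpose_self hA]

theorem IsEquivariant.tri_left {f : (Fin 4 × Fin n → ℝ) →ₗ[ℝ] Tensor3 n} (hf : IsEquivariant n f)
    {A : Matrix (Fin 4 × Fin n) (Fin 4 × Fin n) ℝ} (hA : A ∈ SpSp1 n)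
    (v x y z : Fin 4 × Fin n → ℝ) :
    QuaternionicCR.tri (f (A *ᵥ v)) x (A *ᵥ y) (A *ᵥ z) =
      QuaternionicCR.tri (f v) (Aᵀ *ᵥ x) y z := by
  rw [← hf.tri hA v, Matrix.mulVec_mulVec, SpSp1.orthogonal hA, Matrix.one_mulVec]

theorem blockDiagonal_mulVec_bv (B : Fin n → Matrix (Fin 4) (Fin 4) ℝ) (c : Fin 4) (l : Fin n) :
    Matrix.blockDiagonal B *ᵥ bv (c, l) = ∑ d, B l d c • bv (d, l) := by
  ext ⟨d, k⟩
  rw [blockDiagonal_mulVec_apply]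
  simp only [bv_apply, Finset.sum_apply, Pi.smul_apply, Prod.mk.injEq, smul_eq_mul]
  by_cases h : k = l
  · simp [h]
  · simp [h]

theorem realMat_mulVec_bv (O : Matrix (Fin n) (Fin n) ℝ) (c : Fin 4) (l : Fin n) :
    realMat O *ᵥ bv (c, l) = ∑ k, O k l • bv (c, k) := by
  ext ⟨d, k⟩
  rw [realMat_mulVec_apply]
  simp only [bv_apply, Finset.sum_apply, Pi.smul_apply, Prod.mk.injEq, smul_eq_mul]
  by_cases h : d = c
  · simp [h]
  · simp [h]

/-- Reflections act transitively on spheres. -/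
theorem exists_orthogonal_mulVec (l : Fin n) (x : Fin n → ℝ) :
    ∃ O : Matrix (Fin n) (Fin n) ℝ, Oᵀ * O = 1 ∧ ∃ r : ℝ, O *ᵥ x = r • Pi.single l 1 := by
  set r := Real.sqrt (x ⬝ᵥ x) with hr
  have hr2 : r * r = x ⬝ᵥ x := Real.mul_self_sqrt
    (Finset.sum_nonneg fun i _ => mul_self_nonneg (x i))
  -- The reflection in the hyperplane orthogonal to `x - |x| e_l` exchanges `x` and `|x| e_l`; if
  -- the two agree, the identity serves.
  set z := x - r • (Pi.single l 1 : Fin n → ℝ) with hz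
  by_cases h0 : z = 0
  · exact ⟨1, by simp, r, by rw [Matrix.one_mulVec]; exact sub_eq_zero.1 h0⟩
  have hzz : z ⬝ᵥ z ≠ 0 := by simpa [dotProduct_self_eq_zero] using h0
  set t := 2 / (z ⬝ᵥ z) with ht
  have htz : t * (z ⬝ᵥ z) = 2 := div_mul_cancel₀ _ hzz
  refine ⟨1 - t • Matrix.vecMulVec z z, ?_, r, ?_⟩
  · have h1 : (Matrix.vecMulVec z z)ᵀ = Matrix.vecMulVec z z := by
      ext i j; simp [Matrix.vecMulVec_apply, mul_comm]
    have h2 : Matrix.vecMulVec z z * Matrix.vecMulVec z z = (z ⬝ᵥ z) • Matrix.vecMulVec z z := by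
      ext i j
      simp only [Matrix.mul_apply, Matrix.vecMulVec_apply, Matrix.smul_apply, smul_eq_mul,
        dotProduct, Finset.sum_mul]
      exact Finset.sum_congr rfl fun k _ => by ring
    rw [Matrix.transpose_sub, Matrix.transpose_smul, h1, Matrix.transpose_one, sub_mul, mul_sub,
      mul_sub, one_mul, one_mul, mul_one, smul_mul_assoc, mul_smul_comm, h2, smul_smul, smul_smul,
      mul_assoc, htz]
    module
  · have h1 : z ⬝ᵥ x = (z ⬝ᵥ z) / 2 := by
      have e1 : z ⬝ᵥ x = r * r - r * x l := by
        rw [hz, sub_dotProduct, ← hr2, smul_dotProduct]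
        simp
      have e2 : z ⬝ᵥ z = r * r - r * x l - r * (x l - r) := by
        conv_lhs => rw [hz]
        rw [dotProduct_sub, ← hz, e1, dotProduct_smul]
        simp [hz]
      rw [e1, e2]; ring
    rw [Matrix.sub_mulVec, Matrix.one_mulVec, Matrix.smul_mulVec, Matrix.vecMulVec_mulVec]
    have h2 : t * (z ⬝ᵥ x) = 1 := by rw [h1]; linarith
    have h3 : t • MulOpposite.op (z ⬝ᵥ x) • z = z := by
      rw [op_smul_eq_smul, smul_smul, h2, one_smul]
    rw [h3, hz]
    abel

/-- `Sp(n)` acts transitively on spheres. -/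
theorem exists_isSp_mulVec (l : Fin n) (y : Fin 4 × Fin n → ℝ) :
    ∃ A : Matrix (Fin 4 × Fin n) (Fin 4 × Fin n) ℝ, IsSp A ∧ ∃ r : ℝ, y = A *ᵥ (r • bv (0, l)) := by
  -- Polar decomposition of each quaternionic coordinate: a unit quaternion times a real number,
  -- with the unit `1` and modulus `0` for a vanishing coordinate.
  have h : ∀ k : Fin n, ∃ (u₀ : ℝ) (u : Fin 3 → ℝ) (r : ℝ), u₀ ^ 2 + ∑ a, u a ^ 2 = 1 ∧
      y (0, k) = u₀ * r ∧ ∀ a : Fin 3, y (a.succ, k) = u a * r := by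
    intro k
    set s := y (0, k) ^ 2 + ∑ a : Fin 3, y (a.succ, k) ^ 2 with hs
    have hs0 : 0 ≤ ∑ a : Fin 3, y (a.succ, k) ^ 2 := Finset.sum_nonneg fun a _ => sq_nonneg _
    by_cases h0 : s = 0
    · have h1 : y (0, k) = 0 := by
        have : y (0, k) ^ 2 = 0 := by nlinarith [sq_nonneg (y (0, k))]
        simpa using this
      have h2 : ∑ a : Fin 3, y (a.succ, k) ^ 2 = 0 := by nlinarith [sq_nonneg (y (0, k))]
      rw [Finset.sum_eq_zero_iff_of_nonneg fun a _ => sq_nonneg _] at h2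
      exact ⟨1, 0, 0, by simp, by simp [h1], fun a => by simpa using h2 a (Finset.mem_univ _)⟩
    · have hpos : 0 < s := lt_of_le_of_ne (by positivity) (Ne.symm h0)
      have hq : Real.sqrt s ≠ 0 := (Real.sqrt_pos.2 hpos).ne'
      refine ⟨y (0, k) / Real.sqrt s, fun a => y (a.succ, k) / Real.sqrt s, Real.sqrt s, ?_, ?_, ?_⟩
      · simp only [div_pow, Real.sq_sqrt hpos.le, ← Finset.sum_div, ← add_div, ← hs]
        exact div_self h0
      · field_simp
      · intro a; field_simp
  choose u₀ u r hu h0 h1 using h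
  -- Right multiplications have reduced `y` to the real vector of moduli, which a real orthogonal
  -- matrix moves to the axis `l`.
  obtain ⟨O, hO, s, hs⟩ := exists_orthogonal_mulVec l r
  have hO' : (Oᵀ)ᵀ * Oᵀ = 1 := by rw [Matrix.transpose_transpose]; exact mul_eq_one_comm.1 hO
  refine ⟨_, (isSp_blockDiagonal_rmat hu).mul (isSp_realMat hO'), s, ?_⟩
  have e : r = Oᵀ *ᵥ (s • Pi.single l 1) := by
    rw [← hs, Matrix.mulVec_mulVec, hO, Matrix.one_mulVec]
  have e' : ∀ k, s * Oᵀ k l = r k := by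
    intro k
    rw [e, Matrix.mulVec_smul]
    simp
  rw [← Matrix.mulVec_mulVec, Matrix.mulVec_smul, realMat_mulVec_bv, Finset.smul_sum]
  simp only [smul_smul, e']
  ext ⟨c, k⟩
  rw [blockDiagonal_mulVec_apply]
  simp only [Finset.sum_apply, Pi.smul_apply, bv_apply, Prod.mk.injEq, smul_eq_mul]
  rw [Fin.sum_univ_four]
  refine Fin.cases ?_ (fun a => ?_) c
  · simp [rmat, h0]
  · rw [h1]
    fin_cases a <;> simp [rmat]

/-- The matrix of a permutation of the coordinates. -/
theorem permMat_orthogonal (σ : Equiv.Perm (Fin n)) :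
    (Matrix.of fun i j => if i = σ j then (1 : ℝ) else 0)ᵀ *
      (Matrix.of fun i j => if i = σ j then (1 : ℝ) else 0) = 1 := by
  ext i j
  simp [Matrix.mul_apply, Matrix.one_apply, eq_comm]

theorem blockDiagonal_sign_mulVec_bv (B : Fin n → Matrix (Fin 4) (Fin 4) ℝ) (s : Fin n → Fin 4 → ℝ)
    (σ : Fin 4 → Fin 4)
    (c : Fin 4) (l : Fin n) (h : ∀ d, B l d c = if d = σ c then s l c else 0) :
    Matrix.blockDiagonal B *ᵥ bv (c, l) = s l c • bv (σ c, l) := by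
  rw [blockDiagonal_mulVec_bv]
  simp [h]

theorem tri_neg (w : Tensor3 n) (x y z : Fin 4 × Fin n → ℝ) :
    tri (-w) x y z = -tri w x y z := by
  simp [tri_apply]

theorem tri_sum_smul {ι : Type*} [Fintype ι] (x : ι → ℝ) (w : ι → Tensor3 n) :
    tri (∑ i, x i • w i) = ∑ i, x i • tri (w i) := by
  let T : Tensor3 n →ₗ[ℝ] (Fin 4 × Fin n → ℝ) →ₗ[ℝ] (Fin 4 × Fin n → ℝ) →ₗ[ℝ]
      (Fin 4 × Fin n → ℝ) →ₗ[ℝ] ℝ := ⟨⟨tri, tri_add⟩, tri_smul⟩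
  change T _ = ∑ i, x i • T (w i)
  simp only [map_sum, map_smul]

/-- One matrix entry controls the whole map. Signed permutations in `Sp(n)·Sp(1)` force the entries
`f(v)(x, I_a e, e)` with `v` and `e` in different quaternionic lines to vanish once this one does;
the trace condition covers the case of the same line, and transitivity of `Sp(n)` on spheres passes
from the basis vector `e` to all vectors. -/
theorem IsEquivariant.eq_zero {f : (Fin 4 × Fin n → ℝ) →ₗ[ℝ] Tensor3 n} (hf : IsEquivariant n f)
    {l₀ l₁ : Fin n} (hl : l₀ ≠ l₁) (h0 : QuaternionicCR.tri (f (bv (0, l₁))) (bv (1, l₁))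
      (bv (1, l₀)) (bv (0, l₀)) = 0) : f = 0 := by
  have hdiag : ∀ (c : Fin 4) (a : Fin 3), QuaternionicCR.tri (f (bv (0, l₁))) (bv (c, l₁))
      (bv (a.succ, l₀)) (bv (0, l₀)) = 0 := by
    -- Conjugation by the unit `b` fixes the coordinates `0` and `b.succ` and negates the two others
    -- in every line. Here exactly one of the four arguments changes sign.
    have hsign : ∀ b a c : Fin 3, c ≠ a → b = a ∨ b = c → QuaternionicCR.tri (f (bv (0, l₁)))
        (bv (c.succ, l₁)) (bv (a.succ, l₀)) (bv (0, l₀)) = 0 := by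
      intro b a c hca hb
      have hA := blockDiagonal_conj_mem (n := n) (c₀ := 0) (c := Pi.single b 1)
        (by simp [Pi.single_apply])
      have e : ∀ (c : Fin 4) (l : Fin n), Matrix.blockDiagonal
          (fun _ => rmat 0 (-Pi.single b 1) * lmat 0 (Pi.single b 1)) *ᵥ bv (c, l) =
          (if c = 0 ∨ c = b.succ then 1 else -1 : ℝ) • bv (c, l) := fun c l =>
        blockDiagonal_sign_mulVec_bv _ (fun _ c => if c = 0 ∨ c = b.succ then 1 else -1) id c l
          (fun d => by
            fin_cases b <;> fin_cases c <;> fin_cases d <;>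
              simp [rmat, lmat, Matrix.mul_apply, Fin.sum_univ_four, Fin.ext_iff])
      have := hf.tri hA (bv (0, l₁)) (bv (c.succ, l₁)) (bv (a.succ, l₀)) (bv (0, l₀))
      rw [e, e, e, e] at this
      rcases hb with rfl | rfl
      · simp [hca, Fin.succ_ne_zero] at this
        linarith
      · simp [hca.symm, Fin.succ_ne_zero] at this
        linarith
    have hzero : ∀ a : Fin 3, QuaternionicCR.tri (f (bv (0, l₁)))
        (bv (0, l₁)) (bv (a.succ, l₀)) (bv (0, l₀)) = 0 := by
      intro a
      have hA := blockDiagonal_conj_mem (n := n) (c₀ := 0) (c := Pi.single (a + 1) 1)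
        (by simp [Pi.single_apply])
      have e : ∀ (c : Fin 4) (l : Fin n), Matrix.blockDiagonal
          (fun _ => rmat 0 (-Pi.single (a + 1) 1) * lmat 0 (Pi.single (a + 1) 1)) *ᵥ bv (c, l) =
          (if c = 0 ∨ c = (a + 1).succ then 1 else -1 : ℝ) • bv (c, l) := fun c l =>
        blockDiagonal_sign_mulVec_bv _ (fun _ c => if c = 0 ∨ c = (a + 1).succ then 1 else -1)
          id c l (fun d => by
            generalize a + 1 = b
            fin_cases b <;> fin_cases c <;> fin_cases d <;>
              simp [rmat, lmat, Matrix.mul_apply, Fin.sum_univ_four, Fin.ext_iff])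
      have := hf.tri hA (bv (0, l₁)) (bv (0, l₁)) (bv (a.succ, l₀)) (bv (0, l₀))
      rw [e, e, e] at this
      simp [Fin.succ_ne_zero] at this
      linarith
    -- Conjugation by `(1 + i + j + k) / 2` permutes `i, j, k` cyclically, so the three diagonal
    -- entries vanish together.
    have hcyc : ∀ a b : Fin 3, b = a + 1 → QuaternionicCR.tri (f (bv (0, l₁)))
        (bv (a.succ, l₁)) (bv (a.succ, l₀)) (bv (0, l₀)) = 0 →
        QuaternionicCR.tri (f (bv (0, l₁))) (bv (b.succ, l₁)) (bv (b.succ, l₀)) (bv (0, l₀)) = 0 := by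
      rintro a b rfl h
      have hA := blockDiagonal_conj_mem (n := n) (c₀ := 1 / 2) (c := fun _ => 1 / 2)
        (by simp; norm_num)
      have e : ∀ (c : Fin 4) (l : Fin n), Matrix.blockDiagonal
          (fun _ => rmat (1 / 2) (-fun _ => 1 / 2) * lmat (1 / 2) (fun _ => 1 / 2)) *ᵥ bv (c, l) =
          bv ((![0, 2, 3, 1] : Fin 4 → Fin 4) c, l) := fun c l => by
        rw [blockDiagonal_sign_mulVec_bv _ (fun _ _ => 1) ![0, 2, 3, 1] c l
          (fun d => by
            fin_cases c <;> fin_cases d <;>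
              simp [rmat, lmat, Matrix.mul_apply, Fin.sum_univ_four] <;> norm_num), one_smul]
      have := hf.tri hA (bv (0, l₁)) (bv (a.succ, l₁)) (bv (a.succ, l₀)) (bv (0, l₀))
      rw [e, e, e, e, h] at this
      rw [← this]
      fin_cases a <;> rfl
    have h1 := hcyc 0 1 rfl h0
    have h2 := hcyc 1 2 rfl h1
    intro c a
    refine Fin.cases (hzero a) (fun c => ?_) c
    by_cases hca : c = a
    · subst hca
      fin_cases c
      exacts [h0, h1, h2]
    · exact hsign a a c hca (Or.inl rfl)
  -- The element of `Sp(n)` which is `-1` on the line `l₁` only changes the sign of the argument of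
  -- `f`.
  have hflip : ∀ (c : Fin 4) (l : Fin n) (a : Fin 3), l ≠ l₁ →
      QuaternionicCR.tri (f (bv (0, l₁))) (bv (c, l)) (bv (a.succ, l₀)) (bv (0, l₀)) = 0 := by
    intro c l a h
    have hA := (isSp_blockDiagonal_rmat (u₀ := fun k : Fin n => if k = l₁ then -1 else 1)
      (u := fun _ => 0) (fun k => by split_ifs <;> simp)).mem
    have e : ∀ (c : Fin 4) (l : Fin n), Matrix.blockDiagonal
        (fun k => rmat (if k = l₁ then -1 else 1) (0 : Fin 3 → ℝ)) *ᵥ bv (c, l) =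
        (if l = l₁ then -1 else 1 : ℝ) • bv (c, l) := fun c l =>
      blockDiagonal_sign_mulVec_bv _ (fun k _ => if k = l₁ then -1 else 1) id c l
        (fun d => by fin_cases c <;> fin_cases d <;> simp [rmat])
    have := hf.tri hA (bv (0, l₁)) (bv (c, l)) (bv (a.succ, l₀)) (bv (0, l₀))
    rw [e, e, e, e] at this
    simp [h, hl, tri_neg] at this
    linarith
  have hA0 : ∀ (a : Fin 3) x, QuaternionicCR.tri (f (bv (0, l₁))) x
      (bv (a.succ, l₀)) (bv (0, l₀)) = 0 := by
    intro a x
    rw [← sum_smul_bv x]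
    simp only [map_sum, map_smul, LinearMap.sum_apply, LinearMap.smul_apply]
    refine Finset.sum_eq_zero fun ⟨c, l⟩ _ => ?_
    by_cases h : l = l₁
    · rw [h, hdiag, smul_zero]
    · rw [hflip _ _ _ h, smul_zero]
  have hA1 : ∀ (c : Fin 4) (a : Fin 3) x, QuaternionicCR.tri (f (bv (c, l₁))) x
      (bv (a.succ, l₀)) (bv (0, l₀)) = 0 := by
    intro c a x
    refine Fin.cases (hA0 a x) (fun b => ?_) c
    -- Right multiplication by a unit quaternion on the line `l₁` alone carries `e_(0, l₁)` to
    -- `e_(b.succ, l₁)` and fixes the line `l₀`.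
    have hA := (isSp_blockDiagonal_rmat (u₀ := fun k : Fin n => if k = l₁ then 0 else 1)
      (u := fun k => if k = l₁ then Pi.single b 1 else 0)
      (fun k => by split_ifs <;> simp [Pi.single_apply])).mem
    have e1 : ∀ (c : Fin 4), Matrix.blockDiagonal
        (fun k => rmat (if k = l₁ then 0 else 1) (if k = l₁ then Pi.single b 1 else 0)) *ᵥ
          bv (c, l₀) = bv (c, l₀) := by
      intro c
      have := blockDiagonal_sign_mulVec_bv
        (fun k => rmat (if k = l₁ then 0 else 1) (if k = l₁ then Pi.single b 1 else 0))
        (fun _ _ => 1) id c l₀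
        (fun d => by fin_cases c <;> fin_cases d <;> simp [rmat, hl])
      simpa using this
    have e2 : Matrix.blockDiagonal
        (fun k => rmat (if k = l₁ then 0 else 1) (if k = l₁ then Pi.single b 1 else 0)) *ᵥ
          bv (0, l₁) = bv (b.succ, l₁) := by
      have := blockDiagonal_sign_mulVec_bv
        (fun k => rmat (if k = l₁ then 0 else 1) (if k = l₁ then Pi.single b 1 else 0))
        (fun _ _ => 1) (fun _ => b.succ) 0 l₁
        (fun d => by fin_cases b <;> fin_cases d <;> simp [rmat])
      simpa using this
    have := hf.tri_left hA (bv (0, l₁)) x (bv (a.succ, l₀)) (bv (0, l₀))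
    rw [e1, e1, e2] at this
    rw [this, hA0]
  have hoff : ∀ (c : Fin 4) (a : Fin 3) (l m : Fin n), l ≠ m → ∀ x,
      QuaternionicCR.tri (f (bv (c, l))) x (bv (a.succ, m)) (bv (0, m)) = 0 := by
    intro c a l m hlm x
    obtain ⟨σ, hσ0, hσ1⟩ : ∃ σ : Equiv.Perm (Fin n), σ l₀ = m ∧ σ l₁ = l := by
      -- The first swap sends `l₀` to `m`; the second one corrects the image of `l₁` without moving
      -- `m`.
      refine ⟨Equiv.swap (Equiv.swap l₀ m l₁) l * Equiv.swap l₀ m, ?_, ?_⟩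
      · rw [Equiv.Perm.mul_apply, Equiv.swap_apply_left]
        refine Equiv.swap_apply_of_ne_of_ne (fun h => hl ?_) hlm.symm
        refine (Equiv.swap l₀ m).injective ?_
        rw [Equiv.swap_apply_left, ← h]
      · simp
    have hA := (isSp_realMat (permMat_orthogonal σ)).mem
    have e : ∀ (c : Fin 4) (l : Fin n), realMat (Matrix.of fun i j => if i = σ j then (1 : ℝ) else 0)
        *ᵥ bv (c, l) = bv (c, σ l) := by
      intro c l
      rw [realMat_mulVec_bv]
      simp
    have := hf.tri_left hA (bv (c, l₁)) x (bv (a.succ, l₀)) (bv (0, l₀))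
    rw [e, e, e, hσ0, hσ1] at this
    rw [this, hA1]
  have hall : ∀ (c : Fin 4) (a : Fin 3) (l m : Fin n) x,
      QuaternionicCR.tri (f (bv (c, l))) x (bv (a.succ, m)) (bv (0, m)) = 0 := by
    intro c a l m x
    by_cases h : l = m
    · subst h
      -- All summands of the trace over the lines other than `l` are known to vanish, so the one for
      -- `l` does as well.
      have := sum_tri_bv_zero (hf.1 (bv (c, l))) a x
      simp only [Jv_bv_zero] at this
      rwa [Finset.sum_eq_single l (fun m _ hm => hoff c a l m hm.symm x) (by simp)] at this
    · exact hoff c a l m h x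
  have hv : ∀ (a : Fin 3) v x,
      QuaternionicCR.tri (f v) x (Jv n a (bv (0, l₀))) (bv (0, l₀)) = 0 := by
    intro a v x
    rw [← sum_smul_bv v, Jv_bv_zero]
    have hs : QuaternionicCR.tri (∑ i, v i • f (bv i)) = ∑ i, v i • QuaternionicCR.tri (f (bv i)) := by
      rw [← tri_sum_smul]
    simp only [map_sum, map_smul, hs, LinearMap.sum_apply, LinearMap.smul_apply]
    exact Finset.sum_eq_zero fun ⟨c, l⟩ _ => by rw [hall, smul_zero]
  refine LinearMap.ext fun v => eq_zero_of_tri_Jv (hf.1 v) fun a x y => ?_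
  obtain ⟨A, hA, r, rfl⟩ := exists_isSp_mulVec l₀ y
  have e : Jv n a (A *ᵥ (r • bv (0, l₀))) = A *ᵥ Jv n a (r • bv (0, l₀)) := by
    rw [Jv_eq, Jv_eq, Matrix.mulVec_mulVec, Matrix.mulVec_mulVec, hA.2]
  have e' : v = A *ᵥ (Aᵀ *ᵥ v) := by
    rw [Matrix.mulVec_mulVec, SpSp1.orthogonal hA.mem, Matrix.one_mulVec]
  rw [e, e', hf.tri_left hA.mem]
  simp [hv]

theorem IsEquivariant.sub_smul {f g : (Fin 4 × Fin n → ℝ) →ₗ[ℝ] Tensor3 n}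
    (hf : IsEquivariant n f) (hg : IsEquivariant n g) (c : ℝ) : IsEquivariant n (f - c • g) := by
  refine ⟨fun w => (obsSpace n).sub_mem (hf.1 w) ((obsSpace n).smul_mem _ (hg.1 w)),
    fun A hA w i j k => ?_⟩
  change f (A *ᵥ w) (i, j, k) - c * g (A *ᵥ w) (i, j, k) = ∑ i', ∑ j', ∑ k',
    A i i' * A j j' * A k k' * (f w (i', j', k') - c * g w (i', j', k'))
  rw [hf.2 A hA, hg.2 A hA]
  simp only [Finset.mul_sum, ← Finset.sum_sub_distrib]
  exact Finset.sum_congr rfl fun _ _ => Finset.sum_congr rfl fun _ _ =>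
    Finset.sum_congr rfl fun _ _ => by ring

/-- The entry that controls an equivariant map equals `1 / n` for `ehMap`, so subtracting `c * n`
times `ehMap` kills it. -/
theorem IsEquivariant.eq_smul_ehMap (hn : 2 ≤ n) {f : (Fin 4 × Fin n → ℝ) →ₗ[ℝ] Tensor3 n}
    (hf : IsEquivariant n f) : ∃ c : ℝ, f = c • ehMap n := by
  have hn0 : n ≠ 0 := by omega
  have hn' : (n : ℝ) ≠ 0 := by exact_mod_cast hn0
  let l₀ : Fin n := ⟨0, by omega⟩
  let l₁ : Fin n := ⟨1, by omega⟩
  have hl : l₀ ≠ l₁ := by simp [l₀, l₁]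
  set c := QuaternionicCR.tri (f (bv (0, l₁))) (bv (1, l₁)) (bv (1, l₀)) (bv (0, l₀)) with hc
  have he : QuaternionicCR.tri (ehMap n (bv (0, l₁))) (bv (1, l₁)) (bv (1, l₀)) (bv (0, l₀)) =
      1 / n := by
    rw [tri_ehMap]
    simp only [dot_bv, Fin.sum_univ_three, Jv_bv_apply, modelJ_apply, bv_apply]
    simp [hl, quatUnit]
  have hg := hf.sub_smul (isEquivariant_ehMap hn0) (c * n)
  refine ⟨c * n, sub_eq_zero.1 (hg.eq_zero hl ?_)⟩
  rw [LinearMap.sub_apply, sub_eq_add_neg, tri_add, LinearMap.add_apply, LinearMap.add_apply,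
    LinearMap.add_apply, tri_neg, LinearMap.smul_apply, tri_smul]
  simp only [LinearMap.smul_apply, he, ← hc, smul_eq_mul]
  field_simp
  ring

/-- The `E ⊗ H`-component of a tensor vanishes if and only if its form `ehForm` does. -/
theorem omegaEH_eq_zero_iff (hn : 2 ≤ n) {w : Tensor3 n} (hw : IsSkew w) :
    omegaEH n w = 0 ↔ ∀ v, ehForm w v = 0 := by
  have hn0 : n ≠ 0 := by omega
  have hobs : ∀ v, inner ℝ (ehMap n v) (omegaObs n w) = ehForm w v := by
    intro v
    rw [← inner_ehMap hw, omegaObs, ← Submodule.inner_starProjection_left_eq_right,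
      Submodule.starProjection_eq_self_iff.2 (ehMap_mem_obsSpace hn0 v)]
  rw [omegaEH, Submodule.starProjection_apply_eq_zero_iff]
  constructor
  · intro h v
    rw [← hobs]
    refine (Submodule.mem_orthogonal _ _).1 h _ ?_
    exact Submodule.mem_iSup_of_mem (ehMap n) (Submodule.mem_iSup_of_mem
      (isEquivariant_ehMap hn0) (LinearMap.mem_range_self _ v))
  · intro h
    -- By multiplicity one the isotypic component is the image of the single map `ehMap`, so testing
    -- against its values suffices.
    have hle : ehSpace n ≤ LinearMap.range (ehMap n) := by
      refine iSup_le fun f => iSup_le fun hf => ?_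
      obtain ⟨c, rfl⟩ := hf.eq_smul_ehMap hn
      rintro _ ⟨v, rfl⟩
      exact ⟨c • v, by simp⟩
    refine (Submodule.mem_orthogonal _ _).2 fun u hu => ?_
    obtain ⟨v, rfl⟩ := hle hu
    rw [hobs, h]

end Model

/-! ## Calculus of vector fields -/

section Calculus

set_option linter.unusedSectionVars false

variable {n : ℕ} {M : Type*} [TopologicalSpace M] [ChartedSpace (Mdl n) M]

instance (q : M) : FiniteDimensional ℝ (Tan n q) :=
  inferInstanceAs (FiniteDimensional ℝ (Mdl n))

theorem finrank_tan (q : M) : finrank ℝ (Tan n q) = 4 * n + 3 := by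
  have : finrank ℝ (Tan n q) = finrank ℝ (Mdl n) := rfl
  rw [this]; simp

variable (n) in
/-- The function `f` is smooth at `q`. -/
def SmoothFun (f : M → ℝ) (q : M) : Prop := ContMDiffAt 𝓘(ℝ, Mdl n) 𝓘(ℝ, ℝ) ∞ f q

variable (n) in
/-- The function `f` is differentiable at `q`. -/
def DiffFun (f : M → ℝ) (q : M) : Prop := MDifferentiableAt 𝓘(ℝ, Mdl n) 𝓘(ℝ, ℝ) f q

/-- The bracket of vector fields. -/
def br (X Y : ∀ p : M, Tan n p) (q : M) : Tan n q := mlieBracket 𝓘(ℝ, Mdl n) X Y q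

section Functions

variable {f g : M → ℝ} {q : M}

theorem SmoothFun.diff (hf : SmoothFun n f q) : DiffFun n f q :=
  ContMDiffAt.mdifferentiableAt hf (by simp)

theorem smoothFun_const (c : ℝ) : SmoothFun n (fun _ : M => c) q := contMDiffAt_const

theorem SmoothFun.add (hf : SmoothFun n f q) (hg : SmoothFun n g q) :
    SmoothFun n (fun p => f p + g p) q := ContMDiffAt.add hf hg

theorem SmoothFun.sub (hf : SmoothFun n f q) (hg : SmoothFun n g q) :
    SmoothFun n (fun p => f p - g p) q := ContMDiffAt.sub hf hg

theorem SmoothFun.mul (hf : SmoothFun n f q) (hg : SmoothFun n g q) :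
    SmoothFun n (fun p => f p * g p) q := ContMDiffAt.mul hf hg

theorem SmoothFun.sum {ι : Type*} {s : Finset ι} {f : ι → M → ℝ}
    (hf : ∀ i ∈ s, SmoothFun n (f i) q) : SmoothFun n (fun p => ∑ i ∈ s, f i p) q := by
  classical
  induction s using Finset.induction_on with
  | empty => simpa using smoothFun_const 0
  | insert i s hi ih =>
    simp only [Finset.sum_insert hi]
    exact (hf _ (by simp)).add (ih fun j hj => hf j (by simp [hj]))

theorem SmoothFun.congr (hf : SmoothFun n f q) (h : g =ᶠ[𝓝 q] f) : SmoothFun n g q :=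
  ContMDiffAt.congr_of_eventuallyEq hf h

theorem SmoothFun.comp {φ : ℝ → ℝ} (hφ : ContDiffAt ℝ ∞ φ (f q)) (hf : SmoothFun n f q) :
    SmoothFun n (fun p => φ (f p)) q :=
  ContMDiffAt.comp (I' := 𝓘(ℝ, ℝ)) q hφ.contMDiffAt hf

theorem SmoothFun.inv (hf : SmoothFun n f q) (h : f q ≠ 0) : SmoothFun n (fun p => (f p)⁻¹) q :=
  SmoothFun.comp (φ := fun x => x⁻¹) (contDiffAt_inv ℝ h) hf

theorem SmoothFun.continuousAt (hf : SmoothFun n f q) : ContinuousAt f q :=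
  ContMDiffAt.continuousAt hf

theorem DiffFun.add (hf : DiffFun n f q) (hg : DiffFun n g q) :
    DiffFun n (fun p => f p + g p) q := MDifferentiableAt.add hf hg

theorem DiffFun.mul (hf : DiffFun n f q) (hg : DiffFun n g q) :
    DiffFun n (fun p => f p * g p) q := MDifferentiableAt.mul hf hg

theorem DiffFun.sum {ι : Type*} {s : Finset ι} {f : ι → M → ℝ}
    (hf : ∀ i ∈ s, DiffFun n (f i) q) : DiffFun n (fun p => ∑ i ∈ s, f i p) q := by
  classical
  induction s using Finset.induction_on with
  | empty => simpa using (smoothFun_const 0).diff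
  | insert i s hi ih =>
    simp only [Finset.sum_insert hi]
    exact (hf _ (by simp)).add (ih fun j hj => hf j (by simp [hj]))

theorem DiffFun.congr (hf : DiffFun n f q) (h : g =ᶠ[𝓝 q] f) : DiffFun n g q :=
  MDifferentiableAt.congr_of_eventuallyEq hf h

theorem dirDeriv_congr (h : f =ᶠ[𝓝 q] g) (v : Tan n q) : dirDeriv f q v = dirDeriv g q v := by
  have : mfderiv 𝓘(ℝ, Mdl n) 𝓘(ℝ, ℝ) f q = mfderiv 𝓘(ℝ, Mdl n) 𝓘(ℝ, ℝ) g q := h.mfderiv_eq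
  simp only [dirDeriv, mvfderiv]
  change (NormedSpace.fromTangentSpace (f q)) (mfderiv 𝓘(ℝ, Mdl n) 𝓘(ℝ, ℝ) f q v) =
    (NormedSpace.fromTangentSpace (g q)) (mfderiv 𝓘(ℝ, Mdl n) 𝓘(ℝ, ℝ) g q v)
  rw [this]
  rfl

theorem dirDeriv_const (c : ℝ) (v : Tan n q) : dirDeriv (fun _ => c) q v = 0 := by
  rw [dirDeriv, mvfderiv_const]; rfl

theorem dirDeriv_add (hf : DiffFun n f q) (hg : DiffFun n g q) (v : Tan n q) :
    dirDeriv (fun p => f p + g p) q v = dirDeriv f q v + dirDeriv g q v := by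
  rw [dirDeriv, mvfderiv_fun_add hf hg]; rfl

theorem dirDeriv_sub (hf : DiffFun n f q) (hg : DiffFun n g q) (v : Tan n q) :
    dirDeriv (fun p => f p - g p) q v = dirDeriv f q v - dirDeriv g q v := by
  have : (fun p => f p - g p) = f - g := rfl
  rw [dirDeriv, this, mvfderiv_sub hf hg]; rfl

theorem dirDeriv_mul (hf : DiffFun n f q) (hg : DiffFun n g q) (v : Tan n q) :
    dirDeriv (fun p => f p * g p) q v = f q * dirDeriv g q v + g q * dirDeriv f q v := by
  rw [dirDeriv, mvfderiv_fun_mul hf hg]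
  simp [dirDeriv]

theorem dirDeriv_sum {ι : Type*} {s : Finset ι} {f : ι → M → ℝ}
    (hf : ∀ i ∈ s, DiffFun n (f i) q) (v : Tan n q) :
    dirDeriv (fun p => ∑ i ∈ s, f i p) q v = ∑ i ∈ s, dirDeriv (f i) q v := by
  classical
  induction s using Finset.induction_on with
  | empty => simpa using dirDeriv_const 0 v
  | insert i s hi ih =>
    simp only [Finset.sum_insert hi]
    rw [dirDeriv_add (hf _ (by simp)) (DiffFun.sum fun j hj => hf j (by simp [hj])),
      ih fun j hj => hf j (by simp [hj])]

theorem dirDeriv_add_right (v w : Tan n q) :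
    dirDeriv f q (v + w) = dirDeriv f q v + dirDeriv f q w := map_add _ _ _

theorem dirDeriv_smul_right (c : ℝ) (v : Tan n q) :
    dirDeriv f q (c • v) = c * dirDeriv f q v := map_smul (mvfderiv 𝓘(ℝ, Mdl n) f q) c v

end Functions

/-! ### Smooth vector fields and their brackets -/

section Fields

variable [IsManifold 𝓘(ℝ, Mdl n) ∞ M]

variable {X Y Z : ∀ p : M, Tan n p} {f : M → ℝ} {q : M}

theorem SmoothAt.diffAt (hX : SmoothAt X q) : DiffAt X q := ContMDiffAt.mdifferentiableAt hX (by simp)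

theorem SmoothAt.eventually_diffAt (hX : SmoothAt X q) : ∀ᶠ p in 𝓝 q, DiffAt X p := by
  have h : ContMDiffAt 𝓘(ℝ, Mdl n) (𝓘(ℝ, Mdl n).prod 𝓘(ℝ, Mdl n)) 1
    (fun p => (TotalSpace.mk' (Mdl n) p (X p) : TangentBundle 𝓘(ℝ, Mdl n) M)) q := hX.of_le (by simp)
  filter_upwards [(contMDiffAt_iff_contMDiffAt_nhds (by simp)).1 h] with p hp
  exact hp.mdifferentiableAt (by simp)

theorem SmoothFun.eventually_diff (hf : SmoothFun n f q) : ∀ᶠ p in 𝓝 q, DiffFun n f p := by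
  have h : ContMDiffAt 𝓘(ℝ, Mdl n) 𝓘(ℝ, ℝ) 1 f q := hf.of_le (by simp)
  filter_upwards [(contMDiffAt_iff_contMDiffAt_nhds (by simp)).1 h] with p hp
  exact hp.mdifferentiableAt (by simp)

theorem SmoothAt.congr (hX : SmoothAt X q) (h : ∀ᶠ p in 𝓝 q, Y p = X p) : SmoothAt Y q :=
  ContMDiffAt.congr_of_eventuallyEq hX (h.mono fun p hp => by simp [hp])

theorem SmoothAt.add (hX : SmoothAt X q) (hY : SmoothAt Y q) : SmoothAt (fun p => X p + Y p) q :=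
  ContMDiffAt.add_section hX hY

theorem SmoothAt.sub (hX : SmoothAt X q) (hY : SmoothAt Y q) : SmoothAt (fun p => X p - Y p) q :=
  ContMDiffAt.sub_section hX hY

theorem SmoothAt.smul (hf : SmoothFun n f q) (hX : SmoothAt X q) : SmoothAt (fun p => f p • X p) q :=
  ContMDiffAt.smul_section hf hX

theorem SmoothAt.sum {ι : Type*} {s : Finset ι} {X : ι → ∀ p : M, Tan n p}
    (hX : ∀ i ∈ s, SmoothAt (X i) q) : SmoothAt (fun p => ∑ i ∈ s, X i p) q :=
  ContMDiffAt.sum_section hX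

theorem smoothAt_zero : SmoothAt (fun p : M => (0 : Tan n p)) q :=
  (contMDiff_zeroSection ℝ (fun p : M => Tan n p)).contMDiffAt

theorem DiffAt.add (hX : DiffAt X q) (hY : DiffAt Y q) : DiffAt (fun p => X p + Y p) q :=
  mdifferentiableAt_add_section hX hY

theorem DiffAt.smul (hf : DiffFun n f q) (hX : DiffAt X q) : DiffAt (fun p => f p • X p) q :=
  MDifferentiableAt.smul_section hf hX

/-- Every tangent vector extends to a vector field which is smooth near the point. -/
theorem exists_extension (v : Tan n q) : ∃ X : ∀ p : M, Tan n p, X q = v ∧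
    ∃ V : Opens M, q ∈ V ∧ ∀ p ∈ V, SmoothAt X p := by
  obtain ⟨s, hs, h⟩ := FiberBundle.exists_contMDiffOn_extend 𝓘(ℝ, Mdl n) (Mdl n) (k := ∞)
    (V := fun p : M => Tan n p) v
  obtain ⟨t, hts, ht, hq⟩ := mem_nhds_iff.1 hs
  exact ⟨FiberBundle.extend (Mdl n) v, by simp, ⟨t, ht⟩, hq, fun p hp =>
    (h p (hts hp)).contMDiffAt (mem_of_superset (ht.mem_nhds hp) hts)⟩

theorem isManifold_of_le_infty {k : WithTop ℕ∞} (hk : k ≤ ∞) : IsManifold 𝓘(ℝ, Mdl n) k M :=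
  IsManifold.of_le hk

theorem SmoothAt.br (hX : SmoothAt X q) (hY : SmoothAt Y q) : SmoothAt (br X Y) q := by
  have h2 : minSmoothness ℝ 2 ≤ (∞ : WithTop ℕ∞) := by
    rw [minSmoothness_of_isRCLikeNormedField]
    exact (WithTop.coe_le_coe.2 le_top : ((2 : ℕ∞) : WithTop ℕ∞) ≤ _)
  have := isManifold_of_le_infty (M := M) (n := n) h2
  have : IsManifold 𝓘(ℝ, Mdl n) (∞ + 1) M := isManifold_of_le_infty (by simp)
  exact ContMDiffAt.mlieBracket_vectorField (m := ⊤) (n := ⊤) hX hY (by simp)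

theorem br_congr {X' Y' : ∀ p : M, Tan n p} (hX : ∀ᶠ p in 𝓝 q, X p = X' p)
    (hY : ∀ᶠ p in 𝓝 q, Y p = Y' p) : br X Y q = br X' Y' q :=
  Filter.EventuallyEq.mlieBracket_vectorField_eq hX hY

theorem br_swap : br X Y q = -br Y X q := mlieBracket_swap_apply

theorem br_smul_right (hf : DiffFun n f q) (hY : DiffAt Y q) :
    br X (fun p => f p • Y p) q = dirDeriv f q (X q) • Y q + f q • br X Y q :=
  mlieBracket_smul_right hf hY

theorem br_add_right (hY : DiffAt Y q) (hZ : DiffAt Z q) :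
    br X (fun p => Y p + Z p) q = br X Y q + br X Z q :=
  mlieBracket_add_right hY hZ

theorem br_jacobi (hX : SmoothAt X q) (hY : SmoothAt Y q) (hZ : SmoothAt Z q) :
    br X (br Y Z) q = br (br X Y) Z q + br Y (br X Z) q := by
  have h : minSmoothness ℝ 3 ≤ (∞ : WithTop ℕ∞) := by
    rw [minSmoothness_of_isRCLikeNormedField]
    exact (WithTop.coe_le_coe.2 le_top : ((3 : ℕ∞) : WithTop ℕ∞) ≤ _)
  have h' : minSmoothness ℝ 2 ≤ (∞ : WithTop ℕ∞) := by
    rw [minSmoothness_of_isRCLikeNormedField]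
    exact (WithTop.coe_le_coe.2 le_top : ((2 : ℕ∞) : WithTop ℕ∞) ≤ _)
  have : IsManifold 𝓘(ℝ, Mdl n) (minSmoothness ℝ 3) M := isManifold_of_le_infty h
  exact leibniz_identity_mlieBracket_apply (hX.of_le h') (hY.of_le h') (hZ.of_le h')

/-- Derivatives of smooth functions along smooth vector fields are smooth. -/
theorem SmoothFun.dirDeriv (hf : SmoothFun n f q) (hX : SmoothAt X q) :
    SmoothFun n (fun p => dirDeriv f p (X p)) q := by
  have h1 := ContMDiffAt.mfderiv_const (m := ∞) hf (by simp)
  have h2 := ContMDiffAt.clm_apply_of_inCoordinates (m₀ := q) (b₁ := fun p : M => p) (b₂ := f)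
    (ϕ := fun p => mfderiv 𝓘(ℝ, Mdl n) 𝓘(ℝ, ℝ) f p) (v := X)
    (E₁ := fun p : M => Tan n p) (E₂ := fun x : ℝ => TangentSpace 𝓘(ℝ, ℝ) x) h1 hX hf
  exact ContMDiffAt.comp q (contMDiff_snd_tangentBundle_modelSpace ℝ 𝓘(ℝ, ℝ)).contMDiffAt h2

/-- The bracket is the commutator of derivations. -/
theorem dirDeriv_br (hf : SmoothFun n f q) (hX : SmoothAt X q) (hY : SmoothAt Y q) :
    dirDeriv f q (br X Y q) =
      dirDeriv (fun p => dirDeriv f p (Y p)) q (X q) - dirDeriv (fun p => dirDeriv f p (X p)) q (Y q) := by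
  have : Nontrivial (Tan n q) := Module.nontrivial_of_finrank_pos (R := ℝ) (by
    rw [finrank_tan]; omega)
  -- The Jacobi identity is expanded for `X`, `Y` and `f • Z`. Jacobi for `X, Y, Z` and the mixed
  -- first-order terms cancel; the claimed identity remains as the coefficient of `Z q`, so a field
  -- with `Z q ≠ 0` is chosen.
  obtain ⟨z, hz⟩ := exists_ne (0 : Tan n q)
  obtain ⟨Z, rfl, V, hV, hZ'⟩ := exists_extension z
  have hZ := hZ' q hV
  have key : ∀ X Y : ∀ p : M, Tan n p, SmoothAt X q → SmoothAt Y q →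
      br X (br Y fun p => f p • Z p) q = dirDeriv (fun p => dirDeriv f p (Y p)) q (X q) • Z q
        + dirDeriv f q (Y q) • br X Z q + dirDeriv f q (X q) • br Y Z q + f q • br X (br Y Z) q := by
    intro X Y hX hY
    have e : ∀ᶠ p in 𝓝 q, br Y (fun p => f p • Z p) p = dirDeriv f p (Y p) • Z p + f p • br Y Z p := by
      filter_upwards [hf.eventually_diff, hZ.eventually_diffAt] with p h1 h2
      exact br_smul_right h1 h2
    rw [br_congr (Eventually.of_forall fun _ => rfl) e,
      br_add_right (DiffAt.smul (hf.dirDeriv hY).diff hZ.diffAt) (DiffAt.smul hf.diff (hY.br hZ).diffAt),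
      br_smul_right (hf.dirDeriv hY).diff hZ.diffAt, br_smul_right hf.diff (hY.br hZ).diffAt]
    abel
  have h1 := br_jacobi hX hY (SmoothAt.smul hf hZ)
  rw [key X Y hX hY, key Y X hY hX, br_smul_right hf.diff hZ.diffAt, br_jacobi hX hY hZ,
    smul_add] at h1
  have h2 : (dirDeriv f q (br X Y q) - (dirDeriv (fun p => dirDeriv f p (Y p)) q (X q) -
      dirDeriv (fun p => dirDeriv f p (X p)) q (Y q))) • Z q = 0 := by
    have h3 : (dirDeriv f q (br X Y q)) • Z q = dirDeriv (fun p => dirDeriv f p (Y p)) q (X q) • Z q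
        - dirDeriv (fun p => dirDeriv f p (X p)) q (Y q) • Z q := by
      rw [eq_sub_iff_add_eq, ← sub_eq_zero]
      rw [← sub_eq_zero] at h1
      rw [← neg_eq_zero, ← h1]
      abel
    rw [sub_smul, sub_smul, h3, sub_self]
  have := (smul_eq_zero.1 h2).resolve_right hz
  linarith

end Fields

end Calculus

/-! ### Exterior derivatives of one-forms -/

section Forms

set_option linter.unusedSectionVars false

variable {n : ℕ} {M : Type*} [TopologicalSpace M] [ChartedSpace (Mdl n) M]
  [IsManifold 𝓘(ℝ, Mdl n) ∞ M] {η : ∀ p : M, Tan n p →L[ℝ] ℝ} {U : Opens M} {q : M}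
  {X Y Z : ∀ p : M, Tan n p}

theorem mem_eventually (U : Opens M) (hq : q ∈ U) : ∀ᶠ p in 𝓝 q, p ∈ U := U.2.mem_nhds hq

theorem SmoothFormOn.smoothFun (hη : SmoothFormOn η U) (hq : q ∈ U) (hX : SmoothAt X q) :
    SmoothFun n (fun p => η p (X p)) q := by
  have h := ContMDiffAt.clm_bundle_apply (E₂ := Bundle.Trivial M ℝ)
    ((hη q hq).contMDiffAt (U.2.mem_nhds hq)) hX
  rw [contMDiffAt_totalSpace] at h
  simpa [SmoothFun] using h.2

theorem SmoothFormOn.diffFun (hη : SmoothFormOn η U) (hq : q ∈ U) (hX : DiffAt X q) :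
    DiffFun n (fun p => η p (X p)) q := by
  have h := MDifferentiableAt.clm_bundle_apply (E₂ := Bundle.Trivial M ℝ)
    (((hη q hq).contMDiffAt (U.2.mem_nhds hq)).mdifferentiableAt (by simp)) hX
  rw [mdifferentiableAt_totalSpace] at h
  simpa [DiffFun] using h.2

theorem SmoothFormOn.dForm_eq (hη : SmoothFormOn η U) (hq : q ∈ U) (hX : DiffAt X q)
    (hY : DiffAt Y q) : dForm η q (X q) (Y q) = dirDeriv (fun p => η p (Y p)) q (X q)
      - dirDeriv (fun p => η p (X p)) q (Y q) - η q (br X Y q) :=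
  dForm_apply U.2 hη hq hX hY

theorem SmoothFormOn.dForm_swap (hη : SmoothFormOn η U) (hq : q ∈ U) (v w : Tan n q) :
    dForm η q v w = -dForm η q w v := by
  obtain ⟨X, rfl, V, hV, hX⟩ := exists_extension v
  obtain ⟨Y, rfl, W, hW, hY⟩ := exists_extension w
  rw [hη.dForm_eq hq (hX q hV).diffAt (hY q hW).diffAt,
    hη.dForm_eq hq (hY q hW).diffAt (hX q hV).diffAt, br_swap, map_neg]
  ring

theorem SmoothFormOn.dForm_add_right (hη : SmoothFormOn η U) (hq : q ∈ U) (v w w' : Tan n q) :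
    dForm η q v (w + w') = dForm η q v w + dForm η q v w' := by
  obtain ⟨X, rfl, V, hV, hX⟩ := exists_extension v
  obtain ⟨Y, rfl, W, hW, hY⟩ := exists_extension w
  obtain ⟨Z, rfl, W', hW', hZ⟩ := exists_extension w'
  have hX := (hX q hV).diffAt
  have hY := (hY q hW).diffAt
  have hZ := (hZ q hW').diffAt
  have h := hη.dForm_eq hq hX (DiffAt.add hY hZ)
  rw [br_add_right hY hZ] at h
  simp only [map_add] at h
  rw [h, hη.dForm_eq hq hX hY, hη.dForm_eq hq hX hZ,
    dirDeriv_add (hη.diffFun hq hY) (hη.diffFun hq hZ), dirDeriv_add_right]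
  ring

theorem SmoothFormOn.dForm_smul_right (hη : SmoothFormOn η U) (hq : q ∈ U) (c : ℝ)
    (v w : Tan n q) : dForm η q v (c • w) = c * dForm η q v w := by
  obtain ⟨X, rfl, V, hV, hX⟩ := exists_extension v
  obtain ⟨Y, rfl, W, hW, hY⟩ := exists_extension w
  have hX := (hX q hV).diffAt
  have hY := (hY q hW).diffAt
  have hc : SmoothFun n (fun _ : M => c) q := smoothFun_const c
  have h := hη.dForm_eq hq hX (DiffAt.smul hc.diff hY)
  rw [br_smul_right hc.diff hY] at h
  simp only [map_add, map_smul, smul_eq_mul, dirDeriv_const] at h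
  rw [h, hη.dForm_eq hq hX hY, dirDeriv_mul hc.diff (hη.diffFun hq hY), dirDeriv_smul_right,
    dirDeriv_const]
  ring

/-- The exterior derivative of a one-form at a point, as a bilinear form. -/
def SmoothFormOn.dBilin (hη : SmoothFormOn η U) (hq : q ∈ U) : LinearMap.BilinForm ℝ (Tan n q) :=
  LinearMap.mk₂ ℝ (dForm η q)
    (fun v v' w => by
      rw [hη.dForm_swap hq, hη.dForm_add_right hq, hη.dForm_swap hq w, hη.dForm_swap hq w]; ring)
    (fun c v w => by
      rw [hη.dForm_swap hq, hη.dForm_smul_right hq, hη.dForm_swap hq w, smul_eq_mul]; ring)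
    (fun v w w' => hη.dForm_add_right hq v w w')
    (fun c v w => hη.dForm_smul_right hq c v w)

@[simp]
theorem SmoothFormOn.dBilin_apply (hη : SmoothFormOn η U) (hq : q ∈ U) (v w : Tan n q) :
    hη.dBilin hq v w = dForm η q v w := rfl

theorem SmoothFormOn.eventually_dForm_eq (hη : SmoothFormOn η U) (hq : q ∈ U) (hX : SmoothAt X q)
    (hY : SmoothAt Y q) : ∀ᶠ p in 𝓝 q, dForm η p (X p) (Y p) =
      dirDeriv (fun p => η p (Y p)) p (X p)
      - dirDeriv (fun p => η p (X p)) p (Y p) - η p (br X Y p) := by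
  filter_upwards [mem_eventually U hq, hX.eventually_diffAt, hY.eventually_diffAt] with p h1 h2 h3
  exact hη.dForm_eq h1 h2 h3

theorem SmoothFormOn.smoothFun_dForm (hη : SmoothFormOn η U) (hq : q ∈ U) (hX : SmoothAt X q)
    (hY : SmoothAt Y q) : SmoothFun n (fun p => dForm η p (X p) (Y p)) q := by
  have h1 := (hη.smoothFun hq hY).dirDeriv hX
  have h2 := (hη.smoothFun hq hX).dirDeriv hY
  exact ((h1.sub h2).sub (hη.smoothFun hq (hX.br hY))).congr (hη.eventually_dForm_eq hq hX hY)

/-- The exterior derivative of an exact two-form vanishes. -/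
theorem SmoothFormOn.d_dForm (hη : SmoothFormOn η U) (hq : q ∈ U) (hX : SmoothAt X q)
    (hY : SmoothAt Y q) (hZ : SmoothAt Z q) :
    dForm η q (br X Y q) (Z q) + dForm η q (br Y Z q) (X q) + dForm η q (br Z X q) (Y q) =
      dirDeriv (fun p => dForm η p (Y p) (Z p)) q (X q)
      + dirDeriv (fun p => dForm η p (Z p) (X p)) q (Y q)
      + dirDeriv (fun p => dForm η p (X p) (Y p)) q (Z q) := by
  have key : ∀ X Y Z : ∀ p : M, Tan n p, SmoothAt X q → SmoothAt Y q → SmoothAt Z q →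
      dirDeriv (fun p => dForm η p (Y p) (Z p)) q (X q) =
        dirDeriv (fun p => dirDeriv (fun p => η p (Z p)) p (Y p)) q (X q)
        - dirDeriv (fun p => dirDeriv (fun p => η p (Y p)) p (Z p)) q (X q)
        - dirDeriv (fun p => η p (br Y Z p)) q (X q) := by
    intro X Y Z hX hY hZ
    have h1 := (hη.smoothFun hq hZ).dirDeriv hY
    have h2 := (hη.smoothFun hq hY).dirDeriv hZ
    rw [dirDeriv_congr (hη.eventually_dForm_eq hq hY hZ),
      dirDeriv_sub (h1.sub h2).diff (hη.smoothFun hq (hY.br hZ)).diff,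
      dirDeriv_sub h1.diff h2.diff]
  have key2 : ∀ X Y Z : ∀ p : M, Tan n p, SmoothAt X q → SmoothAt Y q → SmoothAt Z q →
      dForm η q (br X Y q) (Z q) =
        dirDeriv (fun p => dirDeriv (fun p => η p (Z p)) p (Y p)) q (X q)
        - dirDeriv (fun p => dirDeriv (fun p => η p (Z p)) p (X p)) q (Y q)
        - dirDeriv (fun p => η p (br X Y p)) q (Z q) - η q (br (br X Y) Z q) := by
    intro X Y Z hX hY hZ
    rw [hη.dForm_eq hq (hX.br hY).diffAt hZ.diffAt, dirDeriv_br (hη.smoothFun hq hZ) hX hY]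
  rw [key X Y Z hX hY hZ, key Y Z X hY hZ hX, key Z X Y hZ hX hY, key2 X Y Z hX hY hZ,
    key2 Y Z X hY hZ hX, key2 Z X Y hZ hX hY]
  -- Second derivatives cancel once brackets act as commutators; the terms of order zero in `η` are
  -- those of the Jacobi identity.
  have hj : η q (br (br X Y) Z q) + η q (br (br Y Z) X q) + η q (br (br Z X) Y q) = 0 := by
    have h := br_jacobi hX hY hZ
    have e1 : br (br Y Z) X q = -br X (br Y Z) q := br_swap
    have e2 : br (br Z X) Y q = br Y (br X Z) q := by
      rw [br_swap, br_congr (X := Y) (X' := Y) (Y := br Z X) (Y' := fun p => (-1 : ℝ) • br X Z p)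
        (Eventually.of_forall fun _ => rfl)
        (Eventually.of_forall fun p => by rw [br_swap]; simp),
        br_smul_right (smoothFun_const (-1)).diff (hX.br hZ).diffAt, dirDeriv_const]
      simp
    rw [← map_add, ← map_add, e1, e2, h]
    simp
  linarith

/-- A fibrewise linear functional which maps smooth vector fields to smooth functions maps
differentiable ones to differentiable functions. -/
theorem diffFun_of_smoothFun {κ : ∀ p : M, Tan n p →ₗ[ℝ] ℝ}
    (hκ : ∀ X : ∀ p : M, Tan n p, SmoothAt X q → SmoothFun n (fun p => κ p (X p)) q)
    (hX : DiffAt X q) : DiffFun n (fun p => κ p (X p)) q := by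
  let e := trivializationAt (Mdl n) (fun p : M => Tan n p) q
  let b := Module.finBasis ℝ (Mdl n)
  have hq : q ∈ e.baseSet := FiberBundle.mem_baseSet_trivializationAt' q
  have h1 : ∀ i, SmoothAt (e.localFrame b i) q := fun i =>
    contMDiffAt_localFrame_of_mem ∞ e b i hq
  have h2 : ∀ i, DiffFun n (fun p => e.localFrameCoeff 𝓘(ℝ, Mdl n) b i p (X p)) q := fun i =>
    mdifferentiableAt_localFrameCoeff b hq hX i
  refine (DiffFun.sum (s := Finset.univ) fun i _ => (h2 i).mul (hκ _ (h1 i)).diff).congr ?_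
  filter_upwards [e.eventually_eq_localFrame_sum_coeff_smul (I := 𝓘(ℝ, Mdl n)) b (s := X) hq] with p hp
  conv_lhs => rw [hp]
  simp

/-- A section of `Hom(TM, TM)` is smooth if it maps smooth vector fields to smooth ones. -/
theorem contMDiffAt_hom_of_smoothAt {A : ∀ p : M, Tan n p →L[ℝ] Tan n p}
    (hA : ∀ X : ∀ p : M, Tan n p, SmoothAt X q → SmoothAt (fun p => A p (X p)) q) :
    ContMDiffAt 𝓘(ℝ, Mdl n) (𝓘(ℝ, Mdl n).prod 𝓘(ℝ, Mdl n →L[ℝ] Mdl n)) ∞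
      (fun p => (⟨p, A p⟩ : TotalSpace (Mdl n →L[ℝ] Mdl n) fun p : M => Tan n p →L[ℝ] Tan n p)) q := by
  rw [contMDiffAt_hom_bundle]
  refine ⟨contMDiffAt_id, ?_⟩
  let e := trivializationAt (Mdl n) (fun p : M => Tan n p) q
  let b := Module.finBasis ℝ (Mdl n)
  have hq : q ∈ e.baseSet := FiberBundle.mem_baseSet_trivializationAt' q
  have h1 : ∀ i, SmoothAt (e.localFrame b i) q := fun i =>
    contMDiffAt_localFrame_of_mem ∞ e b i hq
  have h2 : ∀ i, ContMDiffAt 𝓘(ℝ, Mdl n) 𝓘(ℝ, Mdl n) ∞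
      (fun p => (e ⟨p, A p (e.localFrame b i p)⟩).2) q := by
    intro i
    have := hA _ (h1 i)
    rw [SmoothAt, contMDiffAt_section] at this
    exact this
  -- `Λ` rebuilds a linear map from its values on a basis, so that smoothness of `A` follows from
  -- smoothness of its columns.
  let Λ : (Fin (finrank ℝ (Mdl n)) → Mdl n) →ₗ[ℝ] (Mdl n →L[ℝ] Mdl n) :=
    LinearMap.toContinuousLinearMap.toLinearMap ∘ₗ (b.constr ℝ).toLinearMap
  have h3 : ContMDiffAt 𝓘(ℝ, Mdl n) 𝓘(ℝ, Mdl n →L[ℝ] Mdl n) ∞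
      (fun p => (LinearMap.toContinuousLinearMap Λ) fun i => (e ⟨p, A p (e.localFrame b i p)⟩).2) q :=
    (LinearMap.toContinuousLinearMap Λ).contMDiff.contMDiffAt.comp q (contMDiffAt_pi_space.2 h2)
  refine h3.congr_of_eventuallyEq ?_
  filter_upwards [e.open_baseSet.mem_nhds hq] with p hp
  have hlin : ∀ B B' : Mdl n →L[ℝ] Mdl n, (∀ i, B (b i) = B' (b i)) → B = B' := fun B B' h =>
    ContinuousLinearMap.coe_injective (b.ext h)
  refine hlin _ _ fun i => ?_
  rw [ContinuousLinearMap.inCoordinates_eq hp hp]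
  have e1 : (LinearMap.toContinuousLinearMap Λ)
      (fun i => (e ⟨p, A p (e.localFrame b i p)⟩).2) (b i) =
      (e ⟨p, A p (e.localFrame b i p)⟩).2 := by
    simp [Λ]
  rw [e1, e.localFrame_apply_of_mem_baseSet b hp]
  rfl

end Forms

/-! ## Quaternion-hermitian vector spaces -/

section Hermitian

variable {n : ℕ} {V : Type*} [AddCommGroup V] [Module ℝ V]

theorem fin3_cases (a b : Fin 3) : b = a ∨ b = a + 1 ∨ b = a + 2 := by
  fin_cases a <;> fin_cases b <;> simp

theorem fin3_add (a : Fin 3) : a + 1 + 1 = a + 2 ∧ a + 1 + 2 = a ∧ a + 2 + 1 = a ∧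
    a + 2 + 2 = a + 1 := by
  fin_cases a <;> simp

theorem fin3_ne (a : Fin 3) : a + 1 ≠ a ∧ a + 2 ≠ a ∧ a + 1 ≠ a + 2 ∧ a ≠ a + 1 ∧ a ≠ a + 2 ∧
    a + 2 ≠ a + 1 := by
  fin_cases a <;> decide

theorem fin3_sum {W : Type*} [AddCommMonoid W] (f : Fin 3 → W) (a : Fin 3) :
    ∑ b, f b = f a + f (a + 1) + f (a + 2) := by
  rw [Fin.sum_univ_three]
  fin_cases a
  · rfl
  · change _ = f 1 + f 2 + f 0
    abel
  · change _ = f 2 + f 0 + f 1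
    abel

/-- A quaternion-hermitian structure on a real vector space. -/
structure IsQuatHerm (γ : LinearMap.BilinForm ℝ V) (I : Fin 3 → Module.End ℝ V) : Prop where
  symm : ∀ x y, γ x y = γ y x
  pos : ∀ x, x ≠ 0 → 0 < γ x x
  sq : ∀ a x, I a (I a x) = -x
  mul : ∀ a x, I a (I (a + 1) x) = I (a + 2) x
  mul' : ∀ a x, I (a + 1) (I a x) = -I (a + 2) x
  skew : ∀ a x y, γ (I a x) y = -γ x (I a y)

namespace IsQuatHerm

variable {γ : LinearMap.BilinForm ℝ V} {I : Fin 3 → Module.End ℝ V} (h : IsQuatHerm γ I)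

include h

theorem mul₂ (a : Fin 3) (x : V) : I (a + 2) (I a x) = I (a + 1) x := by
  have := h.mul (a + 2) x
  rwa [(fin3_add a).2.2.1, (fin3_add a).2.2.2] at this

theorem mul₂' (a : Fin 3) (x : V) : I a (I (a + 2) x) = -I (a + 1) x := by
  have := h.mul' (a + 2) x
  rwa [(fin3_add a).2.2.1, (fin3_add a).2.2.2] at this

theorem herm (a : Fin 3) (x y : V) : γ (I a x) (I a y) = γ x y := by
  rw [h.skew, h.sq, map_neg, neg_neg]

theorem self (a : Fin 3) (x : V) : γ (I a x) x = 0 := by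
  have h1 := h.skew a x x
  rw [h.symm x] at h1
  linarith

theorem eq_zero_of_forall {x : V} (hx : ∀ y, γ x y = 0) : x = 0 := by
  by_contra h0
  exact (h.pos x h0).ne' (hx x)

theorem ext {x x' : V} (hx : ∀ y, γ x y = γ x' y) : x = x' := by
  rw [← sub_eq_zero]
  exact h.eq_zero_of_forall fun y => by rw [map_sub, LinearMap.sub_apply, hx, sub_self]

omit h in
/-- The identity and the three complex structures. -/
def all (I : Fin 3 → Module.End ℝ V) : Fin 4 → Module.End ℝ V := Fin.cons 1 I

omit h in
@[simp] theorem all_zero (x : V) : all I 0 x = x := rfl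

omit h in
@[simp] theorem all_succ (a : Fin 3) (x : V) : all I a.succ x = I a x := rfl

/-- The orthogonal complement of a quaternionic line is a quaternionic subspace, so four vanishing
products force all sixteen to vanish. -/
theorem orthogonal_all {x y : V} (h0 : γ x y = 0) (ha : ∀ a, γ (I a x) y = 0) (c d : Fin 4) :
    γ (all I c x) (all I d y) = 0 := by
  refine Fin.cases ?_ (fun a => ?_) c <;> refine Fin.cases ?_ (fun b => ?_) d
  · simpa using h0
  · have := h.skew b x y
    rw [ha] at this
    simp only [all_zero, all_succ]
    linarith
  · simpa using ha a
  · have h1 := h.skew b (I a x) y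
    simp only [all_succ]
    rcases fin3_cases a b with rfl | rfl | rfl
    · rw [h.herm, h0]
    · rw [h.mul', map_neg, LinearMap.neg_apply, ha] at h1
      linarith
    · rw [h.mul₂, ha] at h1
      linarith

theorem orthonormal_all {x : V} (h0 : γ x x = 1) (c d : Fin 4) :
    γ (all I c x) (all I d x) = if c = d then 1 else 0 := by
  refine Fin.cases ?_ (fun a => ?_) c <;> refine Fin.cases ?_ (fun b => ?_) d
  · simpa using h0
  · simp only [all_zero, all_succ, (Fin.succ_ne_zero b).symm, if_false]
    rw [h.symm, h.self]
  · simp only [all_zero, all_succ, Fin.succ_ne_zero, if_false]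
    rw [h.self]
  · have h1 := h.skew b (I a x) x
    simp only [all_succ, Fin.succ_inj]
    rcases fin3_cases a b with rfl | rfl | rfl
    · rw [h.herm, h0]; simp
    · rw [h.mul', map_neg, LinearMap.neg_apply, h.self] at h1
      rw [if_neg (fin3_ne a).2.2.2.1]
      linarith
    · rw [h.mul₂, h.self] at h1
      rw [if_neg (fin3_ne a).2.2.2.2.1]
      linarith

end IsQuatHerm

/-- An adapted orthonormal basis. -/
structure IsAdaptedBasis (γ : LinearMap.BilinForm ℝ V) (I : Fin 3 → Module.End ℝ V)
    (e : Fin 4 × Fin n → V) : Prop where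
  orth : ∀ i j, γ (e i) (e j) = if i = j then 1 else 0
  adapted : ∀ (a : Fin 3) k, e (a.succ, k) = I a (e (0, k))

/-- The linear combination of the vectors of a family. -/
def lc (e : Fin 4 × Fin n → V) : (Fin 4 × Fin n → ℝ) →ₗ[ℝ] V := Fintype.linearCombination ℝ e

theorem lc_apply (e : Fin 4 × Fin n → V) (x : Fin 4 × Fin n → ℝ) : lc e x = ∑ i, x i • e i := by
  simp [lc, Fintype.linearCombination_apply]

@[simp]
theorem lc_bv (e : Fin 4 × Fin n → V) (i : Fin 4 × Fin n) : lc e (bv i) = e i := by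
  simp [lc_apply, bv_apply]

namespace IsAdaptedBasis

variable {γ : LinearMap.BilinForm ℝ V} {I : Fin 3 → Module.End ℝ V} {e : Fin 4 × Fin n → V}
  (he : IsAdaptedBasis γ I e)

include he

theorem γ_lc (x y : Fin 4 × Fin n → ℝ) : γ (lc e x) (lc e y) = x ⬝ᵥ y := by
  simp only [lc_apply, map_sum, map_smul, LinearMap.sum_apply, LinearMap.smul_apply, he.orth,
    smul_eq_mul]
  simp [dotProduct, mul_comm]

theorem γ_lc_left (x : Fin 4 × Fin n → ℝ) (i : Fin 4 × Fin n) : γ (lc e x) (e i) = x i := by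
  rw [← lc_bv e i, he.γ_lc, dot_bv]

theorem linearIndependent : LinearIndependent ℝ e := by
  rw [Fintype.linearIndependent_iff]
  intro g hg i
  rw [← he.γ_lc_left g i, lc_apply, hg]
  simp

/-- In adapted coordinates the `I_a` become the model structures `J_a`; this transports the algebra
of `ℍⁿ` to the fibres of `Q`. -/
theorem I_lc (h : IsQuatHerm γ I) (a : Fin 3) (x : Fin 4 × Fin n → ℝ) :
    I a (lc e x) = lc e (Jv n a x) := by
  suffices H : I a ∘ₗ lc e = lc e ∘ₗ Jv n a from LinearMap.congr_fun H x
  refine (Pi.basisFun ℝ _).ext fun i => ?_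
  have h0 : ∀ b k, lc e (Jv n b (bv (0, k))) = I b (e (0, k)) := by
    intro b k
    rw [Jv_bv_zero, lc_bv, he.adapted]
  have hbv : ∀ i, I a (lc e (bv i)) = lc e (Jv n a (bv i)) := by
    rintro ⟨c, k⟩
    refine Fin.cases ?_ (fun b => ?_) c
    · rw [h0, lc_bv]
    · rw [← Jv_bv_zero, h0]
      rcases fin3_cases a b with rfl | rfl | rfl
      · rw [h.sq, Jv_sq, map_neg, lc_bv]
      · rw [h.mul, Jv_mul, h0]
      · rw [h.mul₂']
        have := Jv_mul' (a + 2) (bv (n := n) (0, k))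
        rw [(fin3_add a).2.2.1, (fin3_add a).2.2.2] at this
        rw [this, map_neg, h0]
  simpa [bv] using hbv i

theorem γ_I (h : IsQuatHerm γ I) (a : Fin 3) (i j : Fin 4 × Fin n) :
    γ (I a (e i)) (e j) = modelJ n a j i := by
  rw [← lc_bv e i, he.I_lc h, he.γ_lc_left, Jv_bv_apply]

variable [FiniteDimensional ℝ V]

theorem lc_γ (hd : finrank ℝ V = 4 * n) (x : V) : lc e (fun i => γ x (e i)) = x := by
  have hs : Submodule.span ℝ (range e) = ⊤ :=
    he.linearIndependent.span_eq_top_of_card_eq_finrank' (by simp [hd])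
  have hx : x ∈ Submodule.span ℝ (range e) := hs ▸ Submodule.mem_top
  obtain ⟨c, rfl⟩ := (Submodule.mem_span_range_iff_exists_fun ℝ).1 hx
  rw [← lc_apply]
  congr 1
  funext i
  exact he.γ_lc_left c i

theorem eq_sum (hd : finrank ℝ V = 4 * n) (x : V) : x = ∑ i, γ x (e i) • e i := by
  conv_lhs => rw [← he.lc_γ hd x, lc_apply]

end IsAdaptedBasis

end Hermitian

/-! ## Contact frames -/

section Contact

variable {n : ℕ} {M : Type*} [TopologicalSpace M] [ChartedSpace (Mdl n) M]
  [IsManifold 𝓘(ℝ, Mdl n) ∞ M]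

namespace QCStructure

variable (C : QCStructure n M)

/-- The local frames `(I, η)` of a quaternionic contact structure. -/
abbrev Frame (U : Opens M) (I : Fin 3 → ∀ q : M, Module.End ℝ (C.Q q))
    (η : Fin 3 → ∀ q : M, Tan n q →L[ℝ] ℝ) : Prop :=
  IsContactFrame C.Q C.γ C.sphere U I η

/-- Smooth sections of `Q`. -/
def SmoothSec (X : ∀ p : M, C.Q p) (q : M) : Prop := SmoothAt (fun p => (X p : Tan n p)) q

variable {C} {X Y : ∀ p : M, C.Q p} {q : M} {f : M → ℝ}

theorem SmoothSec.sub (hX : C.SmoothSec X q) (hY : C.SmoothSec Y q) :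
    C.SmoothSec (fun p => X p - Y p) q := SmoothAt.sub hX hY

theorem SmoothSec.smul (hf : SmoothFun n f q) (hX : C.SmoothSec X q) :
    C.SmoothSec (fun p => f p • X p) q := SmoothAt.smul hf hX

theorem SmoothSec.sum {ι : Type*} {s : Finset ι} {X : ι → ∀ p : M, C.Q p}
    (hX : ∀ i ∈ s, C.SmoothSec (X i) q) : C.SmoothSec (fun p => ∑ i ∈ s, X i p) q := by
  have := SmoothAt.sum (X := fun i p => (X i p : Tan n p)) hX
  simpa [SmoothSec] using this

theorem SmoothSec.γ (hX : C.SmoothSec X q) (hY : C.SmoothSec Y q) :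
    SmoothFun n (fun p => C.γ p (X p) (Y p)) q := C.smooth_γ q X Y hX hY

variable (C) in
open Classical in
/-- A vector field as a section of `Q`, where this makes sense. -/
def toSec (X : ∀ p : M, Tan n p) (p : M) : C.Q p := if h : X p ∈ C.Q p then ⟨X p, h⟩ else 0

theorem toSec_coe {X : ∀ p : M, Tan n p} {p : M} (h : X p ∈ C.Q p) :
    (C.toSec X p : Tan n p) = X p := by
  simp [toSec, h]

theorem smoothSec_toSec {X : ∀ p : M, Tan n p} (hX : SmoothAt X q) (h : ∀ᶠ p in 𝓝 q, X p ∈ C.Q p) :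
    C.SmoothSec (C.toSec X) q :=
  SmoothAt.congr hX (h.mono fun _ hp => toSec_coe hp)

theorem finrank_Q (q : M) : finrank ℝ (C.Q q) = 4 * n := by
  obtain ⟨V, hq, X, hX⟩ := C.subbundle q trivial
  obtain ⟨-, hli, hspan⟩ := hX q hq
  rw [← hspan trivial, finrank_span_eq_card hli, Fintype.card_fin]

theorem exists_section (v : C.Q q) : ∃ X : ∀ p : M, C.Q p, X q = v ∧
    ∃ V : Opens M, q ∈ V ∧ ∀ p ∈ V, C.SmoothSec X p := by
  obtain ⟨V, hq, X, hX⟩ := C.subbundle q trivial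
  have hv : (v : Tan n q) ∈ Submodule.span ℝ (range fun i => X i q) := by
    rw [(hX q hq).2.2 trivial]; exact v.2
  obtain ⟨c, hc⟩ := (Submodule.mem_span_range_iff_exists_fun ℝ).1 hv
  have hmem : ∀ p ∈ V, ∑ i, c i • X i p ∈ C.Q p := by
    intro p hp
    rw [← (hX p hp).2.2 trivial]
    exact Submodule.sum_mem _ fun i _ => Submodule.smul_mem _ _ (Submodule.subset_span ⟨i, rfl⟩)
  refine ⟨C.toSec fun p => ∑ i, c i • X i p, ?_, V, hq, fun p hp => ?_⟩
  · ext1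
    rw [toSec_coe (hmem q hq), hc]
  · refine smoothSec_toSec (SmoothAt.sum fun i _ => SmoothAt.smul (smoothFun_const _)
      ((hX p hp).1 i)) ?_
    filter_upwards [mem_eventually V hp] with p hp using hmem p hp

namespace Frame

variable {U : Opens M} {I : Fin 3 → ∀ q : M, Module.End ℝ (C.Q q)}
  {η : Fin 3 → ∀ q : M, Tan n q →L[ℝ] ℝ} (F : C.Frame U I η)

include F

theorem mono {V : Opens M} (hV : V ≤ U) : C.Frame V I η where
  smooth_I a q hq := F.smooth_I a q (hV hq)
  quat q hq := F.quat q (hV hq)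
  sphere q hq := F.sphere q (hV hq)
  smooth_η a := (F.smooth_η a).mono hV
  ker q hq := F.ker q (hV hq)
  compat q hq := F.compat q (hV hq)

theorem mem_sphere (hq : q ∈ U) (a : Fin 3) : I a q ∈ C.sphere q := by
  rw [F.sphere q hq]
  exact ⟨Pi.single a 1, by simp, by simp [Pi.single_apply]⟩

theorem isQuatHerm (hq : q ∈ U) : IsQuatHerm (C.γ q) (fun a => I a q) := by
  have hsq : ∀ a, I a q * I a q = -1 := fun a => C.sq q _ (F.mem_sphere hq a)
  have hsq' : ∀ a x, I a q (I a q x) = -x := fun a x => by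
    have := LinearMap.congr_fun (hsq a) x
    simpa using this
  obtain ⟨h1, h2⟩ := F.quat q hq
  have m01 : ∀ x, I 0 q (I 1 q x) = I 2 q x := fun x => LinearMap.congr_fun h1 x
  have m10 : ∀ x, I 1 q (I 0 q x) = -I 2 q x := fun x => LinearMap.congr_fun h2 x
  have m02 : ∀ x, I 0 q (I 2 q x) = -I 1 q x := fun x => by rw [← m01, hsq']
  have m12 : ∀ x, I 1 q (I 2 q x) = I 0 q x := fun x => by
    have := m10 (I 1 q x)
    rw [m01] at this
    have h3 : I 2 q (I 1 q x) = -I 0 q x := by rw [← m01, hsq', map_neg]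
    rw [this, h3, neg_neg]
  have m21 : ∀ x, I 2 q (I 1 q x) = -I 0 q x := fun x => by rw [← m01, hsq', map_neg]
  have m20 : ∀ x, I 2 q (I 0 q x) = I 1 q x := fun x => by
    have := m10 (I 0 q x)
    rw [hsq', map_neg] at this
    exact (neg_injective this).symm
  refine ⟨C.symm q, C.pos q, hsq', ?_, ?_, ?_⟩
  · intro a x
    fin_cases a
    exacts [m01 x, m12 x, m20 x]
  · intro a x
    fin_cases a
    exacts [m10 x, m21 x, m02 x]
  · intro a x y
    have := C.hermitian q _ (F.mem_sphere hq a) x (I a q y)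
    rw [hsq', map_neg] at this
    linarith

theorem smoothSec_I (hq : q ∈ U) (a : Fin 3) (hX : C.SmoothSec X q) :
    C.SmoothSec (fun p => I a p (X p)) q := F.smooth_I a q hq X hX

theorem smoothSec_all (hq : q ∈ U) (c : Fin 4) (hX : C.SmoothSec X q) :
    C.SmoothSec (fun p => IsQuatHerm.all (fun a => I a p) c (X p)) q := by
  refine Fin.cases ?_ (fun a => ?_) c
  · exact hX
  · exact F.smoothSec_I hq a hX

/-- Quaternionic Gram–Schmidt: each step adds one unit vector orthogonal to the quaternionic lines
found so far. The family is indexed by `ℕ` so that a step is a `Function.update`; its values from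
index `k` on are irrelevant. -/
theorem exists_orthonormal_nat (hq : q ∈ U) (k : ℕ) (hk : k ≤ n) : ∃ V : Opens M, q ∈ V ∧ V ≤ U ∧
    ∃ e : ℕ → ∀ p : M, C.Q p, ∀ p ∈ V, (∀ i < k, C.SmoothSec (e i) p) ∧
      (∀ i < k, ∀ j < k, C.γ p (e i p) (e j p) = if i = j then 1 else 0) ∧
      ∀ a, ∀ i < k, ∀ j < k, C.γ p (I a p (e i p)) (e j p) = 0 := by
  induction k with
  | zero => exact ⟨U, hq, le_rfl, fun _ _ => 0, fun p _ => by simp⟩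
  | succ k ih =>
    obtain ⟨V, hqV, hVU, e, he⟩ := ih (by omega)
    let E : Fin 4 × Fin k → ∀ p : M, C.Q p := fun m p =>
      IsQuatHerm.all (fun a => I a p) m.1 (e m.2 p)
    have hE : ∀ p ∈ V, ∀ m m', C.γ p (E m p) (E m' p) = if m = m' then 1 else 0 := by
      rintro p hp ⟨c, i⟩ ⟨d, j⟩
      have h := F.isQuatHerm (hVU hp)
      obtain ⟨-, h1, h2⟩ := he p hp
      by_cases hij : i = j
      · subst hij
        simp only [E, Prod.mk.injEq, and_true]
        exact h.orthonormal_all (by simpa using h1 i i.2 i i.2) c d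
      · simp only [E, Prod.mk.injEq, hij, and_false, if_false]
        exact h.orthogonal_all (by simpa [Fin.val_inj, hij] using h1 i i.2 j j.2)
          (fun a => h2 a i i.2 j j.2) c d
    -- The `k` lines span at most `4k < 4n` dimensions.
    obtain ⟨x, hx⟩ : ∃ x : C.Q q, x ∉ Submodule.span ℝ (range fun m => E m q) := by
      by_contra! hall
      have h1 : Submodule.span ℝ (range fun m => E m q) = ⊤ := by
        rw [eq_top_iff]; exact fun x _ => hall x
      have h2 := finrank_range_le_card (R := ℝ) (fun m => E m q)
      rw [Set.finrank, h1, finrank_top, finrank_Q] at h2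
      simp at h2
      omega
    obtain ⟨X, rfl, W, hqW, hX⟩ := exists_section x
    let Y : ∀ p : M, C.Q p := fun p => X p - ∑ m, C.γ p (X p) (E m p) • E m p
    have hEs : ∀ p ∈ V, ∀ m, C.SmoothSec (E m) p := fun p hp m =>
      F.smoothSec_all (hVU hp) m.1 ((he p hp).1 m.2 m.2.2)
    have hY : ∀ p ∈ V ⊓ W, C.SmoothSec Y p := by
      rintro p ⟨hp, hp'⟩
      exact (hX p hp').sub (SmoothSec.sum fun m _ => SmoothSec.smul ((hX p hp').γ (hEs p hp m)) (hEs p hp m))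
    have hYE : ∀ p ∈ V, ∀ m, C.γ p (Y p) (E m p) = 0 := by
      intro p hp m
      simp only [Y, map_sub, map_sum, map_smul, LinearMap.sub_apply, LinearMap.sum_apply,
        LinearMap.smul_apply, hE p hp, smul_eq_mul]
      simp
    have hY0 : Y q ≠ 0 := by
      intro h0
      refine hx ?_
      rw [sub_eq_zero.1 h0]
      exact Submodule.sum_mem _ fun m _ => Submodule.smul_mem _ _ (Submodule.subset_span ⟨m, rfl⟩)
    -- Nonvanishing at `q` persists nearby, which is what makes the normalization smooth.
    have hpos : ∀ᶠ p in 𝓝 q, 0 < C.γ p (Y p) (Y p) :=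
      ((hY q ⟨hqV, hqW⟩).γ (hY q ⟨hqV, hqW⟩)).continuousAt.eventually_const_lt (C.pos q _ hY0)
    obtain ⟨O, hO, hOo, hqO⟩ := eventually_nhds_iff.1 hpos
    let N : ∀ p : M, C.Q p := fun p => (Real.sqrt (C.γ p (Y p) (Y p)))⁻¹ • Y p
    refine ⟨V ⊓ W ⊓ ⟨O, hOo⟩, ⟨⟨hqV, hqW⟩, hqO⟩, fun p hp => hVU hp.1.1,
      Function.update e k N, fun p hp => ?_⟩
    have hpV : p ∈ V := hp.1.1
    have hp0 : 0 < C.γ p (Y p) (Y p) := hO p hp.2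
    have h := F.isQuatHerm (hVU hpV)
    have hsqrt : Real.sqrt (C.γ p (Y p) (Y p)) ≠ 0 := (Real.sqrt_pos.2 hp0).ne'
    obtain ⟨h0, h1, h2⟩ := he p hpV
    have hNN : C.γ p (N p) (N p) = 1 := by
      simp only [N, map_smul, LinearMap.smul_apply, smul_eq_mul]
      field_simp
      exact (Real.sq_sqrt hp0.le).symm
    have hNe : ∀ j < k, C.γ p (N p) (e j p) = 0 := by
      intro j hj
      have := hYE p hpV (0, ⟨j, hj⟩)
      simp only [E, IsQuatHerm.all_zero] at this
      simp [N, this]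
    have hNI : ∀ a, ∀ j < k, C.γ p (I a p (N p)) (e j p) = 0 := by
      intro a j hj
      have := hYE p hpV (a.succ, ⟨j, hj⟩)
      simp only [E, IsQuatHerm.all_succ] at this
      rw [h.skew]
      simp [N, this]
    have hupd : ∀ i, i ≠ k → Function.update e k N i = e i := fun i hi =>
      Function.update_of_ne hi _ _
    refine ⟨fun i hi => ?_, fun i hi j hj => ?_, fun a i hi j hj => ?_⟩
    · by_cases hik : i = k
      · subst hik
        rw [Function.update_self]
        have hYp := hY p ⟨hpV, hp.1.2⟩
        refine SmoothSec.smul ?_ hYp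
        exact SmoothFun.inv (SmoothFun.comp (Real.contDiffAt_sqrt hp0.ne') (hYp.γ hYp)) hsqrt
      · rw [hupd i hik]
        exact h0 i (by omega)
    · by_cases hik : i = k <;> by_cases hjk : j = k
      · subst hik hjk
        simp only [Function.update_self, hNN, if_true]
      · subst hik
        rw [Function.update_self, hupd j hjk, hNe j (by omega), if_neg (Ne.symm hjk)]
      · subst hjk
        rw [Function.update_self, hupd i hik, C.symm, hNe i (by omega), if_neg hik]
      · rw [hupd i hik, hupd j hjk, h1 i (by omega) j (by omega)]
    · by_cases hik : i = k <;> by_cases hjk : j = k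
      · subst hik hjk
        simp only [Function.update_self]
        exact h.self a _
      · subst hik
        rw [Function.update_self, hupd j hjk, hNI a j (by omega)]
      · subst hjk
        rw [Function.update_self, hupd i hik, h.skew, C.symm, hNI a i (by omega), neg_zero]
      · rw [hupd i hik, hupd j hjk, h2 a i (by omega) j (by omega)]

/-- Near every point there is an adapted orthonormal frame of `Q`. -/
theorem exists_adapted (hq : q ∈ U) : ∃ V : Opens M, q ∈ V ∧ V ≤ U ∧
    ∃ ε : Fin 4 × Fin n → ∀ p : M, C.Q p, ∀ p ∈ V, (∀ i, C.SmoothSec (ε i) p) ∧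
      IsAdaptedBasis (C.γ p) (fun a => I a p) (fun i => ε i p) := by
  obtain ⟨V, hqV, hVU, e, he⟩ := F.exists_orthonormal_nat hq n le_rfl
  refine ⟨V, hqV, hVU, fun m p => IsQuatHerm.all (fun a => I a p) m.1 (e m.2 p), fun p hp => ?_⟩
  have h := F.isQuatHerm (hVU hp)
  obtain ⟨h0, h1, h2⟩ := he p hp
  refine ⟨fun m => F.smoothSec_all (hVU hp) m.1 (h0 m.2 m.2.2), ?_, fun a k => ?_⟩
  · rintro ⟨c, i⟩ ⟨d, j⟩
    by_cases hij : i = j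
    · subst hij
      simp only [Prod.mk.injEq, and_true]
      exact h.orthonormal_all (by simpa using h1 i i.2 i i.2) c d
    · simp only [Prod.mk.injEq, hij, and_false, if_false]
      exact h.orthogonal_all (by simpa [Fin.val_inj, hij] using h1 i i.2 j j.2)
        (fun a => h2 a i i.2 j j.2) c d
  · rfl

end Frame

end QCStructure

end Contact

/-! ## Structure equations and Reeb fields -/

section Forms

set_option linter.unusedSectionVars false

variable {n : ℕ} {M : Type*} [TopologicalSpace M] [ChartedSpace (Mdl n) M]
  [IsManifold 𝓘(ℝ, Mdl n) ∞ M] {η : ∀ p : M, Tan n p →L[ℝ] ℝ} {U : Opens M} {q : M}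

theorem SmoothFormOn.dForm_add_left (hη : SmoothFormOn η U) (hq : q ∈ U) (v v' w : Tan n q) :
    dForm η q (v + v') w = dForm η q v w + dForm η q v' w := by
  simp only [← hη.dBilin_apply hq, map_add, LinearMap.add_apply]

theorem SmoothFormOn.dForm_smul_left (hη : SmoothFormOn η U) (hq : q ∈ U) (c : ℝ)
    (v w : Tan n q) : dForm η q (c • v) w = c * dForm η q v w := by
  simp only [← hη.dBilin_apply hq, map_smul, LinearMap.smul_apply, smul_eq_mul]

theorem SmoothFormOn.dForm_sub_left (hη : SmoothFormOn η U) (hq : q ∈ U) (v v' w : Tan n q) :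
    dForm η q (v - v') w = dForm η q v w - dForm η q v' w := by
  simp only [← hη.dBilin_apply hq, map_sub, LinearMap.sub_apply]

theorem SmoothFormOn.dForm_sum_left (hη : SmoothFormOn η U) (hq : q ∈ U) {ι : Type*}
    (s : Finset ι) (v : ι → Tan n q) (w : Tan n q) :
    dForm η q (∑ i ∈ s, v i) w = ∑ i ∈ s, dForm η q (v i) w := by
  simp only [← hη.dBilin_apply hq, map_sum, LinearMap.sum_apply]

theorem SmoothFormOn.dForm_sum_right (hη : SmoothFormOn η U) (hq : q ∈ U) {ι : Type*}
    (s : Finset ι) (v : ι → Tan n q) (w : Tan n q) :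
    dForm η q w (∑ i ∈ s, v i) = ∑ i ∈ s, dForm η q w (v i) := by
  simp only [← hη.dBilin_apply hq, map_sum]

/-- The determinant of a `3 × 3` matrix of smooth functions is smooth. -/
theorem smoothFun_det {A : M → Matrix (Fin 3) (Fin 3) ℝ}
    (hA : ∀ i j, SmoothFun n (fun p => A p i j) q) : SmoothFun n (fun p => (A p).det) q := by
  simp only [Matrix.det_fin_three]
  have h := fun i j k l m o => SmoothFun.mul (SmoothFun.mul (hA i j) (hA k l)) (hA m o)
  exact ((((SmoothFun.sub (h _ _ _ _ _ _) (h _ _ _ _ _ _)).sub (h _ _ _ _ _ _)).add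
    (h _ _ _ _ _ _)).add (h _ _ _ _ _ _)).sub (h _ _ _ _ _ _)

theorem smoothFun_inv_apply {A : M → Matrix (Fin 3) (Fin 3) ℝ}
    (hA : ∀ i j, SmoothFun n (fun p => A p i j) q) (h0 : (A q).det ≠ 0) (i j : Fin 3) :
    SmoothFun n (fun p => (A p)⁻¹ i j) q := by
  have h : (fun p => (A p)⁻¹ i j)
      = fun p => ((A p).det)⁻¹ * ((A p).updateRow j (Pi.single i 1)).det := by
    funext p
    rw [Matrix.inv_def, Matrix.smul_apply, Matrix.adjugate_apply, Ring.inverse_eq_inv', smul_eq_mul]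
  rw [h]
  refine SmoothFun.mul ((smoothFun_det hA).inv h0) (smoothFun_det fun k l => ?_)
  by_cases hk : k = j
  · subst hk
    simp only [Matrix.updateRow_self]
    exact smoothFun_const _
  · simp only [Matrix.updateRow_ne hk]
    exact hA k l

end Forms

/-! ### Reduction of the structure equation to basis vectors -/

section LinearMaps

variable {n : ℕ}

theorem eq_zero_of_bv {f : (Fin 4 × Fin n → ℝ) → ℝ} (hf : IsLinearMap ℝ f)
    (h : ∀ i, f (bv i) = 0) (x : Fin 4 × Fin n → ℝ) : f x = 0 := by
  have : (hf.mk' f) = 0 := (Pi.basisFun ℝ _).ext fun i => by simpa [bv] using h i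
  exact LinearMap.congr_fun this x

theorem structEq_of_bv {w : Tensor3 n} {α : Fin 3 → (Fin 4 × Fin n → ℝ) →ₗ[ℝ] ℝ} {a : Fin 3}
    (h : ∀ i j k, 
      (tri w (bv i) (bv j) (Jv n a (bv k)) - tri w (bv j) (bv i) (Jv n a (bv k))
        + ∑ b, (Jv n b (bv i) ⬝ᵥ bv j) * α b (bv k)) +
      (tri w (bv j) (bv k) (Jv n a (bv i)) - tri w (bv k) (bv j) (Jv n a (bv i))
        + ∑ b, (Jv n b (bv j) ⬝ᵥ bv k) * α b (bv i)) +
      (tri w (bv k) (bv i) (Jv n a (bv j)) - tri w (bv i) (bv k) (Jv n a (bv j))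
        + ∑ b, (Jv n b (bv k) ⬝ᵥ bv i) * α b (bv j)) = 0) : StructEq w α a := by
  intro x y z
  revert x
  refine eq_zero_of_bv ?_ fun i => ?_
  · constructor <;> intros <;> simp only [map_add, LinearMap.add_apply, map_smul,
      LinearMap.smul_apply, dotProduct_add, add_dotProduct, dotProduct_smul, smul_dotProduct,
      smul_eq_mul, Fin.sum_univ_three] <;> ring
  revert y
  refine eq_zero_of_bv ?_ fun j => ?_
  · constructor <;> intros <;> simp only [map_add, LinearMap.add_apply, map_smul,
      LinearMap.smul_apply, dotProduct_add, add_dotProduct, dotProduct_smul, smul_dotProduct,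
      smul_eq_mul, Fin.sum_univ_three] <;> ring
  revert z
  refine eq_zero_of_bv ?_ fun k => h i j k
  constructor <;> intros <;> simp only [map_add, LinearMap.add_apply, map_smul,
    LinearMap.smul_apply, dotProduct_add, add_dotProduct, dotProduct_smul, smul_dotProduct,
    smul_eq_mul, Fin.sum_univ_three] <;> ring

end LinearMaps

/-! ### Brackets in adapted frames, dual triples and Reeb triples -/

section Contact

set_option linter.unusedSectionVars false

variable {n : ℕ} {M : Type*} [TopologicalSpace M] [ChartedSpace (Mdl n) M]
  [IsManifold 𝓘(ℝ, Mdl n) ∞ M]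

/-- The vectors `t_b` are dual to the forms `η_a` at `q`. -/
def IsDual (η : Fin 3 → ∀ q : M, Tan n q →L[ℝ] ℝ) (q : M) (t : Fin 3 → Tan n q) : Prop :=
  ∀ a b, η a q (t b) = if a = b then 1 else 0

theorem IsDual.sum {η : Fin 3 → ∀ q : M, Tan n q →L[ℝ] ℝ} {q : M} {t : Fin 3 → Tan n q}
    (ht : IsDual η q t) (a : Fin 3) (c : Fin 3 → ℝ) : η a q (∑ b, c b • t b) = c a := by
  simp only [map_sum, map_smul, ht a, smul_eq_mul]
  simp

namespace QCStructure.Frame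

variable {C : QCStructure n M} {X Y : ∀ p : M, C.Q p} {q : M}
  {U : Opens M} {I : Fin 3 → ∀ q : M, Module.End ℝ (C.Q q)}
  {η : Fin 3 → ∀ q : M, Tan n q →L[ℝ] ℝ} (F : C.Frame U I η)

include F

theorem η_Q (hq : q ∈ U) (a : Fin 3) (x : C.Q q) : η a q x = 0 := (F.ker q hq x).1 x.2 a

/-- Since `η_a` vanishes on `Q`, only the bracket term of `dη_a` survives. This is the sole way in
which the contact condition constrains brackets of sections of `Q`. -/
theorem η_br (hq : q ∈ U) (hX : C.SmoothSec X q) (hY : C.SmoothSec Y q) (a : Fin 3) :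
    η a q (br (fun p => (X p : Tan n p)) (fun p => (Y p : Tan n p)) q)
      = -C.γ q (I a q (X q)) (Y q) := by
  rw [F.compat q hq, (F.smooth_η a).dForm_eq hq (X := fun p => (X p : Tan n p))
    (Y := fun p => (Y p : Tan n p)) (SmoothAt.diffAt hX) (SmoothAt.diffAt hY),
    dirDeriv_congr (g := fun _ => 0), dirDeriv_const,
    dirDeriv_congr (f := fun p => η a p (X p)) (g := fun _ => 0), dirDeriv_const]
  · ring
  · filter_upwards [mem_eventually U hq] with p hp using F.η_Q hp a _
  · filter_upwards [mem_eventually U hq] with p hp using F.η_Q hp a _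

theorem sub_mem (hq : q ∈ U) {t : Fin 3 → Tan n q} (ht : IsDual η q t) (v : Tan n q) :
    v - ∑ a, η a q v • t a ∈ C.Q q := by
  rw [F.ker q hq]
  intro a
  rw [map_sub, ht.sum, sub_self]

/-- The coefficients of the brackets of an adapted frame, in terms of a dual triple. -/
theorem br_eq (hq : q ∈ U) {ε : Fin 4 × Fin n → ∀ p : M, C.Q p} (hε : ∀ i, C.SmoothSec (ε i) q)
    (had : IsAdaptedBasis (C.γ q) (fun a => I a q) (fun i => ε i q))
    {t : Fin 3 → Tan n q} (ht : IsDual η q t) : ∃ w : Tensor3 n, IsSkew w ∧ ∀ i j,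
      br (fun p => (ε i p : Tan n p)) (fun p => (ε j p : Tan n p)) q
        = ∑ l, (w (i, j, l) - w (j, i, l)) • (ε l q : Tan n q) - ∑ b, modelJ n b j i • t b := by
  set B : Fin 4 × Fin n → Fin 4 × Fin n → Tan n q := fun i j =>
    br (fun p => (ε i p : Tan n p)) (fun p => (ε j p : Tan n p)) q with hB
  let b : Fin 4 × Fin n → Fin 4 × Fin n → C.Q q := fun i j => ⟨_, F.sub_mem hq ht (B i j)⟩
  let c : Fin 4 × Fin n → Fin 4 × Fin n → Fin 4 × Fin n → ℝ := fun i j l => C.γ q (b i j) (ε l q)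
  have hBs : ∀ i j, B i j = -B j i := fun i j => br_swap
  have hbs : ∀ i j, b i j = -b j i := by
    intro i j
    ext1
    simp only [b, Submodule.coe_neg]
    rw [hBs i j]
    simp only [map_neg, neg_smul, Finset.sum_neg_distrib]
    abel
  have hcs : ∀ i j l, c i j l = -c j i l := fun i j l => by
    simp only [c]; rw [hbs i j, map_neg, LinearMap.neg_apply]
  -- The Koszul formula recovers a skew tensor from its antisymmetrization in the first two slots.
  -- No connection is involved, so this is available before the Reeb field is known to be well
  -- defined.
  refine ⟨WithLp.toLp 2 fun m => (c m.1 m.2.1 m.2.2 - c m.1 m.2.2 m.2.1 - c m.2.1 m.2.2 m.1) / 2,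
    fun i j k => ?_, fun i j => ?_⟩
  · simp only
    rw [hcs k j i]
    ring
  · have h1 : ∀ l, (c i j l - c i l j - c j l i) / 2 - (c j i l - c j l i - c i l j) / 2 = c i j l := by
      intro l
      rw [hcs j i l]; ring
    simp only [h1]
    have h2 : ∑ l, c i j l • (ε l q : Tan n q) = (b i j : Tan n q) := by
      rw [had.eq_sum (finrank_Q q) (b i j)]
      simp [c]
    have h3 : ∀ a, η a q (B i j) = -modelJ n a j i := by
      intro a
      rw [hB, F.η_br hq (hε i) (hε j), had.γ_I (F.isQuatHerm hq)]
    rw [h2]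
    simp only [b, h3, neg_smul, Finset.sum_neg_distrib]
    rw [sub_neg_eq_add, add_sub_cancel_right]

/-- The forms `α_b = dη_a(t_b, ·)` in a frame. -/
def alpha (hq : q ∈ U) (ε : Fin 4 × Fin n → C.Q q) (t : Fin 3 → Tan n q) (a b : Fin 3) :
    (Fin 4 × Fin n → ℝ) →ₗ[ℝ] ℝ :=
  (F.smooth_η a).dBilin hq (t b) ∘ₗ (C.Q q).subtype ∘ₗ lc ε

theorem alpha_apply (hq : q ∈ U) (ε : Fin 4 × Fin n → C.Q q) (t : Fin 3 → Tan n q) (a b : Fin 3)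
    (z : Fin 4 × Fin n → ℝ) : F.alpha hq ε t a b z = dForm (η a) q (t b) (lc ε z : C.Q q) := rfl

/-- The values of `dη_a` on pairs of frame fields are the constants `(J_a)_{ji}`, so closedness of
`dη_a` reduces to the cyclic sum of `dη_a([ε_i, ε_j], ε_k)`, into which the bracket formula is
inserted. -/
theorem structEq_of_bracket (hq : q ∈ U) {ε : Fin 4 × Fin n → ∀ p : M, C.Q p}
    (hε : ∀ i, C.SmoothSec (ε i) q)
    (had : ∀ᶠ p in 𝓝 q, IsAdaptedBasis (C.γ p) (fun a => I a p) (fun i => ε i p))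
    {t : Fin 3 → Tan n q} {w : Tensor3 n}
    (hw : ∀ i j, br (fun p => (ε i p : Tan n p)) (fun p => (ε j p : Tan n p)) q
        = ∑ l, (w (i, j, l) - w (j, i, l)) • (ε l q : Tan n q) - ∑ b, modelJ n b j i • t b)
    (a : Fin 3) : StructEq w (F.alpha hq (fun i => ε i q) t a) a := by
  have hd : ∀ p ∈ U, IsAdaptedBasis (C.γ p) (fun a => I a p) (fun i => ε i p) →
      ∀ i j, dForm (η a) p (ε i p) (ε j p) = modelJ n a j i := by
    intro p hp h i j
    rw [← F.compat p hp, h.γ_I (F.isQuatHerm hp)]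
  have hconst : ∀ i j (v : Tan n q), dirDeriv (fun p => dForm (η a) p (ε i p) (ε j p)) q v = 0 := by
    intro i j v
    rw [dirDeriv_congr (g := fun _ => modelJ n a j i), dirDeriv_const]
    filter_upwards [mem_eventually U hq, had] with p hp h using hd p hp h i j
  have key : ∀ i j k, dForm (η a) q
      (br (fun p => (ε i p : Tan n p)) (fun p => (ε j p : Tan n p)) q) (ε k q)
      = -(tri w (bv i) (bv j) (Jv n a (bv k)) - tri w (bv j) (bv i) (Jv n a (bv k))
        + ∑ b, (Jv n b (bv i) ⬝ᵥ bv j) * F.alpha hq (fun i => ε i q) t a b (bv k)) := by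
    intro i j k
    have htri : ∀ i j, tri w (bv i) (bv j) (Jv n a (bv k)) = ∑ l, w (i, j, l) * modelJ n a l k := by
      intro i j
      rw [← sum_smul_bv (Jv n a (bv k))]
      simp only [map_sum, map_smul, tri_bv, Jv_bv_apply, smul_eq_mul, mul_comm]
    have hη := F.smooth_η a
    rw [hw, hη.dForm_sub_left hq, hη.dForm_sum_left hq, hη.dForm_sum_left hq, htri, htri]
    simp only [hη.dForm_smul_left hq, hd q hq had.self_of_nhds, alpha_apply, lc_bv, dot_bv,
      Jv_bv_apply]
    rw [← Finset.sum_sub_distrib, neg_add, ← Finset.sum_neg_distrib, sub_eq_add_neg]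
    congr 1
    refine Finset.sum_congr rfl fun l _ => ?_
    rw [modelJ_skew a k l]
    ring
  refine structEq_of_bv fun i j k => ?_
  have h := (F.smooth_η a).d_dForm hq (hε i) (hε j) (hε k)
  simp only [hconst] at h
  rw [key, key, key] at h
  linarith

/-- Near every point of `U` there are vector fields which are dual to the forms. -/
theorem exists_dual (hq : q ∈ U) : ∃ V : Opens M, q ∈ V ∧ V ≤ U ∧ ∃ T : Fin 3 → ∀ p : M, Tan n p,
    ∀ p ∈ V, (∀ a, SmoothAt (T a) p) ∧ IsDual η p (fun a => T a p) := by
  let E : Tan n q →ₗ[ℝ] (Fin 3 → ℝ) := LinearMap.pi fun a => (η a q : Tan n q →ₗ[ℝ] ℝ)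
  have hker : LinearMap.ker E = C.Q q := by
    ext v
    rw [LinearMap.mem_ker, F.ker q hq]
    exact funext_iff
  -- The kernel of the three forms is `Q q`, of dimension `4n` in `4n + 3`, so they are independent.
  have hsurj : LinearMap.range E = ⊤ := by
    refine Submodule.eq_top_of_finrank_eq ?_
    have := E.finrank_range_add_finrank_ker
    rw [hker, finrank_Q, finrank_tan] at this
    rw [finrank_fin_fun]
    omega
  have hex : ∀ b : Fin 3, ∃ v : Tan n q, E v = Pi.single b 1 := fun b => by
    have : (Pi.single b 1 : Fin 3 → ℝ) ∈ LinearMap.range E := hsurj ▸ Submodule.mem_top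
    exact this
  choose t ht using hex
  choose X hXq W hW hX using fun b => exists_extension (t b)
  -- Extensions of the dual vectors at `q` are corrected by the inverse of the matrix `η_a(X_b)`,
  -- which is the identity at `q` and hence invertible nearby.
  let A : M → Matrix (Fin 3) (Fin 3) ℝ := fun p => Matrix.of fun a b => η a p (X b p)
  have hA : ∀ p ∈ U, (∀ b, p ∈ W b) → ∀ i j, SmoothFun n (fun p => A p i j) p := fun p hp hp' i j =>
    (F.smooth_η i).smoothFun hp (hX j p (hp' j))
  have hAq : A q = 1 := by
    ext a b
    have := congrFun (ht b) a
    simp only [E, LinearMap.pi_apply] at this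
    simp only [A, Matrix.of_apply, hXq, Matrix.one_apply]
    simpa [Pi.single_apply] using this
  have hdet : ∀ᶠ p in 𝓝 q, (A p).det ≠ 0 := by
    have h := (smoothFun_det (hA q hq hW)).continuousAt
    exact h.eventually_ne (by rw [hAq]; simp)
  obtain ⟨O, hO, hOo, hqO⟩ := eventually_nhds_iff.1 hdet
  refine ⟨U ⊓ (W 0 ⊓ W 1 ⊓ W 2) ⊓ ⟨O, hOo⟩, ⟨⟨hq, ⟨hW 0, hW 1⟩, hW 2⟩, hqO⟩, fun p hp => hp.1.1,
    fun b p => ∑ c, (A p)⁻¹ c b • X c p, fun p hp => ?_⟩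
  have hpW : ∀ b, p ∈ W b := by
    intro b
    fin_cases b
    exacts [hp.1.2.1.1, hp.1.2.1.2, hp.1.2.2]
  have hp0 : (A p).det ≠ 0 := hO p hp.2
  refine ⟨fun b => SmoothAt.sum fun c _ => SmoothAt.smul
    (smoothFun_inv_apply (hA p hp.1.1 hpW) hp0 c b) (hX c p (hpW c)), fun a b => ?_⟩
  have h1 : (A p * (A p)⁻¹) a b = (1 : Matrix (Fin 3) (Fin 3) ℝ) a b := by
    rw [Matrix.mul_nonsing_inv _ (isUnit_iff_ne_zero.2 hp0)]
  rw [Matrix.mul_apply, Matrix.one_apply] at h1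
  rw [← h1]
  simp only [map_sum, map_smul, smul_eq_mul, A, Matrix.of_apply, mul_comm]

omit F in
/-- The vectors `t_a` form the Reeb triple at `q`. -/
structure IsReeb (C : QCStructure n M) (η : Fin 3 → ∀ q : M, Tan n q →L[ℝ] ℝ) (q : M)
    (t : Fin 3 → Tan n q) : Prop where
  dual : IsDual η q t
  reeb : ∀ a, ∀ x : C.Q q, dForm (η a) q (t a) x = 0

/-- A dual field `T_b` may be changed by a section of `Q`. Because `dη_b = γ(I_b ·, ·)` and `I_b² =
-1`, adding `∑ dη_b(T_b, ε_i) I_b ε_i` cancels `dη_b(T_b, ·)` on `Q`; the formula is visibly smooth.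
-/
theorem exists_reeb_field (hq : q ∈ U) : ∃ V : Opens M, q ∈ V ∧ V ≤ U ∧
    ∃ R : Fin 3 → ∀ p : M, Tan n p,
    ∀ p ∈ V, (∀ a, SmoothAt (R a) p) ∧ IsReeb C η p (fun a => R a p) := by
  obtain ⟨V, hqV, hVU, T, hT⟩ := F.exists_dual hq
  obtain ⟨W, hqW, hWU, ε, hε⟩ := F.exists_adapted hq
  refine ⟨V ⊓ W, ⟨hqV, hqW⟩, fun p hp => hVU hp.1,
    fun b p => T b p + ((∑ i, dForm (η b) p (T b p) (ε i p) • I b p (ε i p) : C.Q p) : Tan n p),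
    fun p hp => ⟨fun b => ?_, ?_, ?_⟩⟩
  · refine SmoothAt.add ((hT p hp.1).1 b) (SmoothSec.sum (C := C) fun i _ => SmoothSec.smul ?_
      (F.smoothSec_I (hVU hp.1) b ((hε p hp.2).1 i)))
    exact (F.smooth_η b).smoothFun_dForm (hVU hp.1) ((hT p hp.1).1 b) ((hε p hp.2).1 i)
  · intro a b
    rw [map_add, F.η_Q (hVU hp.1), add_zero]
    exact (hT p hp.1).2 a b
  · intro a x
    have h := F.isQuatHerm (hVU hp.1)
    have had := (hε p hp.2).2
    have hη := F.smooth_η a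
    simp only
    rw [hη.dForm_add_left (hVU hp.1), ← F.compat p (hVU hp.1), map_sum]
    simp only [map_smul, h.sq, map_sum, LinearMap.sum_apply, LinearMap.smul_apply, map_neg,
      LinearMap.neg_apply]
    conv_lhs => enter [1]; rw [had.eq_sum (finrank_Q p) x, Submodule.coe_sum, hη.dForm_sum_right (hVU hp.1)]
    rw [← Finset.sum_add_distrib]
    refine Finset.sum_eq_zero fun i _ => ?_
    rw [Submodule.coe_smul, hη.dForm_smul_right (hVU hp.1), h.symm x]
    simp only [smul_eq_mul]
    ring

theorem exists_reeb (hq : q ∈ U) : ∃ t, IsReeb C η q t := by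
  obtain ⟨V, hqV, -, R, hR⟩ := F.exists_reeb_field hq
  exact ⟨_, (hR q hqV).2⟩

/-- Two Reeb vectors with the same index differ by an element of `Q` which lies in the kernel of the
nondegenerate form `γ(I_a ·, ·)`. -/
theorem reeb_unique (hq : q ∈ U) {t t' : Fin 3 → Tan n q} (ht : IsReeb C η q t)
    (ht' : IsReeb C η q t') : t = t' := by
  funext a
  have hmem : t a - t' a ∈ C.Q q := by
    rw [F.ker q hq]
    intro b
    rw [map_sub, ht.dual, ht'.dual, sub_self]
  have h := F.isQuatHerm hq
  have h0 : I a q ⟨_, hmem⟩ = 0 := h.eq_zero_of_forall fun y => by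
    rw [F.compat q hq, (F.smooth_η a).dForm_sub_left hq, ht.reeb, ht'.reeb, sub_self]
  have h1 : (⟨_, hmem⟩ : C.Q q) = 0 := by
    rw [← neg_eq_zero, ← h.sq a, h0, map_zero]
  exact sub_eq_zero.1 (congrArg Subtype.val h1)

/-- The antisymmetry property of Reeb triples. -/
theorem reeb_antisymm (hn : 2 ≤ n) (hq : q ∈ U) {t : Fin 3 → Tan n q} (ht : IsReeb C η q t)
    (a b : Fin 3) (x : C.Q q) : dForm (η a) q (t b) x + dForm (η b) q (t a) x = 0 := by
  obtain ⟨W, hqW, hWU, ε, hε⟩ := F.exists_adapted hq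
  obtain ⟨w, hw, hbr⟩ := F.br_eq hq (hε q hqW).1 (hε q hqW).2 ht.dual
  have hs := fun a => F.structEq_of_bracket hq (hε q hqW).1
    ((mem_eventually W hqW).mono fun p hp => (hε p hp).2) hbr a
  -- The Reeb condition is the case `κ = 0` of `structEq_antisymm`.
  have h0 : ∀ a, F.alpha hq (fun i => ε i q) t a a = 0 := by
    intro a
    ext z
    simp [alpha_apply, ht.reeb]
  have key : ∀ a, ∀ x : C.Q q, dForm (η a) q (t (a + 1)) x + dForm (η (a + 1)) q (t a) x = 0 := by
    intro a x
    have h := structEq_antisymm hn hw hs h0 a (fun i => C.γ q x (ε i q))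
    simpa only [alpha_apply, (hε q hqW).2.lc_γ (finrank_Q q) x] using h
  rcases fin3_cases a b with rfl | rfl | rfl
  · rw [ht.reeb, add_zero]
  · exact key a x
  · have := key (a + 2) x
    rw [(fin3_add a).2.2.1] at this
    rw [add_comm]
    exact this

end QCStructure.Frame

end Contact

/-! ## Change of contact frames -/

section Contact

set_option linter.unusedSectionVars false

variable {n : ℕ} {M : Type*} [TopologicalSpace M] [ChartedSpace (Mdl n) M]
  [IsManifold 𝓘(ℝ, Mdl n) ∞ M]

/-- The transition matrix between two triples of one-forms. -/
def trans (η η' : Fin 3 → ∀ q : M, Tan n q →L[ℝ] ℝ) (q : M) (t : Fin 3 → Tan n q) :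
    Matrix (Fin 3) (Fin 3) ℝ := Matrix.of fun a b => η' a q (t b)

namespace QCStructure.Frame

variable {C : QCStructure n M} {q : M}
  {U U' : Opens M} {I I' : Fin 3 → ∀ q : M, Module.End ℝ (C.Q q)}
  {η η' : Fin 3 → ∀ q : M, Tan n q →L[ℝ] ℝ} (F : C.Frame U I η) (F' : C.Frame U' I' η')

include F F'

theorem trans_η (hq : q ∈ U) (hq' : q ∈ U') {t : Fin 3 → Tan n q} (ht : IsDual η q t)
    (a : Fin 3) (v : Tan n q) : η' a q v = ∑ b, trans η η' q t a b * η b q v := by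
  have h := F'.η_Q hq' a ⟨_, F.sub_mem hq ht v⟩
  simp only [map_sub, map_sum, map_smul, smul_eq_mul] at h
  rw [sub_eq_zero.1 h]
  simp only [trans, Matrix.of_apply, mul_comm]

/-- Both frames read `γ(I_a X, Y)` off the same bracket `[X, Y]`, so the complex structures change
by the same matrix as the forms. -/
theorem trans_I (hq : q ∈ U) (hq' : q ∈ U') {t : Fin 3 → Tan n q} (ht : IsDual η q t)
    (a : Fin 3) (x : C.Q q) : I' a q x = ∑ b, trans η η' q t a b • I b q x := by
  refine (F.isQuatHerm hq).ext fun y => ?_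
  obtain ⟨X, rfl, V, hV, hX⟩ := exists_section x
  obtain ⟨Y, rfl, W, hW, hY⟩ := exists_section y
  have h := F'.η_br hq' (hX q hV) (hY q hW) a
  rw [F.trans_η F' hq hq' ht] at h
  simp only [F.η_br hq (hX q hV) (hY q hW)] at h
  rw [map_sum, LinearMap.sum_apply]
  simp only [map_smul, LinearMap.smul_apply, smul_eq_mul]
  simp only [mul_neg, Finset.sum_neg_distrib] at h
  linarith

omit F' in
theorem exists_unit (hn : 0 < n) (hq : q ∈ U) : ∃ x : C.Q q, C.γ q x x = 1 := by
  obtain ⟨W, hqW, hWU, ε, hε⟩ := F.exists_adapted hq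
  exact ⟨ε (0, ⟨0, hn⟩) q, by simpa using (hε q hqW).2.orth (0, ⟨0, hn⟩) (0, ⟨0, hn⟩)⟩

/-- For a unit vector `x`, the vectors `I_a x` and `I'_a x` are orthonormal triples, so the matrix
relating them is orthogonal. The relation `I'_2 = I'_0 I'_1` fixes the orientation: its expansion in
the product `γ(I'_2 x, I'_2 x) = 1` is the determinant. -/
theorem trans_mem (hn : 0 < n) (hq : q ∈ U) (hq' : q ∈ U') {t : Fin 3 → Tan n q}
    (ht : IsDual η q t) : trans η η' q t ∈ Matrix.specialOrthogonalGroup (Fin 3) ℝ := by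
  set S := trans η η' q t
  have h := F.isQuatHerm hq
  have h' := F'.isQuatHerm hq'
  obtain ⟨x, hx⟩ := F.exists_unit hn hq
  have hI : ∀ a x, I' a q x = ∑ b, S a b • I b q x := fun a x => F.trans_I F' hq hq' ht a x
  have hor : ∀ b d, C.γ q (I b q x) (I d q x) = if b = d then 1 else 0 := fun b d => by
    simpa using h.orthonormal_all hx b.succ d.succ
  have hor' : ∀ b d, C.γ q (I' b q x) (I' d q x) = if b = d then 1 else 0 := fun b d => by
    simpa using h'.orthonormal_all hx b.succ d.succ
  rw [Matrix.mem_specialOrthogonalGroup_iff, Matrix.mem_orthogonalGroup_iff]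
  constructor
  · ext a c
    rw [Matrix.mul_apply, Matrix.one_apply, ← hor' a c, hI, hI]
    simp only [map_sum, map_smul, LinearMap.sum_apply, LinearMap.smul_apply, hor, smul_eq_mul]
    simp [mul_comm]
  · have h1 := hor' 2 2
    have e : I' 2 q x = I' 0 q (I' 1 q x) := (h'.mul 0 x).symm
    have e01 : ∀ x, I 0 q (I 1 q x) = I 2 q x := h.mul 0
    have e12 : ∀ x, I 1 q (I 2 q x) = I 0 q x := h.mul 1
    have e20 : ∀ x, I 2 q (I 0 q x) = I 1 q x := h.mul 2
    have e10 : ∀ x, I 1 q (I 0 q x) = -I 2 q x := h.mul' 0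
    have e21 : ∀ x, I 2 q (I 1 q x) = -I 0 q x := h.mul' 1
    have e02 : ∀ x, I 0 q (I 2 q x) = -I 1 q x := h.mul' 2
    have hs : ∀ b, C.γ q x (I b q x) = 0 := fun b => by rw [h.symm, h.self]
    conv_lhs at h1 => enter [1, 2]; rw [e]
    simp only [hI, Fin.sum_univ_three, map_add, map_smul, h.sq, e01, e12, e20, e10, e21, e02,
      LinearMap.add_apply, LinearMap.smul_apply, smul_eq_mul, map_neg, LinearMap.neg_apply, hor,
      hs] at h1
    rw [Matrix.det_fin_three]
    simp at h1
    linarith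

omit F F' in
theorem sum_mul_of_mem {S : Matrix (Fin 3) (Fin 3) ℝ}
    (hS : S ∈ Matrix.specialOrthogonalGroup (Fin 3) ℝ) (a c : Fin 3) :
    ∑ b, S a b * S c b = if a = c then 1 else 0 := by
  rw [Matrix.mem_specialOrthogonalGroup_iff, Matrix.mem_orthogonalGroup_iff] at hS
  have h := congrFun (congrFun hS.1 a) c
  rw [Matrix.mul_apply, Matrix.one_apply] at h
  simpa using h

/-- Reeb triples rotate with the frame. -/
theorem isReeb_trans (hn : 2 ≤ n) (hq : q ∈ U) (hq' : q ∈ U') {t : Fin 3 → Tan n q}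
    (ht : IsReeb C η q t) : IsReeb C η' q fun a => ∑ b, trans η η' q t a b • t b := by
  have hS := F.trans_mem F' (by omega) hq hq' ht.dual
  refine ⟨fun a c => ?_, fun a x => ?_⟩
  · rw [F.trans_η F' hq hq' ht.dual, ← sum_mul_of_mem hS a c]
    exact Finset.sum_congr rfl fun b _ => by rw [ht.dual.sum]
  obtain ⟨V, hqV, hVU, R, hR⟩ := F.exists_reeb_field hq
  obtain rfl : (fun a => R a q) = t := F.reeb_unique hq (hR q hqV).2 ht
  obtain ⟨X, rfl, W, hqW, hX⟩ := exists_section x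
  have hX := hX q hqW
  -- The coefficients are frozen at `q`, so that each `η_b(Z)` is constant near `q`, while the true
  -- coefficients `s` of `η'_a` still vary.
  set c : Fin 3 → ℝ := fun b => trans η η' q (fun a => R a q) a b with hc
  set Z : ∀ p : M, Tan n p := fun p => ∑ b, c b • R b p with hZ
  have hZs : SmoothAt Z q := SmoothAt.sum fun b _ => SmoothAt.smul (smoothFun_const _)
    ((hR q hqV).1 b)
  change dForm (η' a) q (Z q) (X q) = 0
  let s : Fin 3 → M → ℝ := fun b p => η' a p (R b p)
  have hs : ∀ b, SmoothFun n (s b) q := fun b => (F'.smooth_η a).smoothFun hq' ((hR q hqV).1 b)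
  have hηX : ∀ b (v : Tan n q), dirDeriv (fun p => η b p (X p)) q v = 0 := fun b v => by
    rw [dirDeriv_congr (g := fun _ => 0), dirDeriv_const]
    filter_upwards [mem_eventually U hq] with p hp using F.η_Q hp b _
  have hηX' : ∀ v : Tan n q, dirDeriv (fun p => η' a p (X p)) q v = 0 := fun v => by
    rw [dirDeriv_congr (g := fun _ => 0), dirDeriv_const]
    filter_upwards [mem_eventually U' hq'] with p hp using F'.η_Q hp a _
  have h1 : ∀ b, dForm (η b) q (Z q) (X q) = -η b q (br Z (fun p => (X p : Tan n p)) q) := by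
    intro b
    rw [(F.smooth_η b).dForm_eq hq (Y := fun p => (X p : Tan n p)) hZs.diffAt (SmoothAt.diffAt hX),
      hηX, dirDeriv_congr (g := fun _ => c b), dirDeriv_const]
    · ring
    · filter_upwards [mem_eventually V hqV] with p hp using (hR p hp).2.dual.sum b c
  have h2 : dForm (η' a) q (Z q) (X q) = -dirDeriv (fun p => ∑ b, c b * s b p) q (X q : Tan n q)
      + ∑ b, c b * dForm (η b) q (Z q) (X q) := by
    rw [(F'.smooth_η a).dForm_eq hq' (Y := fun p => (X p : Tan n p)) hZs.diffAt
      (SmoothAt.diffAt hX), hηX', dirDeriv_congr (f := fun p => η' a p (Z p))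
        (g := fun p => ∑ b, c b * s b p)]
    · simp only [h1]
      rw [F.trans_η F' hq hq' ht.dual]
      simp only [mul_neg, Finset.sum_neg_distrib, hc]
      ring
    · filter_upwards with p
      simp only [hZ, map_sum, map_smul, smul_eq_mul, s]
  -- The row `s` of the transition matrix has length one, and `s = c` at `q`; this derivative is
  -- half that of `|s|²`.
  have h3 : dirDeriv (fun p => ∑ b, c b * s b p) q (X q : Tan n q) = 0 := by
    have e0 : dirDeriv (fun p => ∑ b, s b p * s b p) q (X q : Tan n q) = 0 := by
      rw [dirDeriv_congr (g := fun _ => 1), dirDeriv_const]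
      filter_upwards [mem_eventually V hqV, mem_eventually U' hq'] with p hp hp'
      have := sum_mul_of_mem (F.trans_mem F' (by omega) (hVU hp) hp' (hR p hp).2.dual) a a
      simpa [trans, s] using this
    rw [dirDeriv_sum (fun b _ => (SmoothFun.mul (hs b) (hs b)).diff)] at e0
    rw [dirDeriv_sum (fun b _ => (SmoothFun.mul (smoothFun_const _) (hs b)).diff)]
    have e1 : ∀ b, dirDeriv (fun p => s b p * s b p) q (X q : Tan n q)
        = 2 * dirDeriv (fun p => c b * s b p) q (X q : Tan n q) := by
      intro b
      rw [dirDeriv_mul (hs b).diff (hs b).diff, dirDeriv_mul (smoothFun_const _).diff (hs b).diff,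
        dirDeriv_const]
      simp only [hc, trans, Matrix.of_apply, s]
      ring
    simp only [e1, ← Finset.mul_sum] at e0
    linarith
  -- A quadratic expression in `c` with coefficients `dη_b(R_d, X)`, which are antisymmetric in `b,
  -- d`.
  have h4 : ∑ b, c b * dForm (η b) q (Z q) (X q) = 0 := by
    have e1 : ∀ b, dForm (η b) q (Z q) (X q) = ∑ d, c d * dForm (η b) q (R d q) (X q) := by
      intro b
      simp only [hZ]
      rw [(F.smooth_η b).dForm_sum_left hq]
      exact Finset.sum_congr rfl fun d _ => (F.smooth_η b).dForm_smul_left hq _ _ _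
    have anti := fun b d => F.reeb_antisymm hn hq ht b d (X q)
    have a01 := anti 0 1
    have a02 := anti 0 2
    have a12 := anti 1 2
    have a00 := anti 0 0
    have a11 := anti 1 1
    have a22 := anti 2 2
    simp only [e1, Fin.sum_univ_three]
    linear_combination c 0 * c 1 * a01 + c 0 * c 2 * a02 + c 1 * c 2 * a12 + c 0 * c 0 * a00 / 2
      + c 1 * c 1 * a11 / 2 + c 2 * c 2 * a22 / 2
  rw [h2, h3, h4]
  ring

theorem span_reeb_le (hn : 2 ≤ n) (hq : q ∈ U) (hq' : q ∈ U') {t t' : Fin 3 → Tan n q}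
    (ht : IsReeb C η q t) (ht' : IsReeb C η' q t') :
    Submodule.span ℝ (range t') ≤ Submodule.span ℝ (range t) := by
  rw [← F'.reeb_unique hq' (F.isReeb_trans F' hn hq hq' ht) ht', Submodule.span_le]
  rintro _ ⟨a, rfl⟩
  exact Submodule.sum_mem _ fun b _ => Submodule.smul_mem _ _ (Submodule.subset_span ⟨b, rfl⟩)

theorem span_reeb_eq (hn : 2 ≤ n) (hq : q ∈ U) (hq' : q ∈ U') {t t' : Fin 3 → Tan n q}
    (ht : IsReeb C η q t) (ht' : IsReeb C η' q t') :
    Submodule.span ℝ (range t') = Submodule.span ℝ (range t) :=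
  le_antisymm (F.span_reeb_le F' hn hq hq' ht ht') (F'.span_reeb_le F hn hq' hq ht' ht)

end QCStructure.Frame

namespace QCStructure

/-- Any Reeb field is spanned at each point by the Reeb triples of all the frames. -/
theorem IsReebField.eq_span {C : QCStructure n M} (hn : 2 ≤ n)
    {P : ∀ q : M, Submodule ℝ (Tan n q)} (hP : C.IsReebField P) {q : M} {U : Opens M}
    {I : Fin 3 → ∀ q : M, Module.End ℝ (C.Q q)} {η : Fin 3 → ∀ q : M, Tan n q →L[ℝ] ℝ}
    (F : C.Frame U I η) (hq : q ∈ U) {t : Fin 3 → Tan n q} (ht : Frame.IsReeb C η q t) :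
    P q = Submodule.span ℝ (range t) := by
  obtain ⟨U', hq', I', η', F', R, hR⟩ := hP q
  obtain ⟨-, h1, h2, h3⟩ := hR q hq'
  rw [h3]
  exact Frame.span_reeb_eq F F' hn hq hq' ht (t' := fun a => R a q) ⟨h1, h2⟩

/-- The plane at each point is defined by an arbitrary contact frame there; `span_reeb_eq` makes the
choice immaterial, so a smooth Reeb triple of one frame spans it on a whole neighbourhood. -/
theorem exists_reebField (C : QCStructure n M) (hn : 2 ≤ n) :
    ∃! P : ∀ q : M, Submodule ℝ (Tan n q), C.IsReebField P := by
  choose U hU I η F using C.local_frame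
  choose t ht using fun q => Frame.exists_reeb (F q) (hU q)
  refine ⟨fun q => Submodule.span ℝ (range (t q)), fun q => ?_, fun P hP => ?_⟩
  · obtain ⟨V, hqV, hVU, R, hR⟩ := Frame.exists_reeb_field (F q) (hU q)
    refine ⟨V, hqV, I q, η q, Frame.mono (F q) hVU, R, fun p hp => ⟨(hR p hp).1, (hR p hp).2.dual,
      (hR p hp).2.reeb, ?_⟩⟩
    exact Frame.span_reeb_eq (F q) (F p) hn (hVU hp) (hU p) (hR p hp).2 (ht p)
  · funext q
    exact hP.eq_span hn (F q) (hU q) (ht q)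

end QCStructure

end Contact

/-! ## The induced structure -/

section Contact

set_option linter.unusedSectionVars false

variable {n : ℕ} {M : Type*} [TopologicalSpace M] [ChartedSpace (Mdl n) M]
  [IsManifold 𝓘(ℝ, Mdl n) ∞ M]

theorem dForm_congr {η η' : ∀ p : M, Tan n p →L[ℝ] ℝ} {q : M} (h : ∀ᶠ p in 𝓝 q, η p = η' p)
    (v w : Tan n q) : dForm η q v w = dForm η' q v w := by
  simp only [dForm]
  have key : ∀ X : ∀ p : M, Tan n p, (fun p => η p (X p)) =ᶠ[𝓝 q] fun p => η' p (X p) :=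
    fun X => h.mono fun p hp => by simp only [hp]
  rw [dirDeriv_congr (key _), dirDeriv_congr (key _), h.self_of_nhds]

theorem SmoothFormOn.congr {η η' : ∀ p : M, Tan n p →L[ℝ] ℝ} {U : Set M} (hη : SmoothFormOn η U)
    (h : ∀ p ∈ U, η' p = η p) : SmoothFormOn η' U :=
  ContMDiffOn.congr hη fun p hp => by simp only [h p hp]

namespace LocalData

variable {L : LocalData n M} {a : Fin 3} {q : M} {v w : Tan n q}

theorem ap_of_mem (hv : v ∈ L.D a q) : L.ap a q v = L.J a q ⟨v, hv⟩ := by simp [ap, hv]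

theorem ap_add (hv : v ∈ L.D a q) (hw : w ∈ L.D a q) :
    L.ap a q (v + w) = L.ap a q v + L.ap a q w := by
  rw [ap_of_mem hv, ap_of_mem hw, ap_of_mem (add_mem hv hw), ← Submodule.coe_add, ← map_add]
  rfl

theorem ap_smul (c : ℝ) (hv : v ∈ L.D a q) : L.ap a q (c • v) = c • L.ap a q v := by
  rw [ap_of_mem hv, ap_of_mem (Submodule.smul_mem _ c hv), ← Submodule.coe_smul, ← map_smul]
  rfl

end LocalData

/-! ### Projection and extended complex structures defined by a dual triple -/

namespace QCStructure.Frame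

variable {C : QCStructure n M} {X Y : ∀ p : M, C.Q p} {q : M}
  {U : Opens M} {I : Fin 3 → ∀ q : M, Module.End ℝ (C.Q q)}
  {η : Fin 3 → ∀ q : M, Tan n q →L[ℝ] ℝ} (F : C.Frame U I η)

include F

/-- The projection to `Q` along the span of a dual triple. -/
def pr (hq : q ∈ U) {t : Fin 3 → Tan n q} (ht : IsDual η q t) : Tan n q →ₗ[ℝ] C.Q q :=
  LinearMap.codRestrict (C.Q q)
    (LinearMap.id - ∑ a, (η a q : Tan n q →ₗ[ℝ] ℝ).smulRight (t a)) fun v => by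
      simpa [LinearMap.sum_apply] using F.sub_mem hq ht v

theorem pr_coe (hq : q ∈ U) {t : Fin 3 → Tan n q} (ht : IsDual η q t) (v : Tan n q) :
    (F.pr hq ht v : Tan n q) = v - ∑ a, η a q v • t a := by
  simp [pr, LinearMap.sum_apply]

theorem eq_pr_add (hq : q ∈ U) {t : Fin 3 → Tan n q} (ht : IsDual η q t) (v : Tan n q) :
    v = (F.pr hq ht v : Tan n q) + ∑ a, η a q v • t a := by
  rw [F.pr_coe, sub_add_cancel]

theorem pr_Q (hq : q ∈ U) {t : Fin 3 → Tan n q} (ht : IsDual η q t) (x : C.Q q) :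
    F.pr hq ht x = x := by
  ext1
  rw [F.pr_coe]
  simp [F.η_Q hq]

theorem pr_t (hq : q ∈ U) {t : Fin 3 → Tan n q} (ht : IsDual η q t) (b : Fin 3) :
    F.pr hq ht (t b) = 0 := by
  ext1
  rw [F.pr_coe]
  simp [ht _ b]

theorem tan_ext (hq : q ∈ U) {t : Fin 3 → Tan n q} (ht : IsDual η q t) {v w : Tan n q}
    (h1 : F.pr hq ht v = F.pr hq ht w) (h2 : ∀ a, η a q v = η a q w) : v = w := by
  rw [F.eq_pr_add hq ht v, F.eq_pr_add hq ht w, h1]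
  simp only [h2]

/-- The extension of `I_a` to the tangent space with `t_b ↦ t_c`, `t_c ↦ -t_b`, `t_a ↦ 0`. -/
def rot (hq : q ∈ U) {t : Fin 3 → Tan n q} (ht : IsDual η q t) (a : Fin 3) :
    Module.End ℝ (Tan n q) :=
  (C.Q q).subtype ∘ₗ I a q ∘ₗ F.pr hq ht
    + (η (a + 1) q : Tan n q →ₗ[ℝ] ℝ).smulRight (t (a + 2))
    - (η (a + 2) q : Tan n q →ₗ[ℝ] ℝ).smulRight (t (a + 1))

variable {t : Fin 3 → Tan n q} (hq : q ∈ U) (ht : IsDual η q t)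

theorem rot_apply (a : Fin 3) (v : Tan n q) : F.rot hq ht a v =
    (I a q (F.pr hq ht v) : Tan n q) + η (a + 1) q v • t (a + 2) - η (a + 2) q v • t (a + 1) := by
  simp [rot]

theorem rot_Q (a : Fin 3) (x : C.Q q) : F.rot hq ht a x = (I a q x : Tan n q) := by
  rw [rot_apply, F.pr_Q, F.η_Q hq, F.η_Q hq]; simp

theorem pr_rot (a : Fin 3) (v : Tan n q) : F.pr hq ht (F.rot hq ht a v) = I a q (F.pr hq ht v) := by
  rw [rot_apply, map_sub, map_add, map_smul, map_smul, F.pr_t, F.pr_t, F.pr_Q]; simp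

theorem η_rot (a : Fin 3) (v : Tan n q) : η a q (F.rot hq ht a v) = 0 := by
  obtain ⟨h1, h2, h3, h4, h5, h6⟩ := fin3_ne a
  rw [rot_apply, map_sub, map_add, F.η_Q hq, map_smul, map_smul, ht, ht]
  simp [h4, h5]

theorem η_rot₁ (a : Fin 3) (v : Tan n q) : η (a + 1) q (F.rot hq ht a v) = -η (a + 2) q v := by
  obtain ⟨h1, h2, h3, h4, h5, h6⟩ := fin3_ne a
  rw [rot_apply, map_sub, map_add, F.η_Q hq, map_smul, map_smul, ht, ht]
  simp [h3]

theorem η_rot₂ (a : Fin 3) (v : Tan n q) : η (a + 2) q (F.rot hq ht a v) = η (a + 1) q v := by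
  obtain ⟨h1, h2, h3, h4, h5, h6⟩ := fin3_ne a
  rw [rot_apply, map_sub, map_add, F.η_Q hq, map_smul, map_smul, ht, ht]
  simp [h6]

theorem rot_t (a b : Fin 3) : F.rot hq ht a (t b) =
    (if b = a + 1 then t (a + 2) else 0) - if b = a + 2 then t (a + 1) else 0 := by
  rw [rot_apply, F.pr_t, map_zero, ht, ht]
  simp only [eq_comm (a := b), Submodule.coe_zero, zero_add, ite_smul, one_smul, zero_smul]

end QCStructure.Frame

namespace QCStructure

/-- The properties of the local data induced by the Reeb field. -/
structure IsInduced (C : QCStructure n M) (L : LocalData n M)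
    (I : Fin 3 → ∀ q : M, Module.End ℝ (C.Q q)) : Prop where
  frame : C.Frame L.U I L.θ
  mem_D : ∀ q ∈ L.U, ∀ a v, v ∈ L.D a q ↔ L.θ a q v = 0
  ap_eq : ∀ (q : M) (hq : q ∈ L.U) (t : Fin 3 → Tan n q) (ht : Frame.IsReeb C L.θ q t) (a : Fin 3),
    ∀ v ∈ L.D a q, L.ap a q v = Frame.rot frame hq ht.dual a v

variable {C : QCStructure n M} {P : ∀ q : M, Submodule ℝ (Tan n q)}

/-- A Reeb field is spanned by the Reeb triple of every contact frame, so the triple in `P` dual to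
the forms must be the Reeb triple. Hence all data of `L` can be computed from the endomorphisms
`rot`. -/
theorem exists_isInduced (hn : 2 ≤ n) (hP : C.IsReebField P) {L : LocalData n M}
    (hL : L ∈ C.induced P) : ∃ I, C.IsInduced L I := by
  obtain ⟨I, η, F, h⟩ := hL
  have hθ : ∀ a, ∀ q ∈ L.U, ∀ᶠ p in 𝓝 q, L.θ a p = η a p := fun a q hq => by
    filter_upwards [mem_eventually L.U hq] with p hp using (h p hp).1 a
  have F' : C.Frame L.U I L.θ :=
    { smooth_I := F.smooth_I
      quat := F.quat
      sphere := F.sphere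
      smooth_η := fun a => (F.smooth_η a).congr fun p hp => (h p hp).1 a
      ker := fun q hq v => by
        rw [F.ker q hq]
        exact forall_congr' fun a => by rw [(h q hq).1 a]
      compat := fun q hq a X Y => by rw [F.compat q hq, dForm_congr (hθ a q hq)] }
  have key : ∀ q (hq : q ∈ L.U), ∀ t, Frame.IsReeb C L.θ q t → ∀ a,
      L.D a q = C.Q q ⊔ Submodule.span ℝ {t (a + 1), t (a + 2)} ∧
        (∀ X : C.Q q, L.ap a q X = (I a q X : Tan n q)) ∧
        L.ap a q (t (a + 1)) = t (a + 2) ∧ L.ap a q (t (a + 2)) = -t (a + 1) := by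
    intro q hq t ht
    obtain ⟨h1, s, hsP, hs, hD⟩ := h q hq
    have hst : s = t := by
      funext b
      have hb := hsP b
      rw [hP.eq_span hn F' hq ht] at hb
      obtain ⟨c, hc⟩ := (Submodule.mem_span_range_iff_exists_fun ℝ).1 hb
      have hc' : c = Pi.single b 1 := by
        funext a
        rw [← ht.dual.sum a c, hc, h1 a, hs]
        simp [Pi.single_apply]
      rw [← hc, hc']
      simp [Pi.single_apply]
    rw [← hst]
    exact hD
  have hmem : ∀ q ∈ L.U, ∀ a v, v ∈ L.D a q ↔ L.θ a q v = 0 := by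
    intro q hq a v
    obtain ⟨t, ht⟩ := Frame.exists_reeb F' hq
    obtain ⟨h1, h2, h3, h4, h5, h6⟩ := fin3_ne a
    rw [(key q hq t ht a).1]
    constructor
    · intro hv
      suffices C.Q q ⊔ Submodule.span ℝ {t (a + 1), t (a + 2)}
        ≤ LinearMap.ker (L.θ a q : Tan n q →ₗ[ℝ] ℝ) from this hv
      refine sup_le (fun x hx => Frame.η_Q F' hq a ⟨x, hx⟩) (Submodule.span_le.2 ?_)
      rintro _ (rfl | rfl)
      · exact (ht.dual a _).trans (by simp [h4])
      · exact (ht.dual a _).trans (by simp [h5])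
    · intro hv
      rw [Frame.eq_pr_add F' hq ht.dual v, fin3_sum _ a, hv, zero_smul, zero_add]
      refine add_mem (Submodule.mem_sup_left (Subtype.coe_prop _)) (Submodule.mem_sup_right ?_)
      exact add_mem (Submodule.smul_mem _ _ (Submodule.subset_span (by simp)))
        (Submodule.smul_mem _ _ (Submodule.subset_span (by simp)))
  refine ⟨I, F', hmem, fun q hq t ht a v hv => ?_⟩
  obtain ⟨h1, h2, h3, h4, h5, h6⟩ := fin3_ne a
  obtain ⟨-, k1, k2, k3⟩ := key q hq t ht a
  have hv' := (hmem q hq a v).1 hv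
  have m0 : (Frame.pr F' hq ht.dual v : Tan n q) ∈ L.D a q := (hmem q hq a _).2 (Frame.η_Q F' hq a _)
  have m1 : t (a + 1) ∈ L.D a q := (hmem q hq a _).2 ((ht.dual a _).trans (by simp [h4]))
  have m2 : t (a + 2) ∈ L.D a q := (hmem q hq a _).2 ((ht.dual a _).trans (by simp [h5]))
  conv_lhs => rw [Frame.eq_pr_add F' hq ht.dual v, fin3_sum _ a, hv', zero_smul, zero_add]
  rw [LocalData.ap_add m0 (add_mem (Submodule.smul_mem _ _ m1) (Submodule.smul_mem _ _ m2)),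
    LocalData.ap_add (Submodule.smul_mem _ _ m1) (Submodule.smul_mem _ _ m2),
    LocalData.ap_smul _ m1, LocalData.ap_smul _ m2, k1, k2, k3, Frame.rot_apply, smul_neg]
  abel

namespace IsInduced

variable {L : LocalData n M} {I : Fin 3 → ∀ q : M, Module.End ℝ (C.Q q)} (h : C.IsInduced L I)

include h

theorem Q_eq {q : M} (hq : q ∈ L.U) : C.Q q = L.Q q := by
  ext v
  rw [LocalData.Q, Submodule.mem_iInf, h.frame.ker q hq]
  exact forall_congr' fun a => (h.mem_D q hq a v).symm

theorem ap_Q {q : M} (hq : q ∈ L.U) (a : Fin 3) (x : C.Q q) : L.ap a q x = (I a q x : Tan n q) := by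
  obtain ⟨t, ht⟩ := Frame.exists_reeb h.frame hq
  rw [h.ap_eq q hq t ht a _ ((h.mem_D q hq a _).2 (Frame.η_Q h.frame hq a x)), Frame.rot_Q]

theorem ap_of_θ {q : M} (hq : q ∈ L.U) {t : Fin 3 → Tan n q} (ht : Frame.IsReeb C L.θ q t)
    {a : Fin 3} {v : Tan n q} (hv : L.θ a q v = 0) :
    L.ap a q v = Frame.rot h.frame hq ht.dual a v :=
  h.ap_eq q hq t ht a v ((h.mem_D q hq a v).2 hv)

theorem levi {q : M} (hq : q ∈ L.U) (a : Fin 3) (X Y : C.Q q) :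
    C.γ q X Y = L.levi a q X Y := by
  have hh := Frame.isQuatHerm h.frame hq
  rw [LocalData.levi, h.ap_Q hq, h.ap_Q hq, h.ap_Q hq, ← h.frame.compat q hq,
    ← h.frame.compat q hq, hh.herm, hh.mul, hh.herm]
  ring

theorem isCompatible : L.IsCompatible where
  smooth := h.frame.smooth_η
  ker q hq a v := h.mem_D q hq a v
  comp q hq a v hv := by
    obtain ⟨t, ht⟩ := Frame.exists_reeb h.frame hq
    rw [h.ap_eq q hq t ht a v hv, Frame.η_rot₂]

/-- Both conditions only concern the components `θ_b` of brackets, which are `-γ(I_b ·, ·)` by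
`η_br`. They become identities between `γ`-products of quaternionic multiples of `X` and `Y`. -/
theorem isIntegrable : L.IsIntegrable := by
  intro q hq X Y hX hY a
  have hQ : ∀ p ∈ L.U, ∀ x : L.Q p, (x : Tan n p) ∈ C.Q p := fun p hp x => by
    rw [h.Q_eq hp]; exact x.2
  -- The bundles `L.Q` and `C.Q` agree only over `L.U`, so sections of the former are replaced by
  -- sections of the latter which are equal to them near `q`.
  let X' := C.toSec fun p => (X p : Tan n p)
  let Y' := C.toSec fun p => (Y p : Tan n p)
  have eX : ∀ᶠ p in 𝓝 q, (X p : Tan n p) = X' p := by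
    filter_upwards [mem_eventually L.U hq] with p hp using (toSec_coe (X := fun p => (X p : Tan n p)) (hQ p hp (X p))).symm
  have eY : ∀ᶠ p in 𝓝 q, (Y p : Tan n p) = Y' p := by
    filter_upwards [mem_eventually L.U hq] with p hp using (toSec_coe (X := fun p => (Y p : Tan n p)) (hQ p hp (Y p))).symm
  have eIX : ∀ᶠ p in 𝓝 q, L.ap a p (X p : Tan n p) = (I a p (X' p) : Tan n p) := by
    filter_upwards [mem_eventually L.U hq, eX] with p hp h1 using by rw [h1, h.ap_Q hp]
  have eIY : ∀ᶠ p in 𝓝 q, L.ap a p (Y p : Tan n p) = (I a p (Y' p) : Tan n p) := by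
    filter_upwards [mem_eventually L.U hq, eY] with p hp h1 using by rw [h1, h.ap_Q hp]
  have hX' : C.SmoothSec X' q := SmoothAt.congr hX (eX.mono fun _ h => h.symm)
  have hY' : C.SmoothSec Y' q := SmoothAt.congr hY (eY.mono fun _ h => h.symm)
  have hIX := Frame.smoothSec_I h.frame hq a hX'
  have hIY := Frame.smoothSec_I h.frame hq a hY'
  change br (fun p => (X p : Tan n p)) (fun p => (Y p : Tan n p)) q
        - br (fun p => L.ap a p (X p)) (fun p => L.ap a p (Y p)) q ∈ L.D a q ∧
      L.ap a q (br (fun p => (X p : Tan n p)) (fun p => (Y p : Tan n p)) q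
        - br (fun p => L.ap a p (X p)) (fun p => L.ap a p (Y p)) q)
        - br (fun p => (X p : Tan n p)) (fun p => L.ap a p (Y p)) q
        - br (fun p => L.ap a p (X p)) (fun p => (Y p : Tan n p)) q ∈ L.Q q
  rw [br_congr eX eY, br_congr eIX eIY, br_congr eX eIY, br_congr eIX eY]
  have hh := Frame.isQuatHerm h.frame hq
  have b1 := Frame.η_br h.frame hq hX' hY'
  have b2 := Frame.η_br h.frame hq hIX hIY
  have b3 := Frame.η_br h.frame hq hX' hIY
  have b4 := Frame.η_br h.frame hq hIX hY'
  obtain ⟨t, ht⟩ := Frame.exists_reeb h.frame hq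
  have hN : L.θ a q (br (fun p => (X' p : Tan n p)) (fun p => (Y' p : Tan n p)) q
      - br (fun p => (I a p (X' p) : Tan n p)) (fun p => (I a p (Y' p) : Tan n p)) q) = 0 := by
    rw [map_sub, b1, b2, hh.herm, sub_self]
  refine ⟨(h.mem_D q hq a _).2 hN, ?_⟩
  rw [h.ap_of_θ hq ht hN, ← h.Q_eq hq, h.frame.ker q hq]
  have c1 : ∀ x y, C.γ q (I (a + 1) q x) (I a q y) = -C.γ q (I (a + 2) q x) y := fun x y => by
    rw [← neg_neg (C.γ q (I (a + 1) q x) (I a q y)), ← hh.skew, hh.mul]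
  have c2 : ∀ x y, C.γ q (I (a + 2) q x) (I a q y) = C.γ q (I (a + 1) q x) y := fun x y => by
    rw [← neg_neg (C.γ q (I (a + 2) q x) (I a q y)), ← hh.skew, hh.mul₂', map_neg,
      LinearMap.neg_apply, neg_neg]
  intro b
  rcases fin3_cases a b with rfl | rfl | rfl
  · rw [map_sub, map_sub, Frame.η_rot, b3, b4, hh.herm, hh.sq, map_neg, LinearMap.neg_apply]
    ring
  · rw [map_sub, map_sub, Frame.η_rot₁, map_sub, b1, b2, b3, b4, hh.mul₂, c1, hh.mul',
      map_neg, LinearMap.neg_apply]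
    ring
  · rw [map_sub, map_sub, Frame.η_rot₂, map_sub, b1, b2, b3, b4, hh.mul₂, c2, hh.mul', map_neg,
      LinearMap.neg_apply, c2]
    ring

end IsInduced

end QCStructure

end Contact

/-! ### The almost hyper CR structure -/

section Contact

set_option linter.unusedSectionVars false

variable {n : ℕ} {M : Type*} [TopologicalSpace M] [ChartedSpace (Mdl n) M]
  [IsManifold 𝓘(ℝ, Mdl n) ∞ M]

namespace QCStructure

variable {C : QCStructure n M} {P : ∀ q : M, Submodule ℝ (Tan n q)}

theorem Frame.finrank_ker {U : Opens M} {I : Fin 3 → ∀ q : M, Module.End ℝ (C.Q q)}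
    {η : Fin 3 → ∀ q : M, Tan n q →L[ℝ] ℝ} (F : C.Frame U I η) {q : M} (hq : q ∈ U) (a : Fin 3) :
    finrank ℝ (LinearMap.ker (η a q : Tan n q →ₗ[ℝ] ℝ)) = 4 * n + 2 := by
  obtain ⟨t, ht⟩ := F.exists_reeb hq
  have hs : LinearMap.range (η a q : Tan n q →ₗ[ℝ] ℝ) = ⊤ := by
    rw [LinearMap.range_eq_top]
    intro c
    exact ⟨c • t a, by simp [ht.dual a a]⟩
  have := (η a q : Tan n q →ₗ[ℝ] ℝ).finrank_range_add_finrank_ker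
  rw [hs, finrank_tan, finrank_top, finrank_self] at this
  omega

namespace IsInduced

variable {L : LocalData n M} {I : Fin 3 → ∀ q : M, Module.End ℝ (C.Q q)} (h : C.IsInduced L I)

include h

theorem isSmoothSubbundleOn (a : Fin 3) : IsSmoothSubbundleOn (L.D a) (4 * n + 2) L.U := by
  intro q hq
  obtain ⟨V, hqV, hVU, R, hR⟩ := Frame.exists_reeb_field h.frame hq
  obtain ⟨W, hqW, hWU, ε, hε⟩ := Frame.exists_adapted h.frame hq
  -- The hyperplane is framed by the `4n` fields of `Q` and the two Reeb fields with index different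
  -- from `a`.
  let e : (Fin 4 × Fin n) ⊕ Fin 2 ≃ Fin (4 * n + 2) := Fintype.equivFinOfCardEq (by simp)
  let Y : (Fin 4 × Fin n) ⊕ Fin 2 → ∀ p : M, Tan n p :=
    Sum.elim (fun i p => (ε i p : Tan n p)) ![R (a + 1), R (a + 2)]
  obtain ⟨h1, h2, h3, h4, h5, h6⟩ := fin3_ne a
  have hspan : ∀ p ∈ V ⊓ W, Submodule.span ℝ (range fun i => Y (e.symm i) p)
      = LinearMap.ker (L.θ a p : Tan n p →ₗ[ℝ] ℝ) := by
    rintro p ⟨hpV, hpW⟩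
    have hpU := hVU hpV
    have ht := (hR p hpV).2
    have hr : (range fun i => Y (e.symm i) p) = range fun i => Y i p :=
      e.symm.surjective.range_comp fun i => Y i p
    rw [hr]
    apply le_antisymm
    · rw [Submodule.span_le]
      rintro _ ⟨i | i, rfl⟩
      · exact Frame.η_Q h.frame hpU a _
      · fin_cases i
        · exact (ht.dual a _).trans (by simp [h4])
        · exact (ht.dual a _).trans (by simp [h5])
    · intro v hv
      have hv : L.θ a p v = 0 := hv
      rw [Frame.eq_pr_add h.frame hpU ht.dual v, fin3_sum _ a, hv, zero_smul, zero_add,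
        (hε p hpW).2.eq_sum (finrank_Q p) (Frame.pr h.frame hpU ht.dual v), Submodule.coe_sum]
      refine add_mem (Submodule.sum_mem _ fun i _ => ?_) (add_mem ?_ ?_)
      · rw [Submodule.coe_smul]
        exact Submodule.smul_mem _ _ (Submodule.subset_span ⟨Sum.inl i, rfl⟩)
      · exact Submodule.smul_mem _ _ (Submodule.subset_span ⟨Sum.inr 0, rfl⟩)
      · exact Submodule.smul_mem _ _ (Submodule.subset_span ⟨Sum.inr 1, rfl⟩)
  refine ⟨V ⊓ W, ⟨hqV, hqW⟩, fun i => Y (e.symm i), fun p hp => ⟨fun i => ?_, ?_, fun hpU => ?_⟩⟩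
  · have hY : ∀ j, SmoothAt (Y j) p := ?_
    · exact hY (e.symm i)
    rintro (j | j)
    · exact (hε p hp.2).1 j
    · fin_cases j
      · exact (hR p hp.1).1 _
      · exact (hR p hp.1).1 _
  · rw [linearIndependent_iff_card_eq_finrank_span, Set.finrank, hspan p hp,
      Frame.finrank_ker h.frame (hVU hp.1), Fintype.card_fin]
  · rw [hspan p hp]
    ext v
    exact (h.mem_D p hpU a v).symm

/-- Subtracting the Reeb components of a section leaves a smooth section of `C.Q`, on which `I a`
acts smoothly; `rot` permutes the Reeb components up to sign. -/
theorem smoothEndOn (a : Fin 3) : SmoothEndOn (L.D a) (L.J a) L.U := by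
  intro q hq Y hY
  obtain ⟨V, hqV, hVU, R, hR⟩ := Frame.exists_reeb_field h.frame hq
  have hR' := (hR q hqV).1
  have hηY : ∀ b, SmoothFun n (fun p => L.θ b p (Y p)) q := fun b =>
    (h.frame.smooth_η b).smoothFun hq hY
  let Z : ∀ p : M, Tan n p := fun p => (Y p : Tan n p) - ∑ b, L.θ b p (Y p) • R b p
  have hZ : SmoothAt Z q := SmoothAt.sub hY (SmoothAt.sum fun b _ => SmoothAt.smul (hηY b) (hR' b))
  have hZQ : ∀ p ∈ V, Z p ∈ C.Q p := fun p hp =>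
    Frame.sub_mem h.frame (hVU hp) (hR p hp).2.dual (Y p : Tan n p)
  have hZs : C.SmoothSec (C.toSec Z) q := smoothSec_toSec hZ
    ((mem_eventually V hqV).mono fun p hp => hZQ p hp)
  refine SmoothAt.congr (SmoothAt.sub (SmoothAt.add (Frame.smoothSec_I h.frame hq a hZs)
    (SmoothAt.smul (hηY (a + 1)) (hR' (a + 2)))) (SmoothAt.smul (hηY (a + 2)) (hR' (a + 1)))) ?_
  filter_upwards [mem_eventually V hqV] with p hp
  rw [← LocalData.ap_of_mem (Y p).2, h.ap_eq p (hVU hp) _ (hR p hp).2 a _ (Y p).2, Frame.rot_apply]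
  congr 3
  congr 1
  ext1
  rw [toSec_coe (hZQ p hp), Frame.pr_coe]

theorem rot_rot {q : M} (hq : q ∈ L.U) {t : Fin 3 → Tan n q} (ht : Frame.IsReeb C L.θ q t)
    {a : Fin 3} {v : Tan n q} (hv : L.θ a q v = 0) :
    Frame.rot h.frame hq ht.dual a (Frame.rot h.frame hq ht.dual a v) = -v := by
  refine Frame.tan_ext h.frame hq ht.dual ?_ fun b => ?_
  · rw [Frame.pr_rot, Frame.pr_rot, (Frame.isQuatHerm h.frame hq).sq, map_neg]
  · rcases fin3_cases a b with rfl | rfl | rfl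
    · rw [Frame.η_rot, map_neg, hv, neg_zero]
    · rw [Frame.η_rot₁, Frame.η_rot₂, map_neg]
    · rw [Frame.η_rot₂, Frame.η_rot₁, map_neg]

theorem isAlmostHyperCR : L.IsAlmostHyperCR := by
  have hD : ∀ {q a v}, q ∈ L.U → (v ∈ L.D a q ↔ L.θ a q v = 0) := fun hq => h.mem_D _ hq _ _
  have hap : ∀ {q} (hq : q ∈ L.U) {t : Fin 3 → Tan n q} (ht : Frame.IsReeb C L.θ q t) {a v},
    L.θ a q v = 0 → L.ap a q v = Frame.rot h.frame hq ht.dual a v := fun hq _ ht _ _ hv =>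
      h.ap_of_θ hq ht hv
  refine ⟨h.isSmoothSubbundleOn, h.smoothEndOn, ?_, ?_, ?_, ?_, ?_, ?_⟩
  · intro q hq a v
    obtain ⟨t, ht⟩ := Frame.exists_reeb h.frame hq
    ext1
    have hv := (hD hq).1 v.2
    have h1 : (L.J a q v : Tan n q) = Frame.rot h.frame hq ht.dual a v := by
      rw [← hap hq ht hv, LocalData.ap_of_mem v.2]
    have h2 := hap hq ht ((hD hq).1 (L.J a q v).2)
    rw [LocalData.ap_of_mem (L.J a q v).2] at h2
    rw [Submodule.coe_neg, ← h.rot_rot hq ht hv, ← h1, ← h2]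
  · intro q hq
    obtain ⟨t, ht⟩ := Frame.exists_reeb h.frame hq
    rw [eq_top_iff]
    intro v _
    rw [← sub_add_cancel v (L.θ 0 q v • t 0)]
    refine Submodule.add_mem_sup ((hD hq).2 ?_) ((hD hq).2 ?_)
    · rw [map_sub, map_smul, ht.dual]; simp
    · rw [map_smul, ht.dual]; simp
  -- A vector in both images is annihilated by all three forms, hence lies in `Q`, where the
  -- quaternion relations hold.
  · rintro q hq v ⟨x, hx, hvx⟩ ⟨y, hy, hvy⟩
    obtain ⟨t, ht⟩ := Frame.exists_reeb h.frame hq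
    have x0 := (hD hq).1 hx.1
    have x1 := (hD hq).1 hx.2
    have y0 := (hD hq).1 hy.1
    have y1 := (hD hq).1 hy.2
    rw [hap hq ht x0] at hvx
    rw [hap hq ht y1] at hvy
    have v0 : L.θ 0 q v = 0 := by rw [hvx, Frame.η_rot]
    have v1 : L.θ 1 q v = 0 := by rw [hvy, Frame.η_rot]
    have v2 : L.θ 2 q v = 0 := by rw [hvx]; exact (Frame.η_rot₂ h.frame hq ht.dual 0 x).trans x1
    have hvQ : v ∈ C.Q q := (h.frame.ker q hq v).2 fun b => by fin_cases b <;> assumption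
    have e0 := h.ap_Q hq
    have hh := Frame.isQuatHerm h.frame hq
    change L.ap 0 q (L.ap 1 q ((⟨v, hvQ⟩ : C.Q q) : Tan n q))
      = -L.ap 1 q (L.ap 0 q ((⟨v, hvQ⟩ : C.Q q) : Tan n q))
    rw [e0, e0, e0, e0, ← Submodule.coe_neg]
    have := hh.mul' 0 ⟨v, hvQ⟩
    have h2 := hh.mul 0 ⟨v, hvQ⟩
    simp only [zero_add] at this h2
    rw [this, h2, neg_neg]
  · intro q hq v
    obtain ⟨t, ht⟩ := Frame.exists_reeb h.frame hq
    have hh := Frame.isQuatHerm h.frame hq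
    constructor
    · intro hv
      have hv := (hD hq).1 hv
      -- The first witness is chosen so that `I 0` maps it to the `Q`-part and the `t 1`-part of
      -- `v`; `I 1` maps the second witness to the `t 0`-part.
      have hx : ∀ b : Fin 3, b ≠ 2 → L.θ b q ((-(I 0 q (Frame.pr h.frame hq ht.dual v)) : C.Q q)
          - L.θ 1 q v • t 2 : Tan n q) = 0 := fun b hb => by
        rw [map_sub, Frame.η_Q h.frame hq, map_smul, ht.dual, if_neg hb]; simp
      have hy : ∀ b : Fin 3, b ≠ 2 → L.θ b q (L.θ 0 q v • t 2) = 0 := fun b hb => by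
        rw [map_smul, ht.dual, if_neg hb]; simp
      refine ⟨_, ⟨(hD hq).2 (hx 0 (by decide)), (hD hq).2 (hx 1 (by decide))⟩, _,
        ⟨(hD hq).2 (hy 0 (by decide)), (hD hq).2 (hy 1 (by decide))⟩, ?_⟩
      rw [hap hq ht (hx 0 (by decide)), hap hq ht (hy 1 (by decide)), map_sub, Frame.rot_Q, map_smul,
        map_smul, Frame.rot_t, Frame.rot_t, map_neg, hh.sq, neg_neg]
      conv_lhs => rw [Frame.eq_pr_add h.frame hq ht.dual v, Fin.sum_univ_three, hv]
      simp
      abel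
    · rintro ⟨x, hx, y, hy, rfl⟩
      have x0 := (hD hq).1 hx.1
      have x1 := (hD hq).1 hx.2
      have y0 := (hD hq).1 hy.1
      have y1 := (hD hq).1 hy.2
      rw [hD hq, hap hq ht x0, hap hq ht y1, map_add]
      have e1 := Frame.η_rot₂ h.frame hq ht.dual 0 x
      have e2 := Frame.η_rot₁ h.frame hq ht.dual 1 y
      have e1' : L.θ 2 q (Frame.rot h.frame hq ht.dual 0 x) = L.θ 1 q x := e1
      have e2' : L.θ 2 q (Frame.rot h.frame hq ht.dual 1 y) = -L.θ 0 q y := e2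
      rw [e1', e2', x1, y0]
      simp
  · intro q hq x hx
    obtain ⟨t, ht⟩ := Frame.exists_reeb h.frame hq
    have hh := Frame.isQuatHerm h.frame hq
    have x0 := (hD hq).1 hx.1
    have x1 := (hD hq).1 hx.2
    have e1 : L.θ 2 q (Frame.rot h.frame hq ht.dual 0 x) = 0 :=
      (Frame.η_rot₂ h.frame hq ht.dual 0 x).trans x1
    rw [hap hq ht x0, hap hq ht e1, hap hq ht (Frame.η_rot h.frame hq ht.dual 0 x),
      h.rot_rot hq ht x0, hap hq ht (by rw [map_neg, x1, neg_zero]), map_neg, neg_neg]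
    refine Frame.tan_ext h.frame hq ht.dual ?_ fun b => ?_
    · rw [Frame.pr_rot, Frame.pr_rot, Frame.pr_rot]
      exact hh.mul 2 _
    · fin_cases b
      · refine (Frame.η_rot₁ h.frame hq ht.dual 2 _).trans ?_
        refine Eq.trans ?_ (Frame.η_rot₂ h.frame hq ht.dual 1 _).symm
        refine Eq.trans ?_ (show L.θ 2 q x = L.θ (1 + 1) q x from rfl)
        exact neg_eq_iff_eq_neg.2 (Frame.η_rot₁ h.frame hq ht.dual 0 _)
      · refine (Frame.η_rot₂ h.frame hq ht.dual 2 _).trans ?_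
        refine Eq.trans ?_ (Frame.η_rot h.frame hq ht.dual 1 _).symm
        exact Frame.η_rot h.frame hq ht.dual 0 _
      · refine (Frame.η_rot h.frame hq ht.dual 2 _).trans ?_
        refine Eq.trans ?_ (Frame.η_rot₁ h.frame hq ht.dual 1 _).symm
        exact (neg_eq_zero.2 x0).symm
  · intro q hq x hx
    obtain ⟨t, ht⟩ := Frame.exists_reeb h.frame hq
    have hh := Frame.isQuatHerm h.frame hq
    have x0 := (hD hq).1 hx.1
    have x1 := (hD hq).1 hx.2
    have e1 : L.θ 2 q (Frame.rot h.frame hq ht.dual 1 x) = 0 :=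
      (Frame.η_rot₁ h.frame hq ht.dual 1 x).trans (neg_eq_zero.2 x0)
    rw [hap hq ht x1, hap hq ht e1, hap hq ht (Frame.η_rot h.frame hq ht.dual 1 x),
      h.rot_rot hq ht x1, hap hq ht (by rw [map_neg, x0, neg_zero]), map_neg]
    refine Frame.tan_ext h.frame hq ht.dual ?_ fun b => ?_
    · rw [Frame.pr_rot, Frame.pr_rot, map_neg, Frame.pr_rot]
      exact hh.mul' 1 _
    · rw [map_neg]
      fin_cases b
      · refine (Frame.η_rot₁ h.frame hq ht.dual 2 _).trans (neg_inj.2 ?_)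
        refine (Frame.η_rot h.frame hq ht.dual 1 _).trans ?_
        exact (Frame.η_rot h.frame hq ht.dual 0 _).symm
      · refine (Frame.η_rot₂ h.frame hq ht.dual 2 _).trans ?_
        refine (Frame.η_rot₂ h.frame hq ht.dual 1 _).trans ?_
        exact eq_neg_iff_add_eq_zero.2 (eq_neg_iff_add_eq_zero.1 <|
          (neg_eq_iff_eq_neg.2 (Frame.η_rot₁ h.frame hq ht.dual 0 x)).symm.trans (by rfl))
      · refine (Frame.η_rot h.frame hq ht.dual 2 _).trans ?_
        exact (neg_eq_zero.2 ((Frame.η_rot₂ h.frame hq ht.dual 0 _).trans x1)).symm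

/-- Each `dθ_a(X, I_a X)` equals `γ(X, X)`, so the form in question is `(2n + 1) γ`. -/
theorem isUltra {q : M} (hq : q ∈ L.U) (X : C.Q q) (hX : X ≠ 0) :
    0 < (2 * (n : ℝ) + 4) * C.γ q X X - ∑ a, dForm (L.θ a) q X (L.ap a q X) := by
  have hh := Frame.isQuatHerm h.frame hq
  have h1 : ∀ a, dForm (L.θ a) q X (L.ap a q X) = C.γ q X X := fun a => by
    rw [h.ap_Q hq, ← h.frame.compat q hq, hh.herm]
  simp only [h1, Finset.sum_const, Finset.card_univ, Fintype.card_fin, nsmul_eq_mul]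
  have := hh.pos X hX
  push_cast
  nlinarith [mul_nonneg (Nat.cast_nonneg (α := ℝ) n) this.le]

end IsInduced

/-- The local data induced by a frame. -/
theorem Frame.exists_induced {U : Opens M} {I : Fin 3 → ∀ q : M, Module.End ℝ (C.Q q)}
    {η : Fin 3 → ∀ q : M, Tan n q →L[ℝ] ℝ} (F : C.Frame U I η) (hn : 2 ≤ n)
    (hP : C.IsReebField P) : ∃ L ∈ C.induced P, L.U = U := by
  classical
  choose t ht using fun (q : M) (hq : q ∈ U) => F.exists_reeb hq
  have hJ : ∀ q (hq : q ∈ U) (a : Fin 3), ∀ v ∈ LinearMap.ker (η a q : Tan n q →ₗ[ℝ] ℝ),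
      F.rot hq (ht q hq).dual a v ∈ LinearMap.ker (η a q : Tan n q →ₗ[ℝ] ℝ) := by
    intro q hq a v _
    exact F.η_rot hq (ht q hq).dual a v
  let L : LocalData n M :=
    { U := U
      D := fun a q => LinearMap.ker (η a q : Tan n q →ₗ[ℝ] ℝ)
      -- The Reeb triple is available over `U` only; elsewhere the value does not matter.
      J := fun a q => if hq : q ∈ U then (F.rot hq (ht q hq).dual a).restrict (hJ q hq a) else 0
      θ := η }
  have hap : ∀ q (hq : q ∈ U) a v, η a q v = 0 → L.ap a q v = F.rot hq (ht q hq).dual a v := by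
    intro q hq a v hv
    rw [LocalData.ap_of_mem (show v ∈ L.D a q from hv)]
    simp only [L, dif_pos hq]
    rfl
  refine ⟨L, ⟨I, η, F, fun q hq => ⟨fun a => rfl, t q hq, fun a => ?_, (ht q hq).dual,
    fun a => ⟨?_, fun X => ?_, ?_, ?_⟩⟩⟩, rfl⟩
  · rw [hP.eq_span hn F hq (ht q hq)]
    exact Submodule.subset_span ⟨a, rfl⟩
  · obtain ⟨h1, h2, h3, h4, h5, h6⟩ := fin3_ne a
    apply le_antisymm
    · intro v hv
      have hv : η a q v = 0 := hv
      rw [F.eq_pr_add hq (ht q hq).dual v, fin3_sum _ a, hv, zero_smul, zero_add]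
      refine add_mem (Submodule.mem_sup_left (Subtype.coe_prop _)) (Submodule.mem_sup_right ?_)
      exact add_mem (Submodule.smul_mem _ _ (Submodule.subset_span (by simp)))
        (Submodule.smul_mem _ _ (Submodule.subset_span (by simp)))
    · refine sup_le (fun x hx => F.η_Q hq a ⟨x, hx⟩) (Submodule.span_le.2 ?_)
      rintro _ (rfl | rfl)
      · exact ((ht q hq).dual a _).trans (by simp [h4])
      · exact ((ht q hq).dual a _).trans (by simp [h5])
  · rw [hap q hq a _ (F.η_Q hq a X), F.rot_Q]
  · obtain ⟨h1, h2, h3, h4, h5, h6⟩ := fin3_ne a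
    rw [hap q hq a _ (((ht q hq).dual a _).trans (by simp [h4])), F.rot_t]
    simp [h3]
  · obtain ⟨h1, h2, h3, h4, h5, h6⟩ := fin3_ne a
    rw [hap q hq a _ (((ht q hq).dual a _).trans (by simp [h5])), F.rot_t]
    simp [h6]

end QCStructure

end Contact

/-! ### Gluing -/

section Contact

set_option linter.unusedSectionVars false

variable {n : ℕ} {M : Type*} [TopologicalSpace M] [ChartedSpace (Mdl n) M]
  [IsManifold 𝓘(ℝ, Mdl n) ∞ M]

/-- Rotation matrices preserve cross products. -/
theorem cofactor_of_mem {S : Matrix (Fin 3) (Fin 3) ℝ}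
    (hS : S ∈ Matrix.specialOrthogonalGroup (Fin 3) ℝ) (a b : Fin 3) :
    S (a + 1) (b + 1) * S (a + 2) (b + 2) - S (a + 1) (b + 2) * S (a + 2) (b + 1) = S a b := by
  rw [Matrix.mem_specialOrthogonalGroup_iff, Matrix.mem_orthogonalGroup_iff] at hS
  have h : S.adjugate = Sᵀ := by
    have h1 : S.adjugate * (S * Sᵀ) = Sᵀ := by
      rw [← mul_assoc, Matrix.adjugate_mul, hS.2, one_smul, one_mul]
    rwa [hS.1, mul_one] at h1
  rw [Matrix.adjugate_fin_three] at h
  have h2 := congrFun (congrFun h b) a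
  rw [Matrix.transpose_apply] at h2
  rw [← h2]
  fin_cases a <;> fin_cases b <;> simp <;> ring

namespace QCStructure

variable {C : QCStructure n M} {P : ∀ q : M, Submodule ℝ (Tan n q)}

namespace IsInduced

variable {L L' : LocalData n M} {I I' : Fin 3 → ∀ q : M, Module.End ℝ (C.Q q)}
  (h : C.IsInduced L I) (h' : C.IsInduced L' I') {q : M} (hq : q ∈ L.U) (hq' : q ∈ L'.U)
  {t t' τ τ' : Fin 3 → Tan n q}

include h hq

/-- Admissible triples are obtained from the Reeb triple by means of a section of `Q`. -/
theorem admissible_eq (ht : Frame.IsReeb C L.θ q t) (hτ : L.IsAdmissibleAt q τ) :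
    ∃ (f : ℝ) (r : C.Q q), f ≠ 0 ∧ ∀ a, τ a = f • t a + f • (I a q r : Tan n q) := by
  have hh := Frame.isQuatHerm h.frame hq
  have hm : ∀ a, L.θ (a + 1) q (τ a) = 0 ∧ L.θ (a + 2) q (τ a) = 0 := fun a =>
    ⟨(h.mem_D q hq _ _).1 (hτ.mem a).1, (h.mem_D q hq _ _).1 (hτ.mem a).2⟩
  let x : Fin 3 → C.Q q := fun a => Frame.pr h.frame hq ht.dual (τ a)
  let f : Fin 3 → ℝ := fun a => L.θ a q (τ a)
  have hdec : ∀ a, τ a = (x a : Tan n q) + f a • t a := fun a => by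
    conv_lhs => rw [Frame.eq_pr_add h.frame hq ht.dual (τ a), fin3_sum _ a, (hm a).1, (hm a).2]
    simp [x, f]
  have hrel : ∀ a, Frame.rot h.frame hq ht.dual a (τ (a + 1)) = τ (a + 2) := fun a => by
    have := (hm (a + 1)).2
    rw [(fin3_add a).2.1] at this
    rw [← h.ap_of_θ hq ht this, hτ.rel]
  have hx : ∀ a, I a q (x (a + 1)) = x (a + 2) := fun a => by
    simp only [x]
    rw [← Frame.pr_rot, hrel]
  have hf : ∀ a, f (a + 1) = f (a + 2) := fun a => by
    have := Frame.η_rot₂ h.frame hq ht.dual a (τ (a + 1))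
    rw [hrel] at this
    exact this.symm
  have hf' : ∀ a, f a = f 0 := fun a => by
    have h0 := hf 0
    have h1 := hf 1
    have h2 := hf 2
    fin_cases a
    · rfl
    · exact h2.symm
    · exact h1
  -- The relations `I_a τ_b = τ_c` say for the `Q`-parts that `I_a x_a` does not depend on `a`; up
  -- to the factor `-1 / f` it is the vector `r`.
  have hIx : ∀ a, I (a + 1) q (x (a + 1)) = I (a + 2) q (x (a + 2)) := fun a => by
    rw [← hx a, hh.mul₂]
  have hIx' : ∀ a, I a q (x a) = I 0 q (x 0) := fun a => by
    have h0 := hIx 0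
    have h1 := hIx 1
    have h2 := hIx 2
    fin_cases a
    · rfl
    · exact h2.symm
    · exact h1
  -- Otherwise the triple would lie in `Q` and could not span a complement.
  have hf0 : f 0 ≠ 0 := by
    intro h0
    have hsub : Submodule.span ℝ (range τ) ≤ L.Q q := by
      rw [Submodule.span_le]
      rintro _ ⟨a, rfl⟩
      rw [hdec a, hf' a, h0, zero_smul, add_zero, ← h.Q_eq hq]
      exact (x a).2
    have htop := hτ.transverse.sup_eq_top
    rw [sup_eq_left.2 hsub, ← h.Q_eq hq] at htop
    have h1 := Frame.η_Q h.frame hq 0 ⟨t 0, htop ▸ Submodule.mem_top⟩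
    have h2 := ht.dual 0 0
    simp only [if_true] at h2
    rw [h2] at h1
    exact one_ne_zero h1
  refine ⟨f 0, -((f 0)⁻¹ • I 0 q (x 0)), hf0, fun a => ?_⟩
  rw [hdec a, hf' a, add_comm]
  congr 1
  rw [← hIx' a, map_neg, map_smul, hh.sq, smul_neg, neg_neg, ← Submodule.coe_smul, smul_smul,
    mul_inv_cancel₀ hf0, one_smul]

/-- On `Q_a` the extension is `rot`, and `A_a τ_a = 0` forces `A_a t_a = r`. So the choice of the
triple only adds the term `θ_a ⊗ r`, with `r` independent of `a`. -/
theorem extension_apply (ht : Frame.IsReeb C L.θ q t) {f : ℝ} {r : C.Q q} (hf : f ≠ 0)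
    (hτ : ∀ a, τ a = f • t a + f • (I a q r : Tan n q)) {A : Fin 3 → Module.End ℝ (Tan n q)}
    (hA : L.IsExtension q τ A) (a : Fin 3) (v : Tan n q) :
    A a v = Frame.rot h.frame hq ht.dual a v + L.θ a q v • (r : Tan n q) := by
  have hh := Frame.isQuatHerm h.frame hq
  have hker : ∀ v, L.θ a q v = 0 → A a v = Frame.rot h.frame hq ht.dual a v := fun v hv => by
    rw [(hA a).1 v ((h.mem_D q hq a v).2 hv), h.ap_of_θ hq ht hv]
  have h1 : A a (t a) = r := by
    have h2 := (hA a).2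
    rw [hτ a, map_add, map_smul, map_smul, hker _ (Frame.η_Q h.frame hq a _), Frame.rot_Q, hh.sq,
      ← smul_add, smul_eq_zero] at h2
    have h3 := h2.resolve_left hf
    rw [Submodule.coe_neg, add_neg_eq_zero] at h3
    exact h3
  obtain ⟨-, -, -, h4, h5, -⟩ := fin3_ne a
  have h0 : L.θ a q (v - L.θ a q v • t a) = 0 := by
    rw [map_sub, map_smul, ht.dual]; simp
  rw [← sub_add_cancel v (L.θ a q v • t a), map_add, hker _ h0, map_smul, h1, map_add, map_smul,
    Frame.rot_t, if_neg h4, if_neg h5, sub_zero, smul_zero, map_add, h0, zero_add, map_smul,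
    ht.dual]
  simp

/-- `Q_v` is the kernel of `∑ v_a θ_a`, whichever admissible triple is used. -/
theorem mem_Qv (ht : Frame.IsReeb C L.θ q t) {f : ℝ} {r : C.Q q} (hf : f ≠ 0)
    (hτ : ∀ a, τ a = f • t a + f • (I a q r : Tan n q)) (v : Fin 3 → ℝ) (w : Tan n q) :
    w ∈ L.Qv q τ v ↔ ∑ a, v a * L.θ a q w = 0 := by
  have hθ : ∀ a (x : Fin 3 → ℝ), L.θ a q (∑ b, x b • τ b) = f * x a := by
    intro a x
    simp only [hτ, map_sum, map_smul, map_add, ht.dual a, Frame.η_Q h.frame hq, smul_eq_mul]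
    simp [mul_comm]
  rw [LocalData.Qv, ← h.Q_eq hq]
  constructor
  · intro hw
    obtain ⟨y, hy, z, hz, rfl⟩ := Submodule.mem_sup.1 hw
    have hz' : ∑ a, v a * L.θ a q z = 0 := by
      clear hw
      induction hz using Submodule.span_induction with
      | mem z hz =>
        obtain ⟨x, hx, rfl⟩ := hz
        simp only [hθ]
        rw [← mul_zero f, ← hx, dotProduct, Finset.mul_sum]
        exact Finset.sum_congr rfl fun a _ => by ring
      | zero => simp
      | add x y _ _ hx hy => simp only [map_add, mul_add, Finset.sum_add_distrib, hx, hy, add_zero]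
      | smul c x _ hx =>
        simp only [map_smul, smul_eq_mul]
        rw [← mul_zero c, ← hx, Finset.mul_sum]
        exact Finset.sum_congr rfl fun a _ => by ring
    simp only [map_add, Frame.η_Q h.frame hq _ ⟨y, hy⟩, zero_add, hz']
  · intro hw
    rw [← sub_add_cancel w (∑ a, (f⁻¹ * L.θ a q w) • τ a)]
    refine Submodule.add_mem_sup ?_ (Submodule.subset_span ⟨_, ?_, rfl⟩)
    · rw [h.frame.ker q hq]
      intro a
      rw [map_sub, hθ, mul_inv_cancel_left₀ hf, sub_self]
    · rw [← mul_zero f⁻¹, ← hw, dotProduct, Finset.mul_sum]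
      exact Finset.sum_congr rfl fun a _ => by ring

include h' hq'

/-- The extended complex structures rotate with the frame. -/
theorem rot_trans (hn : 2 ≤ n) (ht : Frame.IsReeb C L.θ q t) (ht' : Frame.IsReeb C L'.θ q t')
    (a : Fin 3) (w : Tan n q) : Frame.rot h'.frame hq' ht'.dual a w =
      ∑ b, trans L.θ L'.θ q t a b • Frame.rot h.frame hq ht.dual b w := by
  have hS := Frame.trans_mem h.frame h'.frame (by omega) hq hq' ht.dual
  have hη := Frame.trans_η h.frame h'.frame hq hq' ht.dual
  have hI := Frame.trans_I h.frame h'.frame hq hq' ht.dual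
  have htt : ∀ a, t' a = ∑ b, trans L.θ L'.θ q t a b • t b := fun a =>
    congrFun (Frame.reeb_unique h'.frame hq' ht'
      (Frame.isReeb_trans h.frame h'.frame hn hq hq' ht)) a
  set S := trans L.θ L'.θ q t with hSdef
  -- Both projections are along the same plane; in formulas, the columns of `S` are orthonormal.
  have hpr : Frame.pr h'.frame hq' ht'.dual w = Frame.pr h.frame hq ht.dual w := by
    ext1
    rw [Frame.pr_coe, Frame.pr_coe]
    congr 1
    have hcol : ∀ b d, ∑ a, S a b * S a d = if b = d then 1 else 0 := by
      intro b d
      rw [Matrix.mem_specialOrthogonalGroup_iff, Matrix.mem_orthogonalGroup_iff'] at hS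
      have h1 := congrFun (congrFun hS.1 b) d
      rw [Matrix.mul_apply, Matrix.one_apply] at h1
      simpa using h1
    have h00 := hcol 0 0
    have h01 := hcol 0 1
    have h02 := hcol 0 2
    have h11 := hcol 1 1
    have h12 := hcol 1 2
    have h22 := hcol 2 2
    simp only [Fin.sum_univ_three, Fin.isValue, if_true, show ((0 : Fin 3) = 1) = False by simp,
      show ((0 : Fin 3) = 2) = False by simp, show ((1 : Fin 3) = 2) = False by simp, if_false]
      at h00 h01 h02 h11 h12 h22
    simp only [hη, htt, Fin.sum_univ_three]
    linear_combination (norm := module) (L.θ 0 q w • h00 + L.θ 1 q w • h01 + L.θ 2 q w • h02) • t 0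
      + (L.θ 0 q w • h01 + L.θ 1 q w • h11 + L.θ 2 q w • h12) • t 1
      + (L.θ 0 q w • h02 + L.θ 1 q w • h12 + L.θ 2 q w • h22) • t 2
  rw [Frame.rot_apply, hpr, hI]
  simp only [Frame.rot_apply, hη, htt]
  -- The `t`-components of `rot a w` form a cross product with the vector `(θ_b w)`, and rotations
  -- are compatible with cross products.
  have hc := cofactor_of_mem hS a
  have c0 := hc 0
  have c1 := hc 1
  have c2 := hc 2
  simp only [Fin.isValue, zero_add, show (1 : Fin 3) + 1 = 2 from rfl,
    show (1 : Fin 3) + 2 = 0 from rfl, show (2 : Fin 3) + 1 = 0 from rfl,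
    show (2 : Fin 3) + 2 = 1 from rfl] at c0 c1 c2
  simp only [Fin.sum_univ_three, Submodule.coe_add, Submodule.coe_smul, Fin.isValue, zero_add,
    show (1 : Fin 3) + 1 = 2 from rfl, show (1 : Fin 3) + 2 = 0 from rfl,
    show (2 : Fin 3) + 1 = 0 from rfl, show (2 : Fin 3) + 2 = 1 from rfl]
  linear_combination (norm := module) (L.θ 1 q w • c0 - L.θ 0 q w • c1) • t 2
    + (L.θ 0 q w • c2 - L.θ 2 q w • c0) • t 1 + (L.θ 2 q w • c1 - L.θ 1 q w • c2) • t 0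

theorem gluesAt (hn : 2 ≤ n) (ht : Frame.IsReeb C L.θ q t) :
    GluesAt L L' q (trans L.θ L'.θ q t) := by
  have hη := Frame.trans_η h.frame h'.frame hq hq' ht.dual
  refine ⟨fun a => ?_, fun τ τ' hτ hτ' A A' hA hA' v _ => ?_⟩
  · ext v
    rw [hη]
    simp
  obtain ⟨t', ht'⟩ := Frame.exists_reeb h'.frame hq'
  obtain ⟨f, r, hf, hr⟩ := h.admissible_eq hq ht hτ
  obtain ⟨f', r', hf', hr'⟩ := h'.admissible_eq hq' ht' hτ'
  have hker : ∀ w, ∑ a, v a * L'.θ a q w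
      = ∑ a, ((trans L.θ L'.θ q t)ᵀ *ᵥ v) a * L.θ a q w := by
    intro w
    simp only [hη, Matrix.mulVec, dotProduct, Matrix.transpose_apply, Fin.sum_univ_three]
    ring
  refine ⟨?_, fun w hw => ?_⟩
  · ext w
    rw [h'.mem_Qv hq' ht' hf' hr', h.mem_Qv hq ht hf hr, hker]
  -- The terms with `r` and `r'` carry the factor `∑ v_a θ'_a(w)`, which vanishes on `Q_v`.
  · have hw := (h'.mem_Qv hq' ht' hf' hr' v w).1 hw
    have hw' := hw
    rw [hker] at hw'
    simp only [h.extension_apply hq ht hf hr hA, h'.extension_apply hq' ht' hf' hr' hA', smul_add,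
      Finset.sum_add_distrib, smul_smul, ← Finset.sum_smul, hw, hw', zero_smul, add_zero]
    simp only [h.rot_trans h' hq hq' hn ht ht', Matrix.mulVec, dotProduct, Matrix.transpose_apply,
      Fin.sum_univ_three]
    module

omit hq hq' in
theorem exists_glue (hn : 2 ≤ n) : ∃ S : M → Matrix (Fin 3) (Fin 3) ℝ,
    (∀ a b, ContMDiffOn 𝓘(ℝ, Mdl n) 𝓘(ℝ, ℝ) ∞ (fun q => S q a b) (L.U ∩ L'.U : Set M)) ∧
    ∀ q ∈ (L.U ∩ L'.U : Set M), S q ∈ Matrix.specialOrthogonalGroup (Fin 3) ℝ ∧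
      GluesAt L L' q (S q) := by
  classical
  choose t ht using fun (q : M) (hq : q ∈ L.U) => Frame.exists_reeb h.frame hq
  refine ⟨fun q => if hq : q ∈ L.U then trans L.θ L'.θ q (t q hq) else 1, fun a b q hq => ?_,
    fun q hq => ?_⟩
  · obtain ⟨V, hqV, hVU, R, hR⟩ := Frame.exists_reeb_field h.frame hq.1
    have h1 : SmoothFun n (fun p => L'.θ a p (R b p)) q :=
      (h'.frame.smooth_η a).smoothFun hq.2 ((hR q hqV).1 b)
    refine ContMDiffAt.contMDiffWithinAt (SmoothFun.congr h1 ?_)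
    filter_upwards [mem_eventually V hqV] with p hp
    -- By uniqueness the triples chosen point by point agree with a smooth local Reeb triple.
    rw [dif_pos (hVU hp), Frame.reeb_unique h.frame (hVU hp) (ht p (hVU hp)) (hR p hp).2]
    rfl
  · simp only [dif_pos (show q ∈ L.U from hq.1)]
    exact ⟨Frame.trans_mem h.frame h'.frame (by omega) hq.1 hq.2 (ht q hq.1).dual,
      h.gluesAt h' hq.1 hq.2 hn (ht q hq.1)⟩

end IsInduced

theorem isQuaternionicPseudohermitian_induced (hn : 2 ≤ n) (hP : C.IsReebField P) :
    IsQuaternionicPseudohermitian (C.induced P) C.Q C.γ where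
  covers q := by
    obtain ⟨U, hq, I, η, F⟩ := C.local_frame q
    obtain ⟨L, hL, rfl⟩ := Frame.exists_induced F hn hP
    exact ⟨L, hL, hq⟩
  almost L hL := (exists_isInduced hn hP hL).choose_spec.isAlmostHyperCR
  integrable L hL := (exists_isInduced hn hP hL).choose_spec.isIntegrable
  compatible L hL := (exists_isInduced hn hP hL).choose_spec.isCompatible
  glue L hL L' hL' := (exists_isInduced hn hP hL).choose_spec.exists_glue
    (exists_isInduced hn hP hL').choose_spec hn
  underlying L hL q hq := (exists_isInduced hn hP hL).choose_spec.Q_eq hq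
  levi L hL q hq a X Y := (exists_isInduced hn hP hL).choose_spec.levi hq a X Y
  pos := C.pos

theorem isUltraPseudoconvex_induced (hn : 2 ≤ n) (hP : C.IsReebField P) :
    IsUltraPseudoconvex (C.induced P) C.Q C.γ := fun _ hL _ hq X hX =>
  (exists_isInduced hn hP hL).choose_spec.isUltra hq X hX

theorem isAdmissible_reeb (hn : 2 ≤ n) (hP : C.IsReebField P) : IsAdmissible (C.induced P) P := by
  classical
  intro L hL
  obtain ⟨I, h⟩ := exists_isInduced hn hP hL
  choose t ht using fun (q : M) (hq : q ∈ L.U) => Frame.exists_reeb h.frame hq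
  refine ⟨fun a q => if hq : q ∈ L.U then t q hq a else 0, fun q hq => ?_⟩
  have htq : (fun a => if hq : q ∈ L.U then t q hq a else 0) = t q hq := by
    simp only [dif_pos hq]
  rw [htq]
  have hd := (ht q hq).dual
  refine ⟨fun a => ?_, ⟨?_, fun a => ⟨?_, ?_⟩, fun a => ?_⟩, hP.eq_span hn h.frame hq (ht q hq)⟩
  · obtain ⟨V, hqV, hVU, R, hR⟩ := Frame.exists_reeb_field h.frame hq
    refine SmoothAt.congr ((hR q hqV).1 a) ?_
    filter_upwards [mem_eventually V hqV] with p hp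
    rw [dif_pos (hVU hp), Frame.reeb_unique h.frame (hVU hp) (ht p (hVU hp)) (hR p hp).2]
  · rw [← h.Q_eq hq]
    constructor
    · rw [Submodule.disjoint_def]
      intro v hv hv'
      obtain ⟨c, rfl⟩ := (Submodule.mem_span_range_iff_exists_fun ℝ).1 hv'
      have hc : c = 0 := funext fun a => by
        rw [← hd.sum a c]
        exact Frame.η_Q h.frame hq a ⟨_, hv⟩
      simp [hc]
    · rw [codisjoint_iff, eq_top_iff]
      intro v _
      rw [Frame.eq_pr_add h.frame hq hd v]
      exact Submodule.add_mem_sup (Subtype.coe_prop _) (Submodule.sum_mem _ fun b _ =>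
        Submodule.smul_mem _ _ (Submodule.subset_span ⟨b, rfl⟩))
  · exact (h.mem_D q hq _ _).2 ((hd _ _).trans (by simp [(fin3_ne a).1]))
  · exact (h.mem_D q hq _ _).2 ((hd _ _).trans (by simp [(fin3_ne a).2.1]))
  · have h0 : L.θ a q (t q hq (a + 1)) = 0 := (hd _ _).trans (by simp [(fin3_ne a).2.2.2.1])
    rw [h.ap_of_θ hq (ht q hq) h0, Frame.rot_t]
    simp [(fin3_ne a).2.2.1]

end QCStructure

end Contact

/-! ## Connections adapted to an orthogonal splitting of the tangent bundle -/

section Splitting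

set_option linter.unusedSectionVars false

variable {n : ℕ} {M : Type*} [TopologicalSpace M] [ChartedSpace (Mdl n) M]
  [IsManifold 𝓘(ℝ, Mdl n) ∞ M] {K : Type*} [Fintype K] [DecidableEq K]

theorem br_sum_right {X : ∀ p : M, Tan n p} {ι : Type*} {s : Finset ι} {Y : ι → ∀ p : M, Tan n p}
    {q : M} (hY : ∀ i ∈ s, SmoothAt (Y i) q) :
    br X (fun p => ∑ i ∈ s, Y i p) q = ∑ i ∈ s, br X (Y i) q := by
  classical
  induction s using Finset.induction_on with
  | empty =>
    have h := br_smul_right (X := X) (Y := fun p : M => (0 : Tan n p)) (q := q) (f := fun _ => 0)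
      (smoothFun_const 0).diff smoothAt_zero.diffAt
    simpa [dirDeriv_const] using h
  | insert a s ha ih =>
    simp only [Finset.sum_insert ha]
    rw [br_add_right (hY a (by simp)).diffAt
      (SmoothAt.sum fun i hi => hY i (by simp [hi])).diffAt, ih fun i hi => hY i (by simp [hi])]

variable (n M) in
/-- A metric on the tangent bundle, with an orthogonal splitting into two subbundles. -/
structure SplitData where
  /-- the metric -/
  G : ∀ q : M, LinearMap.BilinForm ℝ (Tan n q)
  /-- the projections to the two subbundles -/
  pj : Bool → ∀ q : M, Tan n q →ₗ[ℝ] Tan n q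

namespace SplitData

variable (S : SplitData n M)

/-- Orthonormal frames adapted to the splitting, on an open set. -/
structure IsFrame (ty : K → Bool) (V : Opens M) (E : K → ∀ p : M, Tan n p) : Prop where
  smooth : ∀ p ∈ V, ∀ k, SmoothAt (E k) p
  orth : ∀ p ∈ V, ∀ j k, S.G p (E j p) (E k p) = if j = k then 1 else 0
  eq_sum : ∀ p ∈ V, ∀ v, v = ∑ k, S.G p v (E k p) • E k p
  type : ∀ k p, S.pj (ty k) p (E k p) = E k p

/-- The conditions on a metric and a splitting. -/
structure IsSplitting (ty : K → Bool) : Prop where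
  smooth_G : ∀ {q : M} {X Y : ∀ p : M, Tan n p}, SmoothAt X q → SmoothAt Y q →
    SmoothFun n (fun p => S.G p (X p) (Y p)) q
  symm : ∀ q u v, S.G q u v = S.G q v u
  orth : ∀ q s s' u v, s ≠ s' → S.G q (S.pj s q u) (S.pj s' q v) = 0
  frame : ∀ q : M, ∃ V : Opens M, q ∈ V ∧ ∃ E : K → ∀ p : M, Tan n p, S.IsFrame ty V E

/-- Sections of one of the two subbundles which are smooth at a point. -/
def Sec (s : Bool) (Y : ∀ p : M, Tan n p) (q : M) : Prop :=
  SmoothAt Y q ∧ ∀ p, S.pj s p (Y p) = Y p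

/-- The torsion of an operator `D`. -/
def tor {q : M} (D : (∀ p : M, Tan n p) → Tan n q →L[ℝ] Tan n q) (X Y : ∀ p : M, Tan n p) :
    Tan n q := D Y (X q) - D X (Y q) - br X Y q

/-- The conditions which characterize the connection associated with the splitting. -/
structure IsAssocAt (q : M) (D : (∀ p : M, Tan n p) → Tan n q →L[ℝ] Tan n q) : Prop where
  add : ∀ {Y Z : ∀ p : M, Tan n p}, DiffAt Y q → DiffAt Z q →
    D (fun p => Y p + Z p) = D Y + D Z
  leibniz : ∀ {Y : ∀ p : M, Tan n p} {f : M → ℝ}, DiffAt Y q → DiffFun n f q → ∀ v,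
    D (fun p => f p • Y p) v = f q • D Y v + dirDeriv f q v • Y q
  pres : ∀ {s Y}, S.Sec s Y q → ∀ v, S.pj s q (D Y v) = D Y v
  metric : ∀ {s Y Z}, S.Sec s Y q → S.Sec s Z q → ∀ v,
    dirDeriv (fun p => S.G p (Y p) (Z p)) q v = S.G q (D Y v) (Z q) + S.G q (Y q) (D Z v)
  tor_same : ∀ {s X Y Z}, S.Sec s X q → S.Sec s Y q → S.Sec s Z q → S.G q (tor D X Y) (Z q) = 0
  tor_mixed : ∀ {s s' V X Y}, s ≠ s' → S.Sec s' V q → S.Sec s X q → S.Sec s Y q →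
    S.G q (tor D V X) (Y q) = S.G q (X q) (tor D V Y)

variable {S} {ty : K → Bool} (hS : S.IsSplitting ty) {q : M} {V : Opens M}
  {E : K → ∀ p : M, Tan n p} (hE : S.IsFrame ty V E)

include hE in
theorem IsFrame.sec (hq : q ∈ V) (k : K) : S.Sec (ty k) (E k) q := ⟨hE.smooth q hq k, hE.type k⟩

include hS hE in
theorem IsFrame.orth_type (hq : q ∈ V) {s : Bool} {v : Tan n q} (hv : S.pj s q v = v) {k : K}
    (hk : ty k ≠ s) : S.G q v (E k q) = 0 := by
  rw [← hv, ← hE.type k q]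
  exact hS.orth q _ _ _ _ (Ne.symm hk)

include hS hE in
theorem IsFrame.ext (hq : q ∈ V) {u v : Tan n q} (h : ∀ k, S.G q u (E k q) = S.G q v (E k q)) :
    u = v := by
  rw [hE.eq_sum q hq u, hE.eq_sum q hq v]
  simp only [h]

include hS hE in
/-- The difference of two connections which satisfy the conditions vanishes on frames. -/
theorem IsAssocAt.frame_unique (hq : q ∈ V) {D D' : (∀ p : M, Tan n p) → Tan n q →L[ℝ] Tan n q}
    (hD : S.IsAssocAt q D) (hD' : S.IsAssocAt q D') (j : K) : D (E j) = D' (E j) := by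
  let A : K → K → K → ℝ := fun i j k => S.G q (D (E j) (E i q) - D' (E j) (E i q)) (E k q)
  have hsec := hE.sec hq
  have h1 : ∀ i j k, ty k ≠ ty j → A i j k = 0 := fun i j k hk =>
    hE.orth_type hS hq (s := ty j) (by rw [map_sub, hD.pres (hsec j), hD'.pres (hsec j)]) hk
  have h2 : ∀ i j k, A i j k = -A i k j := by
    intro i j k
    by_cases hjk : ty k = ty j
    · have hk := hjk ▸ hsec k
      have e := hD.metric (hsec j) hk (E i q)
      rw [hD'.metric (hsec j) hk (E i q), hS.symm q (E j q), hS.symm q (E j q)] at e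
      simp only [A, map_sub, LinearMap.sub_apply]
      linarith
    · rw [h1 i j k hjk, h1 i k j (Ne.symm hjk), neg_zero]
  have hA0 : ∀ i j k, S.G q (tor D (E i) (E j) - tor D' (E i) (E j)) (E k q) = A i j k - A j i k := by
    intro i j k
    simp only [A, tor, map_sub, LinearMap.sub_apply]
    ring
  -- The torsion condition within one subbundle makes the difference tensor symmetric in its first
  -- two slots.
  have h3 : ∀ i j k, ty i = ty j → A i j k = A j i k := by
    intro i j k hij
    by_cases hk : ty k = ty j
    · have e := hD.tor_same (hij ▸ hsec i) (hsec j) (hk ▸ hsec k)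
      have e' := hD'.tor_same (hij ▸ hsec i) (hsec j) (hk ▸ hsec k)
      rw [← sub_eq_zero, ← hA0, map_sub, LinearMap.sub_apply, e, e', sub_zero]
    · rw [h1 i j k hk, h1 j i k (hij ▸ hk)]
  -- The mixed torsion condition makes it symmetric in the last two slots, where `h2` says that it
  -- is skew.
  have h4 : ∀ i j k, ty j ≠ ty i → A i j k = A i k j := by
    intro i j k hij
    by_cases hk : ty k = ty j
    · have e := hD.tor_mixed hij (hsec i) (hsec j) (hk ▸ hsec k)
      have e' := hD'.tor_mixed hij (hsec i) (hsec j) (hk ▸ hsec k)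
      have a1 := hA0 i j k
      have a2 := hA0 i k j
      rw [h1 j i k (hk ▸ hij), map_sub, LinearMap.sub_apply] at a1
      rw [h1 k i j hij, map_sub, LinearMap.sub_apply] at a2
      rw [hS.symm q (E j q)] at e e'
      linarith
    · rw [h1 i j k hk, h1 i k j (Ne.symm hk)]
  have h5 : ∀ i j k, A i j k = 0 := by
    intro i j k
    by_cases hk : ty k = ty j
    · by_cases hij : ty i = ty j
      -- Symmetric in the first two slots and skew in the last two: the usual six-term argument
      -- gives zero.
      · have e1 := h3 i j k hij
        have e2 := h2 j i k
        have e3 := h3 j k i hk.symm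
        have e4 := h2 k j i
        have e5 := h3 k i j (hk.trans hij.symm)
        have e6 := h2 i k j
        linarith
      · have := h4 i j k (Ne.symm hij)
        have := h2 i j k
        linarith
    · exact h1 i j k hk
  ext v
  rw [hE.eq_sum q hq v, map_sum, map_sum]
  refine Finset.sum_congr rfl fun i _ => ?_
  rw [map_smul, map_smul]
  congr 1
  refine hE.ext hS hq fun k => ?_
  have := h5 i j k
  simp only [A, map_sub, LinearMap.sub_apply] at this
  linarith

include hS in
-- The difference of the two operators is tensorial in the field, so it is determined by its values
-- on a frame.
theorem IsAssocAt.unique {D D' : (∀ p : M, Tan n p) → Tan n q →L[ℝ] Tan n q}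
    (hD : S.IsAssocAt q D) (hD' : S.IsAssocAt q D') {Y : ∀ p : M, Tan n p} (hY : DiffAt Y q) :
    D Y = D' Y := by
  obtain ⟨V, hq, E, hE⟩ := hS.frame q
  have hT : TensorialAt 𝓘(ℝ, Mdl n) (Mdl n) (fun Y : ∀ p : M, Tan n p => D Y - D' Y) q := by
    constructor
    · intro f Z hf hZ
      ext v
      have e1 := hD.leibniz (Y := Z) hZ hf v
      have e2 := hD'.leibniz (Y := Z) hZ hf v
      change (D (fun p => f p • Z p) - D' (fun p => f p • Z p)) v = (f q • (D Z - D' Z)) v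
      simp only [ContinuousLinearMap.sub_apply, ContinuousLinearMap.smul_apply, e1, e2, smul_sub]
      abel
    · intro Z Z' hZ hZ'
      have e1 := hD.add (Y := Z) (Z := Z') hZ hZ'
      have e2 := hD'.add (Y := Z) (Z := Z') hZ hZ'
      change D (fun p => Z p + Z' p) - D' (fun p => Z p + Z' p) = _
      rw [e1, e2]
      abel
  have hs : ∀ k, SmoothAt (fun p => S.G q (Y q) (E k q) • E k p) q := fun k =>
    SmoothAt.smul (smoothFun_const _) (hE.smooth q hq k)
  have h1 := hT.pointwise (σ := Y) (σ' := fun p => ∑ k, S.G q (Y q) (E k q) • E k p) hY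
    (SmoothAt.diffAt (SmoothAt.sum fun k _ => hs k)) (hE.eq_sum q hq (Y q))
  have h2 := hT.sum (s := Finset.univ) (fun k p => S.G q (Y q) (E k q) • E k p)
    fun k _ => (hs k).diffAt
  rw [← sub_eq_zero]
  refine h1.trans (h2.trans (Finset.sum_eq_zero fun k _ => ?_))
  have h3 := hT.smul (f := fun _ => S.G q (Y q) (E k q)) (σ := E k) (smoothFun_const _).diff
    (hE.smooth q hq k).diffAt
  refine h3.trans ?_
  rw [hD.frame_unique hS hE hq hD', sub_self, smul_zero]

end SplitData

end Splitting

/-! ### Existence -/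

section Splitting

set_option linter.unusedSectionVars false

variable {n : ℕ} {M : Type*} [TopologicalSpace M] [ChartedSpace (Mdl n) M]
  [IsManifold 𝓘(ℝ, Mdl n) ∞ M] {K : Type*} [Fintype K] [DecidableEq K]

instance (q : M) : T2Space (Tan n q) := inferInstanceAs (T2Space (Mdl n))

theorem dirDeriv_sum_right {ι : Type*} (s : Finset ι) (f : M → ℝ) (q : M) (v : ι → Tan n q) :
    dirDeriv f q (∑ i ∈ s, v i) = ∑ i ∈ s, dirDeriv f q (v i) :=
  map_sum (mvfderiv 𝓘(ℝ, Mdl n) f q) _ _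

theorem sum_leibniz (a b a' b' A B : K → ℝ) (h : ∑ k, A k * b k = -∑ k, a k * B k) :
    ∑ k, (a k * b' k + b k * a' k) = ∑ k, (a' k + A k) * b k + ∑ k, a k * (b' k + B k) := by
  simp only [add_mul, mul_add, Finset.sum_add_distrib, h, mul_comm (b _)]
  ring

namespace SplitData

variable (S : SplitData n M) (ty : K → Bool)

/-- The structure coefficients of a frame. -/
def coeff (E : K → ∀ p : M, Tan n p) (i j k : K) (q : M) : ℝ := S.G q (br (E i) (E j) q) (E k q)

/-- The connection coefficients in a frame. -/
def chris (E : K → ∀ p : M, Tan n p) (i j k : K) (q : M) : ℝ :=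
  -- With three equal types this is the Koszul formula. If the direction `i` is of the other type,
  -- only the part of the structure coefficient that is skew in `j, k` is kept, so that the torsion
  -- is its symmetric part up to sign.
  if ty j = ty k then (S.coeff E i j k q - S.coeff E i k j q
    - if ty i = ty j then S.coeff E j k i q else 0) / 2 else 0

/-- The components of the covariant derivative in a frame. -/
def comp (E : K → ∀ p : M, Tan n p) (q : M) (Y : ∀ p : M, Tan n p) (v : Tan n q) (k : K) : ℝ :=
  dirDeriv (fun p => S.G p (Y p) (E k p)) q v
    + ∑ j, S.G q (Y q) (E j q) * ∑ i, S.G q v (E i q) * S.chris ty E i j k q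

/-- The covariant derivative defined by a frame. -/
def cov (E : K → ∀ p : M, Tan n p) (q : M) (Y : ∀ p : M, Tan n p) : Tan n q →L[ℝ] Tan n q :=
  LinearMap.toContinuousLinearMap
    { toFun := fun v => ∑ k, S.comp ty E q Y v k • E k q
      map_add' := fun v w => by
        simp only [comp, dirDeriv_add_right, map_add, LinearMap.add_apply, add_mul,
          Finset.sum_add_distrib, mul_add, add_smul]
        abel
      map_smul' := fun c v => by
        rw [RingHom.id_apply, Finset.smul_sum]
        refine Finset.sum_congr rfl fun k _ => ?_
        rw [smul_smul]
        congr 1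
        simp only [comp, dirDeriv_smul_right, map_smul, LinearMap.smul_apply, smul_eq_mul,
          Finset.mul_sum, mul_add]
        congr 1
        refine Finset.sum_congr rfl fun j _ => Finset.sum_congr rfl fun i _ => by ring }

theorem cov_apply (E : K → ∀ p : M, Tan n p) (q : M) (Y : ∀ p : M, Tan n p) (v : Tan n q) :
    S.cov ty E q Y v = ∑ k, S.comp ty E q Y v k • E k q := rfl

variable {S} {ty} (hS : S.IsSplitting ty) {q : M} {V : Opens M}
  {E : K → ∀ p : M, Tan n p} (hE : S.IsFrame ty V E)

include hE

theorem G_sum (hq : q ∈ V) (c : K → ℝ) (k : K) : S.G q (∑ j, c j • E j q) (E k q) = c k := by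
  simp only [map_sum, map_smul, LinearMap.sum_apply, LinearMap.smul_apply, hE.orth q hq, smul_eq_mul]
  simp

theorem G_eq_sum (hq : q ∈ V) (u v : Tan n q) :
    S.G q u v = ∑ k, S.G q u (E k q) * S.G q v (E k q) := by
  conv_lhs => rw [hE.eq_sum q hq v]
  simp only [map_sum, map_smul, smul_eq_mul, mul_comm]

theorem G_cov (hq : q ∈ V) (Y : ∀ p : M, Tan n p) (v : Tan n q) (k : K) :
    S.G q (S.cov ty E q Y v) (E k q) = S.comp ty E q Y v k := by
  rw [cov_apply, G_sum hE hq]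

theorem chris_skew (i j k : K) : S.chris ty E i j k q = -S.chris ty E i k j q := by
  have h : S.coeff E k j i q = -S.coeff E j k i q := by
    rw [coeff, br_swap, map_neg, LinearMap.neg_apply]; rfl
  rw [chris, chris]
  by_cases hjk : ty j = ty k
  · rw [if_pos hjk, if_pos hjk.symm, hjk, h]
    split_ifs <;> ring
  · rw [if_neg hjk, if_neg (Ne.symm hjk), neg_zero]

include hS

theorem diffFun_coord (hq : q ∈ V) {Y : ∀ p : M, Tan n p} (hY : DiffAt Y q) (k : K) :
    DiffFun n (fun p => S.G p (Y p) (E k p)) q :=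
  diffFun_of_smoothFun (κ := fun p => (S.G p).flip (E k p))
    (fun _ hX => hS.smooth_G hX (hE.smooth q hq k)) hY

theorem cov_add (hq : q ∈ V) {Y Z : ∀ p : M, Tan n p} (hY : DiffAt Y q) (hZ : DiffAt Z q) :
    S.cov ty E q (fun p => Y p + Z p) = S.cov ty E q Y + S.cov ty E q Z := by
  ext v
  rw [ContinuousLinearMap.add_apply]
  refine hE.ext hS hq fun k => ?_
  rw [map_add, LinearMap.add_apply, G_cov hE hq, G_cov hE hq, G_cov hE hq]
  simp only [comp, map_add, LinearMap.add_apply]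
  rw [dirDeriv_add (diffFun_coord hS hE hq hY k) (diffFun_coord hS hE hq hZ k)]
  simp only [add_mul, Finset.sum_add_distrib]
  ring

theorem cov_leibniz (hq : q ∈ V) {Y : ∀ p : M, Tan n p} {f : M → ℝ} (hY : DiffAt Y q)
    (hf : DiffFun n f q) (v : Tan n q) : S.cov ty E q (fun p => f p • Y p) v
      = f q • S.cov ty E q Y v + dirDeriv f q v • Y q := by
  refine hE.ext hS hq fun k => ?_
  rw [map_add, map_smul, map_smul, LinearMap.add_apply, LinearMap.smul_apply, LinearMap.smul_apply,
    G_cov hE hq, G_cov hE hq]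
  simp only [comp, map_smul, LinearMap.smul_apply, smul_eq_mul]
  rw [dirDeriv_mul hf (diffFun_coord hS hE hq hY k)]
  simp only [mul_assoc, ← Finset.mul_sum]
  ring

theorem coord_eq_zero {s : Bool} {Y : ∀ p : M, Tan n p} (hY : S.Sec s Y q) {k : K}
    (hk : ty k ≠ s) : ∀ p ∈ V, S.G p (Y p) (E k p) = 0 := fun p hp =>
  hE.orth_type hS hp (hY.2 p) hk

theorem cov_comp_eq_zero (hq : q ∈ V) {s : Bool} {Y : ∀ p : M, Tan n p} (hY : S.Sec s Y q)
    {k : K} (hk : ty k ≠ s) (v : Tan n q) : S.comp ty E q Y v k = 0 := by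
  rw [comp, dirDeriv_congr (g := fun _ => 0) ((mem_eventually V hq).mono fun p hp =>
    coord_eq_zero hS hE hY hk p hp), dirDeriv_const, zero_add]
  refine Finset.sum_eq_zero fun j _ => ?_
  by_cases hj : ty j = s
  · have : ∀ i, S.chris ty E i j k q = 0 := fun i => by rw [chris, if_neg (hj ▸ Ne.symm hk)]
    simp [this]
  · rw [coord_eq_zero hS hE hY hj q hq, zero_mul]

theorem cov_pres (hq : q ∈ V) {s : Bool} {Y : ∀ p : M, Tan n p} (hY : S.Sec s Y q)
    (v : Tan n q) : S.pj s q (S.cov ty E q Y v) = S.cov ty E q Y v := by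
  rw [cov_apply, map_sum]
  refine Finset.sum_congr rfl fun k _ => ?_
  rw [map_smul]
  by_cases hk : ty k = s
  · rw [← hk, hE.type]
  · rw [cov_comp_eq_zero hS hE hq hY hk, zero_smul, zero_smul]

theorem cov_metric (hq : q ∈ V) {Y Z : ∀ p : M, Tan n p} (hY : SmoothAt Y q)
    (hZ : SmoothAt Z q) (v : Tan n q) : dirDeriv (fun p => S.G p (Y p) (Z p)) q v
      = S.G q (S.cov ty E q Y v) (Z q) + S.G q (Y q) (S.cov ty E q Z v) := by
  have hy := fun k => diffFun_coord hS hE hq hY.diffAt k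
  have hz := fun k => diffFun_coord hS hE hq hZ.diffAt k
  rw [dirDeriv_congr (g := fun p => ∑ k, S.G p (Y p) (E k p) * S.G p (Z p) (E k p))
    ((mem_eventually V hq).mono fun p hp => G_eq_sum hE hp _ _),
    dirDeriv_sum fun k _ => (hy k).mul (hz k), G_eq_sum hE hq (S.cov ty E q Y v),
    G_eq_sum hE hq (Y q)]
  simp only [G_cov hE hq, comp]
  simp only [fun k => dirDeriv_mul (hy k) (hz k) v]
  refine sum_leibniz _ _ _ _ _ _ ?_
  simp only [Finset.sum_mul, Finset.mul_sum, ← Finset.sum_neg_distrib]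
  rw [Finset.sum_comm]
  refine Finset.sum_congr rfl fun k _ => Finset.sum_congr rfl fun j _ =>
    Finset.sum_congr rfl fun i _ => ?_
  rw [chris_skew hE]
  ring

theorem br_eq_sum (hq : q ∈ V) {X Y : ∀ p : M, Tan n p} (hX : SmoothAt X q) (hY : SmoothAt Y q) :
    br X Y q = ∑ j, dirDeriv (fun p => S.G p (Y p) (E j p)) q (X q) • E j q
      - ∑ j, dirDeriv (fun p => S.G p (X p) (E j p)) q (Y q) • E j q
      + ∑ j, ∑ i, (S.G q (Y q) (E j q) * S.G q (X q) (E i q)) • br (E i) (E j) q := by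
  have hEs := hE.smooth q hq
  have key : ∀ X Y : ∀ p : M, Tan n p, SmoothAt X q → SmoothAt Y q → br X Y q =
      ∑ j, dirDeriv (fun p => S.G p (Y p) (E j p)) q (X q) • E j q
      + ∑ j, S.G q (Y q) (E j q) • br X (E j) q := by
    intro X Y hX hY
    rw [br_congr (Y' := fun p => ∑ j, S.G p (Y p) (E j p) • E j p) (Eventually.of_forall fun _ => rfl)
      ((mem_eventually V hq).mono fun p hp => hE.eq_sum p hp (Y p)),
      br_sum_right fun j _ => SmoothAt.smul (hS.smooth_G hY (hEs j)) (hEs j),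
      ← Finset.sum_add_distrib]
    exact Finset.sum_congr rfl fun j _ =>
      br_smul_right (hS.smooth_G hY (hEs j)).diff (hEs j).diffAt
  have h2 : ∀ j, br X (E j) q = -(∑ i, dirDeriv (fun p => S.G p (X p) (E i p)) q (E j q) • E i q)
      + ∑ i, S.G q (X q) (E i q) • br (E i) (E j) q := by
    intro j
    rw [br_swap, key (E j) X (hEs j) hX, neg_add, ← Finset.sum_neg_distrib (f := fun i =>
      S.G q (X q) (E i q) • br (E j) (E i) q)]
    congr 1
    refine Finset.sum_congr rfl fun i _ => ?_
    rw [br_swap, smul_neg, neg_neg]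
  have h3 : ∑ j, dirDeriv (fun p => S.G p (X p) (E j p)) q (Y q) • E j q
      = ∑ j, S.G q (Y q) (E j q) • ∑ i, dirDeriv (fun p => S.G p (X p) (E i p)) q (E j q) • E i q := by
    simp only [Finset.smul_sum, smul_smul]
    rw [Finset.sum_comm]
    refine Finset.sum_congr rfl fun i _ => ?_
    rw [← Finset.sum_smul]
    conv_lhs => rw [hE.eq_sum q hq (Y q), dirDeriv_sum_right]
    simp only [dirDeriv_smul_right]
  rw [key X Y hX hY, h3]
  simp only [h2, smul_add, Finset.sum_add_distrib, smul_neg, Finset.sum_neg_distrib,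
    Finset.smul_sum, smul_smul]
  abel

/-- The derivatives of the components of `X` and `Y` cancel against those in the bracket, so the
torsion is expressed by the coefficients in the frame. -/
theorem G_tor (hq : q ∈ V) {X Y : ∀ p : M, Tan n p} (hX : SmoothAt X q) (hY : SmoothAt Y q) (k : K) :
    S.G q (tor (S.cov ty E q) X Y) (E k q) = ∑ j, ∑ i, S.G q (Y q) (E j q) * S.G q (X q) (E i q) *
      (S.chris ty E i j k q - S.chris ty E j i k q - S.coeff E i j k q) := by
  rw [tor, br_eq_sum hS hE hq hX hY]
  have hc : ∀ i j, S.G q (br (E i) (E j) q) (E k q) = S.coeff E i j k q := fun _ _ => rfl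
  simp only [map_sub, map_add, LinearMap.sub_apply, LinearMap.add_apply, G_sum hE hq, G_cov hE hq,
    comp]
  simp only [map_sum, map_smul, LinearMap.sum_apply, LinearMap.smul_apply, smul_eq_mul,
    hc, Finset.mul_sum, mul_sub, Finset.sum_sub_distrib]
  have h : ∑ j, ∑ i, S.G q (X q) (E j q) * (S.G q (Y q) (E i q) * S.chris ty E i j k q)
      = ∑ j, ∑ i, S.G q (Y q) (E j q) * S.G q (X q) (E i q) * S.chris ty E j i k q := by
    rw [Finset.sum_comm]
    refine Finset.sum_congr rfl fun i _ => Finset.sum_congr rfl fun j _ => by ring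
  rw [h]
  simp only [mul_assoc]
  ring

theorem cov_isAssocAt (hq : q ∈ V) : S.IsAssocAt q (S.cov ty E q) where
  add hY hZ := cov_add hS hE hq hY hZ
  leibniz hY hf v := cov_leibniz hS hE hq hY hf v
  pres hY v := cov_pres hS hE hq hY v
  metric hY hZ v := cov_metric hS hE hq hY.1 hZ.1 v
  tor_same {s X Y Z} hX hY hZ := by
    rw [G_eq_sum hE hq]
    refine Finset.sum_eq_zero fun k _ => ?_
    by_cases hk : ty k = s
    · rw [G_tor hS hE hq hX.1 hY.1]
      refine mul_eq_zero_of_left (Finset.sum_eq_zero fun j _ => Finset.sum_eq_zero fun i _ => ?_) _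
      by_cases hj : ty j = s
      · by_cases hi : ty i = s
        · have h1 : S.coeff E j i k q = -S.coeff E i j k q := by
            rw [coeff, br_swap, map_neg, LinearMap.neg_apply]; rfl
          simp only [chris, hi, hj, hk, if_true]
          rw [h1]
          ring
        · rw [coord_eq_zero hS hE hX hi q hq]; ring
      · rw [coord_eq_zero hS hE hY hj q hq]; ring
    · rw [coord_eq_zero hS hE hZ hk q hq, mul_zero]
  tor_mixed {s s' A X Y} hs hA hX hY := by
    have hτ : ∀ i j k, ty i ≠ s → ty j = s → ty k = s →
        S.chris ty E i j k q - S.chris ty E j i k q - S.coeff E i j k q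
          = -(S.coeff E i j k q + S.coeff E i k j q) / 2 := by
      intro i j k hi hj hk
      simp only [chris, hj, hk, if_true, if_neg hi]
      ring
    rw [hS.symm q (X q), G_eq_sum hE hq (tor _ A X), G_eq_sum hE hq (tor _ A Y)]
    simp only [G_tor hS hE hq hA.1 hX.1, G_tor hS hE hq hA.1 hY.1, Finset.sum_mul]
    rw [Finset.sum_comm]
    refine Finset.sum_congr rfl fun j _ => Finset.sum_congr rfl fun k _ =>
      Finset.sum_congr rfl fun i _ => ?_
    by_cases hj : ty j = s
    · by_cases hk : ty k = s
      · by_cases hi : ty i = s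
        · rw [coord_eq_zero hS hE hA (hi ▸ hs) q hq]; ring
        · rw [hτ i j k hi hj hk, hτ i k j hi hk hj]; ring
      · rw [coord_eq_zero hS hE hY hk q hq]; ring
    · rw [coord_eq_zero hS hE hX hj q hq]; ring

theorem smoothFun_coeff (hq : q ∈ V) (i j k : K) : SmoothFun n (S.coeff E i j k) q :=
  hS.smooth_G ((hE.smooth q hq i).br (hE.smooth q hq j)) (hE.smooth q hq k)

theorem smoothFun_chris (hq : q ∈ V) (i j k : K) : SmoothFun n (S.chris ty E i j k) q := by
  have h := smoothFun_coeff hS hE hq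
  unfold chris
  split_ifs
  · exact SmoothFun.mul (f := fun p => S.coeff E i j k p - S.coeff E i k j p - S.coeff E j k i p)
      (((h i j k).sub (h i k j)).sub (h j k i)) (smoothFun_const 2⁻¹)
  · exact SmoothFun.mul (f := fun p => S.coeff E i j k p - S.coeff E i k j p - 0)
      (((h i j k).sub (h i k j)).sub (smoothFun_const 0)) (smoothFun_const 2⁻¹)
  · exact smoothFun_const 0

theorem smoothAt_cov (hq : q ∈ V) {X Y : ∀ p : M, Tan n p} (hX : SmoothAt X q) (hY : SmoothAt Y q) :
    SmoothAt (fun p => S.cov ty E p Y (X p)) q := by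
  have hEs := hE.smooth q hq
  refine SmoothAt.sum fun k _ => SmoothAt.smul ?_ (hEs k)
  refine SmoothFun.add ((hS.smooth_G hY (hEs k)).dirDeriv hX) (SmoothFun.sum fun j _ =>
    SmoothFun.mul (hS.smooth_G hY (hEs j)) (SmoothFun.sum fun i _ =>
      SmoothFun.mul (hS.smooth_G hX (hEs i)) (smoothFun_chris hS hE hq i j k)))

omit hE in
/-- The connection associated with a splitting exists. -/
theorem exists_connection : ∃ D : Connection n M, CovariantDerivative.ContMDiffCovariantDerivative D ∞ ∧
    ∀ q, S.IsAssocAt q fun Y => D Y q := by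
  choose V hV E hE using hS.frame
  have hA := fun q => cov_isAssocAt hS (hE q) (hV q)
  refine ⟨⟨fun Y q => S.cov ty (E q) q Y, ⟨fun {Y Z q} hY hZ _ => (hA q).add hY hZ,
    fun {Y f q} hY hf _ => ?_⟩⟩, ⟨⟨fun {Y} hY q _ => ?_⟩⟩, hA⟩
  · ext v
    exact (hA q).leibniz hY hf v
  · have hY' : ∀ p, SmoothAt Y p := fun p => (hY p trivial).contMDiffAt univ_mem
    refine ContMDiffAt.contMDiffWithinAt (contMDiffAt_hom_of_smoothAt fun X hX => ?_)
    -- The operator at each point is defined by a frame chosen at that point. By uniqueness it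
    -- agrees near `q` with the one of the frame chosen at `q`, which depends smoothly on the point.
    refine SmoothAt.congr (smoothAt_cov hS (hE q) (hV q) hX (hY' q)) ?_
    filter_upwards [mem_eventually (V q) (hV q)] with p hp
    rw [(hA p).unique hS (cov_isAssocAt hS (hE q) hp) (hY' p).diffAt]

end SplitData

end Splitting

/-! ## The splitting defined by a contact structure and the Reeb field -/

section Contact

set_option linter.unusedSectionVars false

variable {n : ℕ} {M : Type*} [TopologicalSpace M] [ChartedSpace (Mdl n) M]
  [IsManifold 𝓘(ℝ, Mdl n) ∞ M]

namespace QCStructure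

theorem exists_forms (C : QCStructure n M) (q : M) : ∃ η : Fin 3 → ∀ q : M, Tan n q →L[ℝ] ℝ,
    ∃ U : Opens M, q ∈ U ∧ ∃ I, C.Frame U I η := by
  obtain ⟨U, hq, I, η, (F : C.Frame U I η)⟩ := C.local_frame q
  exact ⟨η, U, hq, I, F⟩

/-- The form `η₁² + η₂² + η₃²`, which does not depend on the contact frame. -/
def perp (C : QCStructure n M) (q : M) : LinearMap.BilinForm ℝ (Tan n q) :=
  ∑ a, (LinearMap.mul ℝ ℝ).compl₁₂ ((C.exists_forms q).choose a q : Tan n q →ₗ[ℝ] ℝ)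
    ((C.exists_forms q).choose a q : Tan n q →ₗ[ℝ] ℝ)

variable {C : QCStructure n M}

/-- The contact frame in the definition of `perp` is chosen separately at each point; transition
matrices are orthogonal, so any frame gives the same sum of squares. -/
theorem Frame.perp_eq {U : Opens M} {I : Fin 3 → ∀ q : M, Module.End ℝ (C.Q q)}
    {η : Fin 3 → ∀ q : M, Tan n q →L[ℝ] ℝ} (F : C.Frame U I η) (hn : 0 < n) {q : M} (hq : q ∈ U)
    (u v : Tan n q) : C.perp q u v = ∑ a, η a q u * η a q v := by
  obtain ⟨U', hq', I', F'⟩ := (C.exists_forms q).choose_spec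
  obtain ⟨t, ht⟩ := F'.exists_reeb hq'
  have hη := F'.trans_η F hq' hq ht.dual
  have hS := F'.trans_mem F hn hq' hq ht.dual
  simp only [perp, LinearMap.sum_apply, LinearMap.compl₁₂_apply, LinearMap.mul_apply',
    ContinuousLinearMap.coe_coe]
  set S := trans _ η q t
  have hcol : ∀ b d, ∑ a, S a b * S a d = if b = d then 1 else 0 := by
    intro b d
    rw [Matrix.mem_specialOrthogonalGroup_iff, Matrix.mem_orthogonalGroup_iff'] at hS
    have h1 := congrFun (congrFun hS.1 b) d
    rw [Matrix.mul_apply, Matrix.one_apply] at h1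
    simpa using h1
  set ζ := (C.exists_forms q).choose
  have e : ∀ a, η a q u * η a q v = ∑ b, ∑ d, (S a b * S a d) * (ζ b q u * ζ d q v) := by
    intro a
    rw [hη, hη, Finset.sum_mul_sum]
    exact Finset.sum_congr rfl fun b _ => Finset.sum_congr rfl fun d _ => by ring
  simp only [e]
  rw [Finset.sum_comm]
  refine Finset.sum_congr rfl fun b _ => ?_
  rw [Finset.sum_comm]
  simp only [← Finset.sum_mul, hcol]
  simp

theorem perp_symm (C : QCStructure n M) (q : M) (u v : Tan n q) : C.perp q u v = C.perp q v u := by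
  simp only [perp, LinearMap.sum_apply, LinearMap.compl₁₂_apply, LinearMap.mul_apply']
  exact Finset.sum_congr rfl fun a _ => mul_comm _ _

theorem perp_Q (C : QCStructure n M) (q : M) (x : C.Q q) (v : Tan n q) : C.perp q x v = 0 := by
  obtain ⟨U', hq', I', F'⟩ := (C.exists_forms q).choose_spec
  simp [perp, LinearMap.sum_apply, F'.η_Q hq']

variable {P : ∀ q : M, Submodule ℝ (Tan n q)}

/-- The metric `γ + η₁² + η₂² + η₃²` and the splitting `TM = Q ⊕ P`. -/
def splitData (hc : ∀ q, IsCompl (C.Q q) (P q)) : SplitData n M where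
  G q := (C.γ q).compl₁₂ ((C.Q q).projectionOnto (P q) (hc q))
    ((C.Q q).projectionOnto (P q) (hc q)) + C.perp q
  pj
    | false, q => (C.Q q).projection (P q) (hc q)
    | true, q => (P q).projection (C.Q q) (hc q).symm

section

variable (hc : ∀ q, IsCompl (C.Q q) (P q)) {q : M}

theorem G_apply (u v : Tan n q) : (C.splitData hc).G q u v =
    C.γ q ((C.Q q).projectionOnto (P q) (hc q) u) ((C.Q q).projectionOnto (P q) (hc q) v)
      + C.perp q u v := rfl

theorem pj_false_iff (v : Tan n q) : (C.splitData hc).pj false q v = v ↔ v ∈ C.Q q :=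
  ⟨fun h => h ▸ Subtype.coe_prop _, fun h =>
    congrArg Subtype.val (Submodule.projectionOnto_apply_of_mem_left (hc q) h)⟩

theorem pj_true_iff (v : Tan n q) : (C.splitData hc).pj true q v = v ↔ v ∈ P q :=
  ⟨fun h => h ▸ Subtype.coe_prop _, fun h =>
    congrArg Subtype.val (Submodule.projectionOnto_apply_of_mem_left (hc q).symm h)⟩

theorem pj_mem_false (v : Tan n q) : (C.splitData hc).pj false q v ∈ C.Q q := Subtype.coe_prop _

theorem pj_mem_true (v : Tan n q) : (C.splitData hc).pj true q v ∈ P q := Subtype.coe_prop _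

theorem pj_idem (s : Bool) (v : Tan n q) :
    (C.splitData hc).pj s q ((C.splitData hc).pj s q v) = (C.splitData hc).pj s q v := by
  cases s
  · exact (pj_false_iff hc _).2 (pj_mem_false hc v)
  · exact (pj_true_iff hc _).2 (pj_mem_true hc v)

theorem G_symm (u v : Tan n q) :
    (C.splitData hc).G q u v = (C.splitData hc).G q v u := by
  rw [G_apply, G_apply, C.symm, perp_symm]

theorem G_Q (u : Tan n q) (x : C.Q q) : (C.splitData hc).G q u x =
    C.γ q ((C.Q q).projectionOnto (P q) (hc q) u) x := by
  rw [G_apply, perp_symm, perp_Q, add_zero, Submodule.projectionOnto_apply_left]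

theorem G_Q_Q (x y : C.Q q) : (C.splitData hc).G q x y = C.γ q x y := by
  rw [G_Q, Submodule.projectionOnto_apply_left]

theorem G_P (u : Tan n q) (v : P q) : (C.splitData hc).G q u v = C.perp q u v := by
  rw [G_apply, Submodule.projectionOnto_apply_right, map_zero, zero_add]

theorem perp_projectionOnto (u v : Tan n q) :
    C.perp q ((P q).projectionOnto (C.Q q) (hc q).symm u : Tan n q) v = C.perp q u v := by
  have h := Submodule.projection_add_projection_eq_self (hc q) u
  conv_rhs => rw [← h, map_add, LinearMap.add_apply]
  rw [show (C.Q q).projection (P q) (hc q) u = ((C.Q q).projectionOnto (P q) (hc q) u : Tan n q) from rfl,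
    perp_Q, zero_add]
  rfl

theorem sec_false_iff {Y : ∀ p : M, Tan n p} :
    (C.splitData hc).Sec false Y q ↔ SmoothAt Y q ∧ ∀ p, Y p ∈ C.Q p :=
  and_congr_right fun _ => forall_congr' fun _ => pj_false_iff hc _

theorem sec_true_iff {Y : ∀ p : M, Tan n p} :
    (C.splitData hc).Sec true Y q ↔ SmoothAt Y q ∧ ∀ p, Y p ∈ P p :=
  and_congr_right fun _ => forall_congr' fun _ => pj_true_iff hc _

theorem projectionOnto_coe {η : Fin 3 → ∀ q : M, Tan n q →L[ℝ] ℝ} {U : Opens M}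
    {I : Fin 3 → ∀ q : M, Module.End ℝ (C.Q q)} (F : C.Frame U I η) (hq : q ∈ U)
    {t : Fin 3 → Tan n q} (ht : IsDual η q t) (hP : ∀ a, t a ∈ P q) (v : Tan n q) :
    ((C.Q q).projectionOnto (P q) (hc q) v : Tan n q) = v - ∑ a, η a q v • t a := by
  have h := F.eq_pr_add hq ht v
  have h0 : (C.Q q).projectionOnto (P q) (hc q) (∑ a, η a q v • t a) = 0 :=
    Submodule.projectionOnto_apply_of_mem_right (hc q)
      (Submodule.sum_mem _ fun a _ => Submodule.smul_mem _ _ (hP a))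
  conv_lhs => rw [h, map_add, Submodule.projectionOnto_apply_left, h0, add_zero]
  rw [F.pr_coe]

end

theorem isCompl_of_dual {η : Fin 3 → ∀ q : M, Tan n q →L[ℝ] ℝ} {U : Opens M} {q : M}
    {I : Fin 3 → ∀ q : M, Module.End ℝ (C.Q q)} (F : C.Frame U I η) (hq : q ∈ U)
    {t : Fin 3 → Tan n q} (ht : IsDual η q t) : IsCompl (C.Q q) (Submodule.span ℝ (range t)) := by
  constructor
  · rw [Submodule.disjoint_def]
    intro v hv hv'
    obtain ⟨c, rfl⟩ := (Submodule.mem_span_range_iff_exists_fun ℝ).1 hv'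
    refine Finset.sum_eq_zero fun a _ => ?_
    rw [← ht.sum a c, F.η_Q hq a ⟨_, hv⟩, zero_smul]
  · rw [codisjoint_iff, eq_top_iff]
    intro v _
    rw [F.eq_pr_add hq ht v]
    exact add_mem (Submodule.mem_sup_left (Subtype.coe_prop _)) (Submodule.mem_sup_right
      (Submodule.sum_mem _ fun a _ => Submodule.smul_mem _ _ (Submodule.subset_span ⟨a, rfl⟩)))

theorem IsReebField.isCompl (hn : 2 ≤ n) (hP : C.IsReebField P) (q : M) :
    IsCompl (C.Q q) (P q) := by
  obtain ⟨U, hq, I, η, (F : C.Frame U I η)⟩ := C.local_frame q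
  obtain ⟨t, ht⟩ := F.exists_reeb hq
  rw [hP.eq_span hn F hq ht]
  exact isCompl_of_dual F hq ht.dual

/-! ### Regularity of the splitting defined by the Reeb field -/

section Reeb

variable (hn : 2 ≤ n) (hP : C.IsReebField P) (hc : ∀ q, IsCompl (C.Q q) (P q)) {q : M}

include hn hP

theorem smoothAt_pj (s : Bool) {X : ∀ p : M, Tan n p} (hX : SmoothAt X q) :
    SmoothAt (fun p => (C.splitData hc).pj s p (X p)) q := by
  obtain ⟨U, hq, I, η, (F : C.Frame U I η)⟩ := C.local_frame q
  obtain ⟨V, hqV, hVU, R, hR⟩ := F.exists_reeb_field hq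
  have hmem : ∀ p ∈ V, ∀ a, R a p ∈ P p := fun p hp a => by
    rw [hP.eq_span hn F (hVU hp) (hR p hp).2]
    exact Submodule.subset_span ⟨a, rfl⟩
  have h0 : SmoothAt (fun p => (C.splitData hc).pj false p (X p)) q := by
    refine SmoothAt.congr (hX.sub (SmoothAt.sum (s := Finset.univ) fun a _ => SmoothAt.smul
      ((F.smooth_η a).smoothFun hq hX) ((hR q hqV).1 a))) ?_
    filter_upwards [mem_eventually V hqV] with p hp
    exact projectionOnto_coe hc F (hVU hp) (hR p hp).2.dual (hmem p hp) (X p)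
  cases s
  · exact h0
  · refine SmoothAt.congr (hX.sub h0) (Eventually.of_forall fun p => ?_)
    rw [eq_sub_iff_add_eq, add_comm]
    exact Submodule.projection_add_projection_eq_self (hc p) (X p)

theorem exists_sec (s : Bool) {v : Tan n q} (hv : (C.splitData hc).pj s q v = v) :
    ∃ Y, (C.splitData hc).Sec s Y q ∧ Y q = v := by
  obtain ⟨X, rfl, V, hq, hX⟩ := exists_extension v
  exact ⟨fun p => (C.splitData hc).pj s p (X p), ⟨smoothAt_pj hn hP hc s (hX q hq),
    fun p => pj_idem hc s _⟩, hv⟩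

theorem isSplitting : (C.splitData hc).IsSplitting
    (Sum.isRight : (Fin 4 × Fin n) ⊕ Fin 3 → Bool) where
  smooth_G {q X Y} hX hY := by
    obtain ⟨U, hq, I, η, (F : C.Frame U I η)⟩ := C.local_frame q
    have h1 := C.smooth_γ q (fun p => (C.Q p).projectionOnto (P p) (hc p) (X p))
      (fun p => (C.Q p).projectionOnto (P p) (hc p) (Y p)) (smoothAt_pj hn hP hc false hX)
      (smoothAt_pj hn hP hc false hY)
    have h2 : SmoothFun n (fun p => ∑ a, η a p (X p) * η a p (Y p)) q := SmoothFun.sum fun a _ =>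
      ((F.smooth_η a).smoothFun hq hX).mul ((F.smooth_η a).smoothFun hq hY)
    refine SmoothFun.congr (SmoothFun.add h1 h2) ?_
    filter_upwards [mem_eventually U hq] with p hp
    rw [G_apply, F.perp_eq (by omega) hp]
  symm q u v := G_symm hc u v
  orth q s s' u v hs := by
    have key : ∀ u v : Tan n q, (C.splitData hc).G q ((C.splitData hc).pj true q u)
        ((C.splitData hc).pj false q v) = 0 := fun u v => by
      refine (G_Q hc _ ⟨_, pj_mem_false hc v⟩).trans ?_
      rw [Submodule.projectionOnto_apply_of_mem_right (hc q) (pj_mem_true hc u), map_zero,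
        LinearMap.zero_apply]
    cases s <;> cases s'
    · exact absurd rfl hs
    · rw [G_symm, key]
    · exact key u v
    · exact absurd rfl hs
  frame q := by
    obtain ⟨U, hq, I, η, (F : C.Frame U I η)⟩ := C.local_frame q
    obtain ⟨V, hqV, hVU, R, hR⟩ := F.exists_reeb_field hq
    obtain ⟨W, hqW, hWU, ε, hε⟩ := F.exists_adapted hq
    have hmem : ∀ p ∈ V, ∀ a, R a p ∈ P p := fun p hp a => by
      rw [hP.eq_span hn F (hVU hp) (hR p hp).2]
      exact Submodule.subset_span ⟨a, rfl⟩
    -- Frame fields must have their type at every point of `M`, whereas `R a` is known to lie in `P`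
    -- on `V` only. Projecting it to `P` changes nothing on `V`.
    let E : (Fin 4 × Fin n) ⊕ Fin 3 → ∀ p : M, Tan n p := Sum.elim (fun i p => (ε i p : Tan n p))
      fun a p => (C.splitData hc).pj true p (R a p)
    have hE : ∀ p ∈ V, ∀ a, E (Sum.inr a) p = R a p := fun p hp a =>
      (pj_true_iff hc _).2 (hmem p hp a)
    have gQ : ∀ p ∈ V, ∀ (v : Tan n p) a, (C.splitData hc).G p v (E (Sum.inr a) p) = η a p v := by
      intro p hp v a
      rw [hE p hp, G_P hc v ⟨_, hmem p hp a⟩, F.perp_eq (by omega) (hVU hp)]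
      simp [(hR p hp).2.dual _ a]
    have gε : ∀ (p : M) (v : Tan n p) i, (C.splitData hc).G p v (E (Sum.inl i) p) =
        C.γ p ((C.Q p).projectionOnto (P p) (hc p) v) (ε i p) := fun p v i => G_Q hc v (ε i p)
    refine ⟨V ⊓ W, ⟨hqV, hqW⟩, E, ⟨?_, ?_, ?_, ?_⟩⟩
    · rintro p ⟨hp, hp'⟩ (i | a)
      · exact (hε p hp').1 i
      · exact smoothAt_pj hn hP hc true ((hR p hp).1 a)
    · rintro p ⟨hp, hp'⟩ j (i | a)
      · rw [gε]
        rcases j with j | b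
        · change C.γ p ((C.Q p).projectionOnto (P p) (hc p) (ε j p : Tan n p)) _ = _
          rw [Submodule.projectionOnto_apply_left, (hε p hp').2.orth]
          simp
        · rw [hE p hp, Submodule.projectionOnto_apply_of_mem_right (hc p) (hmem p hp b)]
          simp
      · rw [gQ p hp]
        rcases j with j | b
        · exact (F.η_Q (hVU hp) a (ε j p)).trans (by simp)
        · rw [hE p hp, (hR p hp).2.dual]
          simp [eq_comm]
    · rintro p ⟨hp, hp'⟩ v
      rw [Fintype.sum_sum_type]
      simp only [gε, gQ p hp]
      simp only [hE p hp]
      have h1 := projectionOnto_coe hc F (hVU hp) (hR p hp).2.dual (hmem p hp) v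
      have h2 := congrArg Subtype.val
        ((hε p hp').2.eq_sum (finrank_Q p) ((C.Q p).projectionOnto (P p) (hc p) v))
      rw [← sub_eq_iff_eq_add, ← h1, h2]
      simp [E]
    · rintro (i | a) p
      · exact (pj_false_iff hc _).2 (ε i p).2
      · exact pj_idem hc true _

end Reeb

end QCStructure

end Contact

/-! ## The connection associated with the Reeb field -/

section Contact

set_option linter.unusedSectionVars false

variable {n : ℕ} {M : Type*} [TopologicalSpace M] [ChartedSpace (Mdl n) M]
  [IsManifold 𝓘(ℝ, Mdl n) ∞ M]

theorem torsion_eq_tor (D : Connection n M) {X Y : ∀ p : M, Tan n p} {q : M} (hX : DiffAt X q)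
    (hY : DiffAt Y q) : D.torsion q (X q) (Y q) = SplitData.tor (fun Y => D Y q) X Y :=
  CovariantDerivative.torsion_apply D hX hY

theorem torsion_swap (D : Connection n M) (q : M) (u v : Tan n q) :
    D.torsion q u v = -D.torsion q v u :=
  D.isCovariantDerivativeOn.torsion_antisymm u v

/-- A covariant derivative is only constrained on differentiable fields, so two connections are
compared by their difference tensor, which such fields determine. -/
theorem difference_eq_zero {D D' : Connection n M}
    (h : ∀ (q : M) (Y : ∀ p : M, Tan n p), DiffAt Y q → D Y q = D' Y q) : D.difference D' = 0 := by
  funext q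
  ext1 v
  obtain ⟨Y, rfl, V, hq, hY⟩ := exists_extension v
  have h1 := D.isCovariantDerivativeOnUniv.difference_apply D'.isCovariantDerivativeOnUniv
    (x := q) trivial (hY q hq).diffAt
  exact h1.trans (sub_eq_zero.2 (h q Y (hY q hq).diffAt))

namespace QCStructure

variable {C : QCStructure n M} {P : ∀ q : M, Submodule ℝ (Tan n q)}

theorem gPerp_eq (hn : 2 ≤ n) (hP : C.IsReebField P) {L : LocalData n M} (hL : L ∈ C.induced P)
    {q : M} (hq : q ∈ L.U) (u v : Tan n q) : gPerp L q u v = C.perp q u v := by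
  obtain ⟨I, h⟩ := exists_isInduced hn hP hL
  rw [Frame.perp_eq h.frame (by omega) hq, gPerp]

theorem exists_induced_at (hn : 2 ≤ n) (hP : C.IsReebField P) (q : M) :
    ∃ L ∈ C.induced P, q ∈ L.U :=
  (isQuaternionicPseudohermitian_induced hn hP).covers q

/-- With the metric `γ + ∑ η_a²` the conditions on `Q` and on `P` become instances of one condition.
In the mixed torsion condition with the fixed argument in `Q`, the arguments appear in the other
order, which changes the sign on both sides. -/
theorem isAssocAt_of_isAssociatedConnection (hn : 2 ≤ n) (hP : C.IsReebField P)
    (hc : ∀ q, IsCompl (C.Q q) (P q)) {D : Connection n M}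
    (hD : IsAssociatedConnection (C.induced P) C.Q C.γ P D) (q : M) :
    (C.splitData hc).IsAssocAt q (fun Y => D Y q) where
  add hY hZ := D.isCovariantDerivativeOnUniv.add hY hZ
  leibniz {Y f} hY hf v := by
    have h := D.isCovariantDerivativeOnUniv.leibniz hY hf (x := q) trivial
    exact DFunLike.congr_fun h v
  pres {s Y} hY v := by
    cases s
    · have h := (sec_false_iff hc).1 hY
      exact (pj_false_iff hc _).2 (hD.preserves_Q q (fun p => ⟨Y p, h.2 p⟩) h.1 v)
    · have h := (sec_true_iff hc).1 hY
      exact (pj_true_iff hc _).2 (hD.preserves_P q (fun p => ⟨Y p, h.2 p⟩) h.1 v)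
  metric {s Y Z} hY hZ v := by
    cases s
    · have h := (sec_false_iff hc).1 hY
      have h' := (sec_false_iff hc).1 hZ
      have e := hD.parallel_g q (fun p => ⟨Y p, h.2 p⟩) (fun p => ⟨Z p, h'.2 p⟩) h.1 h'.1 v
      rw [← G_Q_Q hc, ← G_Q_Q hc] at e
      refine Eq.trans (dirDeriv_congr (Eventually.of_forall fun p => ?_) v) e
      exact G_Q_Q hc ⟨Y p, h.2 p⟩ ⟨Z p, h'.2 p⟩
    · have h := (sec_true_iff hc).1 hY
      have h' := (sec_true_iff hc).1 hZ
      obtain ⟨L, hL, hq⟩ := exists_induced_at hn hP q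
      have e := hD.parallel_gPerp L hL q hq (fun p => ⟨Y p, h.2 p⟩) (fun p => ⟨Z p, h'.2 p⟩)
        h.1 h'.1 v
      have e1 := G_P hc (D Y q v) ⟨Z q, h'.2 q⟩
      have e2 := G_P hc (D Z q v) ⟨Y q, h.2 q⟩
      rw [gPerp_eq hn hP hL hq, gPerp_eq hn hP hL hq, perp_symm C q (Y q)] at e
      rw [G_symm hc (Y q)]
      refine Eq.trans (dirDeriv_congr ?_ v) (e.trans (by rw [← e1, ← e2]))
      filter_upwards [mem_eventually L.U hq] with p hp
      rw [gPerp_eq hn hP hL hp]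
      exact G_P hc (Y p) ⟨Z p, h'.2 p⟩
  tor_same {s X Y Z} hX hY hZ := by
    rw [← torsion_eq_tor D hX.1.diffAt hY.1.diffAt]
    cases s
    · have h := (sec_false_iff hc).1 hX
      have h' := (sec_false_iff hc).1 hY
      have h'' := (sec_false_iff hc).1 hZ
      refine (G_Q hc _ ⟨Z q, h''.2 q⟩).trans ?_
      have e := hD.tor_a q ⟨X q, h.2 q⟩ ⟨Y q, h'.2 q⟩
      rw [e, map_zero, LinearMap.zero_apply]
    · have h := (sec_true_iff hc).1 hX
      have h' := (sec_true_iff hc).1 hY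
      have h'' := (sec_true_iff hc).1 hZ
      refine (G_P hc _ ⟨Z q, h''.2 q⟩).trans ?_
      have e := hD.tor_b q ⟨X q, h.2 q⟩ ⟨Y q, h'.2 q⟩
      rw [← perp_projectionOnto hc]
      exact (congrArg (fun x : P q => C.perp q (x : Tan n q) (Z q)) e).trans
        (by rw [Submodule.coe_zero, map_zero, LinearMap.zero_apply])
  tor_mixed {s s' V X Y} hs hV hX hY := by
    rw [← torsion_eq_tor D hV.1.diffAt hX.1.diffAt, ← torsion_eq_tor D hV.1.diffAt hY.1.diffAt]
    rw [G_symm hc (X q)]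
    cases s <;> cases s'
    · exact absurd rfl hs
    · have h := (sec_true_iff hc).1 hV
      have h' := (sec_false_iff hc).1 hX
      have h'' := (sec_false_iff hc).1 hY
      have e := hD.tor_c q ⟨V q, h.2 q⟩ ⟨X q, h'.2 q⟩ ⟨Y q, h''.2 q⟩
      rw [C.symm q ⟨X q, h'.2 q⟩] at e
      exact (G_Q hc _ ⟨Y q, h''.2 q⟩).trans (e.trans (G_Q hc _ ⟨X q, h'.2 q⟩).symm)
    · have h := (sec_false_iff hc).1 hV
      have h' := (sec_true_iff hc).1 hX
      have h'' := (sec_true_iff hc).1 hY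
      obtain ⟨L, hL, hq⟩ := exists_induced_at hn hP q
      have e := hD.tor_d L hL q hq ⟨V q, h.2 q⟩ ⟨X q, h'.2 q⟩ ⟨Y q, h''.2 q⟩
      rw [gPerp_eq hn hP hL hq, gPerp_eq hn hP hL hq, perp_symm C q (X q), perp_projectionOnto hc,
        perp_projectionOnto hc, torsion_swap, torsion_swap D q (Y q)] at e
      refine (G_P hc _ ⟨Y q, h''.2 q⟩).trans (Eq.trans ?_ (G_P hc _ ⟨X q, h'.2 q⟩).symm)
      simpa only [map_neg, LinearMap.neg_apply, neg_inj] using e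
    · exact absurd rfl hs

theorem isAssociatedConnection_of_isAssocAt (hn : 2 ≤ n) (hP : C.IsReebField P)
    (hc : ∀ q, IsCompl (C.Q q) (P q)) {D : Connection n M}
    (hs : CovariantDerivative.ContMDiffCovariantDerivative D ∞)
    (hD : ∀ q, (C.splitData hc).IsAssocAt q (fun Y => D Y q)) :
    IsAssociatedConnection (C.induced P) C.Q C.γ P D where
  smooth := hs
  compl := hc
  preserves_Q q Y hY v := (pj_false_iff hc _).1
    ((hD q).pres ((sec_false_iff hc).2 ⟨hY, fun p => (Y p).2⟩) v)
  preserves_P q Y hY v := (pj_true_iff hc _).1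
    ((hD q).pres ((sec_true_iff hc).2 ⟨hY, fun p => (Y p).2⟩) v)
  parallel_g q Y Z hY hZ v := by
    have e := (hD q).metric ((sec_false_iff hc).2 ⟨hY, fun p => (Y p).2⟩)
      ((sec_false_iff hc).2 ⟨hZ, fun p => (Z p).2⟩) v
    rw [← G_Q_Q hc, ← G_Q_Q hc]
    refine Eq.trans (dirDeriv_congr (Eventually.of_forall fun p => ?_) v) e
    exact (G_Q_Q hc (Y p) (Z p)).symm
  parallel_gPerp L hL q hq Y Z hY hZ v := by
    have e := (hD q).metric ((sec_true_iff hc).2 ⟨hY, fun p => (Y p).2⟩)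
      ((sec_true_iff hc).2 ⟨hZ, fun p => (Z p).2⟩) v
    rw [gPerp_eq hn hP hL hq, gPerp_eq hn hP hL hq, perp_symm C q (Y q), ← G_P hc, ← G_P hc]
    rw [G_symm hc (Y q : Tan n q)] at e
    refine Eq.trans (dirDeriv_congr ?_ v) e
    filter_upwards [mem_eventually L.U hq] with p hp
    rw [gPerp_eq hn hP hL hp, ← G_P hc]
  tor_a q x y := by
    obtain ⟨X, hX, hx⟩ := exists_sec hn hP hc false ((pj_false_iff hc _).2 x.2)
    obtain ⟨Y, hY, hy⟩ := exists_sec hn hP hc false ((pj_false_iff hc _).2 y.2)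
    rw [← hx, ← hy, torsion_eq_tor D hX.1.diffAt hY.1.diffAt]
    -- The torsion component is paired with an extension of itself; positivity of `γ` concludes, and
    -- on `P` the sum of squares of the forms plays this role.
    by_contra h0
    refine (C.pos q _ h0).ne' ?_
    set z := (C.Q q).projectionOnto (P q) (hc q) (SplitData.tor (fun Y => D Y q) X Y) with hz
    obtain ⟨Z, hZ, hz'⟩ := exists_sec hn hP hc false ((pj_false_iff hc _).2 z.2)
    have e := (hD q).tor_same hX hY hZ
    rw [hz', G_Q hc] at e
    exact e
  tor_b q x y := by
    obtain ⟨X, hX, hx⟩ := exists_sec hn hP hc true ((pj_true_iff hc _).2 x.2)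
    obtain ⟨Y, hY, hy⟩ := exists_sec hn hP hc true ((pj_true_iff hc _).2 y.2)
    rw [← hx, ← hy, torsion_eq_tor D hX.1.diffAt hY.1.diffAt]
    set z := (P q).projectionOnto (C.Q q) (hc q).symm (SplitData.tor (fun Y => D Y q) X Y) with hz
    obtain ⟨Z, hZ, hz'⟩ := exists_sec hn hP hc true ((pj_true_iff hc _).2 z.2)
    have e := (hD q).tor_same hX hY hZ
    rw [hz', G_P hc, ← perp_projectionOnto hc, ← hz] at e
    obtain ⟨U, hq, I, η, (F : C.Frame U I η)⟩ := C.local_frame q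
    rw [F.perp_eq (by omega) hq, Finset.sum_eq_zero_iff_of_nonneg fun a _ => mul_self_nonneg _] at e
    have hzQ : (z : Tan n q) ∈ C.Q q :=
      (F.ker q hq _).2 fun a => mul_self_eq_zero.1 (e a (Finset.mem_univ a))
    exact Subtype.ext ((Submodule.disjoint_def.1 (hc q).disjoint) _ hzQ z.2)
  tor_c q v x y := by
    obtain ⟨V, hV, hv⟩ := exists_sec hn hP hc true ((pj_true_iff hc _).2 v.2)
    obtain ⟨X, hX, hx⟩ := exists_sec hn hP hc false ((pj_false_iff hc _).2 x.2)
    obtain ⟨Y, hY, hy⟩ := exists_sec hn hP hc false ((pj_false_iff hc _).2 y.2)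
    have e := (hD q).tor_mixed (by decide) hV hX hY
    rw [G_symm hc (X q), ← torsion_eq_tor D hV.1.diffAt hX.1.diffAt,
      ← torsion_eq_tor D hV.1.diffAt hY.1.diffAt, hv, hx, hy, G_Q hc, G_Q hc] at e
    rw [e, C.symm]
  tor_d L hL q hq x v w := by
    obtain ⟨X, hX, hx⟩ := exists_sec hn hP hc false ((pj_false_iff hc _).2 x.2)
    obtain ⟨V, hV, hv⟩ := exists_sec hn hP hc true ((pj_true_iff hc _).2 v.2)
    obtain ⟨W, hW, hw⟩ := exists_sec hn hP hc true ((pj_true_iff hc _).2 w.2)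
    have e := (hD q).tor_mixed (by decide) hX hV hW
    rw [G_symm hc (V q), ← torsion_eq_tor D hX.1.diffAt hV.1.diffAt,
      ← torsion_eq_tor D hX.1.diffAt hW.1.diffAt, hv, hx, hw, G_P hc, G_P hc] at e
    rw [gPerp_eq hn hP hL hq, gPerp_eq hn hP hL hq, perp_symm C q v, perp_projectionOnto hc,
        perp_projectionOnto hc, torsion_swap, torsion_swap D q w]
    simpa only [map_neg, LinearMap.neg_apply, neg_inj] using e

/-- The connection associated with the Reeb field exists. -/
theorem exists_isAssociatedConnection (hn : 2 ≤ n) (hP : C.IsReebField P) :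
    ∃ D : Connection n M, IsAssociatedConnection (C.induced P) C.Q C.γ P D := by
  have hc := hP.isCompl hn
  obtain ⟨D, hs, hD⟩ := SplitData.exists_connection (isSplitting hn hP hc)
  exact ⟨D, isAssociatedConnection_of_isAssocAt hn hP hc hs hD⟩

theorem difference_associated_eq_zero (hn : 2 ≤ n) (hP : C.IsReebField P) {D D' : Connection n M}
    (hD : IsAssociatedConnection (C.induced P) C.Q C.γ P D)
    (hD' : IsAssociatedConnection (C.induced P) C.Q C.γ P D') : D.difference D' = 0 := by
  have hc := hP.isCompl hn
  exact difference_eq_zero fun q Y hY => (isAssocAt_of_isAssociatedConnection hn hP hc hD q).unique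
    (isSplitting hn hP hc) (isAssocAt_of_isAssociatedConnection hn hP hc hD' q) hY

end QCStructure

end Contact

/-! ## The canonical three-plane field -/

section Contact

set_option linter.unusedSectionVars false

variable {n : ℕ} {M : Type*} [TopologicalSpace M] [ChartedSpace (Mdl n) M]
  [IsManifold 𝓘(ℝ, Mdl n) ∞ M]

namespace QCStructure

variable {C : QCStructure n M} {𝒜 : Set (LocalData n M)} {P : ∀ q : M, Submodule ℝ (Tan n q)}
  {D : Connection n M} {q : M} {ε : Fin 4 × Fin n → ∀ p : M, C.Q p} {w : Tensor3 n}
  {U : Opens M} {I : Fin 3 → ∀ q : M, Module.End ℝ (C.Q q)}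
  {η : Fin 3 → ∀ q : M, Tan n q →L[ℝ] ℝ}

theorem isSkew_of_associated (hD : IsAssociatedConnection 𝒜 C.Q C.γ P D)
    (hε : ∀ i, C.SmoothSec (ε i) q)
    (ho : ∀ᶠ p in 𝓝 q, ∀ i j, C.γ p (ε i p) (ε j p) = if i = j then 1 else 0)
    (hw : ∀ i j, D (fun p => (ε j p : Tan n p)) q (ε i q) = ∑ k, w (i, j, k) • (ε k q : Tan n q)) :
    IsSkew w := by
  intro i j k
  have h1 : ∀ j (hv : D (fun p => (ε j p : Tan n p)) q (ε i q) ∈ C.Q q),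
      (⟨_, hv⟩ : C.Q q) = ∑ k, w (i, j, k) • ε k q := fun j hv =>
    Subtype.ext ((hw i j).trans (by simp))
  have e := hD.parallel_g q (ε j) (ε k) (hε j) (hε k) (ε i q)
  rw [dirDeriv_congr (g := fun _ => if j = k then 1 else 0) (ho.mono fun p hp => hp j k),
    dirDeriv_const, h1, h1] at e
  simp only [map_sum, map_smul, LinearMap.sum_apply, LinearMap.smul_apply,
    ho.self_of_nhds, smul_eq_mul] at e
  simp at e
  linarith

/-- Since the torsion of two sections of `Q` lies in `P`, the `Q`-part of a bracket is the
antisymmetrized connection; the coefficients along `t` are read off with `η_br`. -/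
theorem Frame.br_of_associated (F : C.Frame U I η) (hq : q ∈ U)
    (hD : IsAssociatedConnection 𝒜 C.Q C.γ P D) (hε : ∀ i, C.SmoothSec (ε i) q)
    (had : IsAdaptedBasis (C.γ q) (fun a => I a q) (fun i => ε i q))
    (hw : ∀ i j, D (fun p => (ε j p : Tan n p)) q (ε i q) = ∑ k, w (i, j, k) • (ε k q : Tan n q))
    {t : Fin 3 → Tan n q} (ht : IsDual η q t) (hP : P q = Submodule.span ℝ (range t))
    (i j : Fin 4 × Fin n) :
    br (fun p => (ε i p : Tan n p)) (fun p => (ε j p : Tan n p)) q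
      = ∑ l, (w (i, j, l) - w (j, i, l)) • (ε l q : Tan n q) - ∑ b, modelJ n b j i • t b := by
  have h1 := torsion_eq_tor D (SmoothAt.diffAt (hε i)) (SmoothAt.diffAt (hε j))
  have h2 : D.torsion q (ε i q) (ε j q) ∈ P q :=
    (Submodule.projectionOnto_apply_eq_zero_iff (hD.compl q)).1 (hD.tor_a q (ε i q) (ε j q))
  rw [hP] at h2
  obtain ⟨c, hc⟩ := (Submodule.mem_span_range_iff_exists_fun ℝ).1 h2
  rw [SplitData.tor, hw, hw, ← hc] at h1
  have h3 : ∀ b, c b = modelJ n b j i := by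
    intro b
    have e := congrArg (η b q) h1
    rw [ht.sum, map_sub, F.η_br hq (hε i) (hε j), had.γ_I (F.isQuatHerm hq)] at e
    simpa [F.η_Q hq] using e
  rw [eq_sub_iff_add_eq] at h1 ⊢
  simp only [← h3, sub_smul, Finset.sum_sub_distrib]
  rw [add_comm, h1]

/-- Here the connection enters the algebra: its coefficients satisfy the structure equations with
`α_aa = κ`, and metric compatibility makes them skew. -/
theorem Frame.ehForm_of_associated (F : C.Frame U I η) (hn : 2 ≤ n) (hq : q ∈ U)
    (hD : IsAssociatedConnection 𝒜 C.Q C.γ P D) (hε : ∀ i, C.SmoothSec (ε i) q)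
    (had : ∀ᶠ p in 𝓝 q, IsAdaptedBasis (C.γ p) (fun a => I a p) (fun i => ε i p))
    (hw : ∀ i j, D (fun p => (ε j p : Tan n p)) q (ε i q) = ∑ k, w (i, j, k) • (ε k q : Tan n q))
    {t : Fin 3 → Tan n q} (ht : IsDual η q t) (hP : P q = Submodule.span ℝ (range t))
    {κ : C.Q q →ₗ[ℝ] ℝ} (hκ : ∀ a, ∀ x : C.Q q, dForm (η a) q (t a) x = κ x)
    (z : Fin 4 × Fin n → ℝ) :
    n * ehForm w z = -3 * (2 * n + 1) * (n - 1) * κ (lc (fun i => ε i q) z) := by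
  refine ehForm_eq_of_structEq hn (isSkew_of_associated hD hε (had.mono fun p hp => hp.orth) hw)
    (κ := κ ∘ₗ lc (fun i => ε i q)) (fun a => F.structEq_of_bracket hq hε had
      (F.br_of_associated hq hD hε had.self_of_nhds hw ht hP) a) (fun a => ?_) z
  refine LinearMap.ext fun x => ?_
  rw [Frame.alpha_apply, hκ]
  rfl

theorem IsInduced.isAdaptedFrameAt_iff {L : LocalData n M} (h : C.IsInduced L I) (hq : q ∈ L.U) :
    IsAdaptedFrameAt L C.Q C.γ q ε ↔ (∀ i, C.SmoothSec (ε i) q) ∧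
      ∀ᶠ p in 𝓝 q, IsAdaptedBasis (C.γ p) (fun a => I a p) (fun i => ε i p) := by
  constructor
  · intro hε
    refine ⟨hε.smooth, ?_⟩
    filter_upwards [hε.orthonormal, hε.adapted, mem_eventually L.U hq] with p h1 h2 hp
    exact ⟨h1, fun a k => Subtype.ext ((h2 a k).trans (h.ap_Q hp a _))⟩
  · rintro ⟨h1, h2⟩
    refine ⟨h1, h2.mono fun p hp => hp.orth, ?_⟩
    filter_upwards [h2, mem_eventually L.U hq] with p h2 hp a k
    rw [h.ap_Q hp, h2.adapted]

variable (hn : 2 ≤ n) (hP : C.IsReebField P)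

include hn hP

/-- For the Reeb triple `κ = 0`, so `ehForm` vanishes. -/
theorem ehVanishes_reeb (hD : IsAssociatedConnection (C.induced P) C.Q C.γ P D) :
    EHVanishes (C.induced P) C.Q C.γ D := by
  intro L hL q hq ε hε w hw
  obtain ⟨I, h⟩ := exists_isInduced hn hP hL
  obtain ⟨h1, h2⟩ := (h.isAdaptedFrameAt_iff hq).1 hε
  obtain ⟨t, ht⟩ := Frame.exists_reeb h.frame hq
  rw [omegaEH_eq_zero_iff hn (isSkew_of_associated hD h1 hε.orthonormal hw)]
  intro z
  have e := Frame.ehForm_of_associated h.frame hn hq hD h1 h2 hw ht.dual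
    (hP.eq_span hn h.frame hq ht) (κ := 0) (fun a x => ht.reeb a x) z
  rw [LinearMap.zero_apply, mul_zero, mul_eq_zero] at e
  exact e.resolve_left (by positivity)

theorem satisfiesEH_reeb : SatisfiesEH (C.induced P) C.Q C.γ P := by
  obtain ⟨D, hD⟩ := exists_isAssociatedConnection hn hP
  exact ⟨isAdmissible_reeb hn hP, D, hD, ehVanishes_reeb hn hP hD⟩

/-- An admissible plane field is the Reeb plane tilted by some `r` in `Q`. The tilt makes `ehForm` a
multiple of `γ(r, ·)` whose constant is nonzero for `n ≥ 2`, so the vanishing condition forces `r =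
0`. -/
theorem eq_of_satisfiesEH {P' : ∀ q : M, Submodule ℝ (Tan n q)}
    (hP' : SatisfiesEH (C.induced P) C.Q C.γ P') : P' = P := by
  obtain ⟨hadm, D, hD, hEH⟩ := hP'
  funext q
  obtain ⟨L, hL, hq⟩ := exists_induced_at hn hP q
  obtain ⟨I, h⟩ := exists_isInduced hn hP hL
  have hh := Frame.isQuatHerm h.frame hq
  obtain ⟨T, hT⟩ := hadm L hL
  obtain ⟨-, hTa, hTs⟩ := hT q hq
  obtain ⟨t, ht⟩ := Frame.exists_reeb h.frame hq
  obtain ⟨f, r, hf, hTt⟩ := h.admissible_eq hq ht hTa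
  -- Dividing the admissible triple by the factor `f` gives a triple dual to the forms without
  -- changing the plane.
  let s : Fin 3 → Tan n q := fun a => t a + (I a q r : Tan n q)
  have hTs' : ∀ a, T a q = f • s a := fun a => by rw [hTt a, smul_add]
  have hs : IsDual L.θ q s := fun a b => by
    rw [map_add, Frame.η_Q h.frame hq, add_zero, ht.dual]
  have hspan : P' q = Submodule.span ℝ (range s) := by
    rw [hTs]
    simp only [hTs']
    refine le_antisymm (Submodule.span_le.2 ?_) (Submodule.span_le.2 ?_)
    · rintro _ ⟨a, rfl⟩
      exact Submodule.smul_mem _ _ (Submodule.subset_span ⟨a, rfl⟩)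
    · rintro _ ⟨a, rfl⟩
      rw [← inv_smul_smul₀ hf (s a)]
      exact Submodule.smul_mem _ _ (Submodule.subset_span ⟨a, rfl⟩)
  -- The Reeb part contributes nothing and `I_a² = -1` removes the index: the three diagonal forms
  -- share the value `-γ(r, ·)`.
  have hκ : ∀ a, ∀ x : C.Q q, dForm (L.θ a) q (s a) x = (-C.γ q r) x := fun a x => by
    rw [(h.frame.smooth_η a).dForm_add_left hq, ht.reeb, zero_add, ← h.frame.compat q hq, hh.sq,
      map_neg]
  obtain ⟨W, hqW, hWU, ε, hε⟩ := Frame.exists_adapted h.frame hq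
  have h1 := (hε q hqW).1
  have h2 : ∀ᶠ p in 𝓝 q, IsAdaptedBasis (C.γ p) (fun a => I a p) (fun i => ε i p) :=
    (mem_eventually W hqW).mono fun p hp => (hε p hp).2
  let w : Tensor3 n := WithLp.toLp 2 fun m =>
    C.γ q ⟨_, hD.preserves_Q q (ε m.2.1) (h1 m.2.1) (ε m.1 q)⟩ (ε m.2.2 q)
  have hw : ∀ i j, D (fun p => (ε j p : Tan n p)) q (ε i q)
      = ∑ k, w (i, j, k) • (ε k q : Tan n q) := fun i j => by
    have e := congrArg Subtype.val (h2.self_of_nhds.eq_sum (finrank_Q q)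
      ⟨_, hD.preserves_Q q (ε j) (h1 j) (ε i q)⟩)
    refine e.trans ?_
    simp [w]
  have hw0 := hEH L hL q hq ε ((h.isAdaptedFrameAt_iff hq).2 ⟨h1, h2⟩) w hw
  rw [omegaEH_eq_zero_iff hn (isSkew_of_associated hD h1 (h2.mono fun p hp => hp.orth) hw)] at hw0
  have hr : r = 0 := by
    refine hh.eq_zero_of_forall fun y => ?_
    have e := Frame.ehForm_of_associated h.frame hn hq hD h1 h2 hw hs hspan hκ
      (fun i => C.γ q y (ε i q))
    rw [hw0, mul_zero, h2.self_of_nhds.lc_γ (finrank_Q q) y, LinearMap.neg_apply] at e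
    have hn' : (2 : ℝ) ≤ n := by exact_mod_cast hn
    have h3 : (-3 * (2 * n + 1) * (n - 1) : ℝ) ≠ 0 :=
      mul_ne_zero (mul_ne_zero (by norm_num) (by positivity)) (by linarith)
    exact neg_eq_zero.1 ((mul_eq_zero.1 e.symm).resolve_left h3)
  rw [hspan, hP.eq_span hn h.frame hq ht]
  congr 2
  funext a
  simp [s, hr]

theorem isCanonicalThreePlaneField_reeb :
    IsCanonicalThreePlaneField (C.induced P) C.Q C.γ P :=
  ⟨satisfiesEH_reeb hn hP, fun _ h => eq_of_satisfiesEH hn hP h⟩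

theorem difference_canonical_eq_zero {D D' : Connection n M}
    (hD : IsCanonicalConnection (C.induced P) C.Q C.γ D)
    (hD' : IsCanonicalConnection (C.induced P) C.Q C.γ D') : D.difference D' = 0 := by
  obtain ⟨P₁, h₁, hD⟩ := hD
  obtain ⟨P₂, h₂, hD'⟩ := hD'
  rw [eq_of_satisfiesEH hn hP h₁.1] at hD
  rw [eq_of_satisfiesEH hn hP h₂.1] at hD'
  exact difference_associated_eq_zero hn hP hD hD'

end QCStructure

end Contact

end QuaternionicCR

end

theorem proposition5p1 {n : ℕ} (hn : 2 ≤ n) {M : Type*} [TopologicalSpace M] [T2Space M]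
    [SecondCountableTopology M] [ChartedSpace (QuaternionicCR.Mdl n) M]
    [IsManifold 𝓘(ℝ, QuaternionicCR.Mdl n) ∞ M] (C : QuaternionicCR.QCStructure n M) :
    (∃! P : ∀ q : M, Submodule ℝ (QuaternionicCR.Tan n q), C.IsReebField P) ∧
    ∀ P : ∀ q : M, Submodule ℝ (QuaternionicCR.Tan n q), C.IsReebField P →
      QuaternionicCR.IsQuaternionicPseudohermitian (C.induced P) C.Q C.γ ∧
      QuaternionicCR.IsUltraPseudoconvex (C.induced P) C.Q C.γ ∧
      QuaternionicCR.IsCanonicalThreePlaneField (C.induced P) C.Q C.γ P ∧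
      (∃ D : QuaternionicCR.Connection n M,
        QuaternionicCR.IsAssociatedConnection (C.induced P) C.Q C.γ P D) ∧
      (∀ D : QuaternionicCR.Connection n M,
        QuaternionicCR.IsAssociatedConnection (C.induced P) C.Q C.γ P D →
        QuaternionicCR.IsCanonicalConnection (C.induced P) C.Q C.γ D) ∧
      (∀ D D' : QuaternionicCR.Connection n M,
        QuaternionicCR.IsCanonicalConnection (C.induced P) C.Q C.γ D →
        QuaternionicCR.IsCanonicalConnection (C.induced P) C.Q C.γ D' →
        D.difference D' = 0) := by
  refine ⟨QuaternionicCR.QCStructure.exists_reebField C hn, fun P hP => ?_⟩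
  have hcan := QuaternionicCR.QCStructure.isCanonicalThreePlaneField_reeb hn hP
  exact ⟨QuaternionicCR.QCStructure.isQuaternionicPseudohermitian_induced hn hP,
    QuaternionicCR.QCStructure.isUltraPseudoconvex_induced hn hP, hcan,
    QuaternionicCR.QCStructure.exists_isAssociatedConnection hn hP, fun D hD => ⟨P, hcan, hD⟩,
    fun D D' hD hD' => QuaternionicCR.QCStructure.difference_canonical_eq_zero hn hP hD hD'⟩
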